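/- For a graph $G$ with distance $d_G$ and an integer $c\ge 1$, a \emph{packing $c$-coloring} of $G$ is a map $f$ from $V(G)$ onto $\{1,\dots,c\}$ such that any two distinct vertices $u,v$ with $f(u)=f(v)=i$ satisfy $d_G(u,v)>i$. The \emph{packing chromatic number} $\chi_\rho(G)$ is the smallest $c$ for which $G$ has a packing $c$-coloring. The base-3 Sierpiński graphs $S^n$ are defined by $S^0=K_1$ and, for $n\ge 1$, $V(S^n)=\{0,1,2\}^n$ and $$E(S^n)=\{\{is,it\} : i\in\{0,1,2\},\ \{s,t\}\in E(S^{n-1})\}\cup\{\{ij^{n-1},ji^{n-1}\} : i,j\in\{0,1,2\},\ i\ne j\}.$$ For $n\ge 0$, the Sierpiński triangle graph $ST_3^n$ is the simple graph obtained from $S^{n+1}$ by contracting all non-clique edges, i.e. all edges that lie in no triangle. \textbf{Theorem.} (i) $\chi_\rho(ST_3^0)=3$, $\chi_\rho(ST_3^1)=4$, $\chi_\rho(ST_3^2)=8$ and $\chi_\rho(ST_3^3)=12$. (ii) $12\le\chi_\rho(ST_3^4)\le 15$. (iii) $12\le\chi_\rho(ST_3^5)\le 19$. (iv) For every $n\ge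 6$, $12\le\chi_\rho(ST_3^n)\le 20$. -/

import Mathlib

namespace SierpinskiPacking

/-- The base-3 Sierpiński graph `S^n` on the words of length `n` over a three-letter alphabet.
`S^0` is the one-vertex graph; two words of length `n + 1` are adjacent if either they have the
same first letter and their tails are adjacent in `S^n`, or they are `i j ⋯ j` and `j i ⋯ i` for
distinct letters `i`, `j`. -/
def sierpinskiGraph : (n : ℕ) → SimpleGraph (Fin n → Fin 3)
  | 0 => ⊥
  | n + 1 =>
    { Adj := fun u v =>
        (u 0 = v 0 ∧ (sierpinskiGraph n).Adj (Fin.tail u) (Fin.tail v)) ∨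
          (u 0 ≠ v 0 ∧ (∀ k, Fin.tail u k = v 0) ∧ (∀ k, Fin.tail v k = u 0))
      symm := ⟨fun _ _ h => h.elim
        (fun h => Or.inl ⟨h.1.symm, h.2.symm⟩)
        (fun h => Or.inr ⟨h.1.symm, h.2.2, h.2.1⟩)⟩
      loopless := ⟨fun _ h => h.elim (fun h => h.2.ne rfl) (fun h => h.1 rfl)⟩ }

/-- `uv` is a non-clique edge of `G`: an edge that lies in no triangle. -/
def IsNonCliqueEdge {V : Type*} (G : SimpleGraph V) (u v : V) : Prop :=
  G.Adj u v ∧ ∀ w, ¬ (G.Adj u w ∧ G.Adj v w)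

/-- The equivalence relation on `V` whose classes are merged into single vertices when all edges
`uv` with `r u v` are contracted. -/
def contractionSetoid {V : Type*} (r : V → V → Prop) : Setoid V := Relation.EqvGen.setoid r

/-- The simple graph obtained from `G` by contracting all pairs related by `r`: distinct classes
are adjacent if some representatives are adjacent in `G`. -/
def contract {V : Type*} (G : SimpleGraph V) (r : V → V → Prop) :
    SimpleGraph (Quotient (contractionSetoid r)) :=
  G.map (Quotient.mk (contractionSetoid r))

/-- The Sierpiński triangle graph `ST_3^n`, obtained from `S^{n+1}` by contracting all non-clique
edges. -/
def sierpinskiTriangleGraph (n : ℕ) :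
    SimpleGraph (Quotient (contractionSetoid (IsNonCliqueEdge (sierpinskiGraph (n + 1))))) :=
  contract (sierpinskiGraph (n + 1)) (IsNonCliqueEdge (sierpinskiGraph (n + 1)))

/-- `f` is a packing `c`-coloring of `G`: it maps the vertex set onto `{1, …, c}`, and any two
distinct vertices of the same color `i` are at distance greater than `i`. -/
def IsPackingColoring {V : Type*} (G : SimpleGraph V) (c : ℕ) (f : V → ℕ) : Prop :=
  Set.range f = Set.Icc 1 c ∧ ∀ u v, u ≠ v → f u = f v → (f u : ℕ∞) < G.edist u v

/-- The packing chromatic number: the least `c` for which `G` has a packing `c`-coloring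
(`⊤` if there is none). -/
noncomputable def packingChromaticNumber {V : Type*} (G : SimpleGraph V) : ℕ∞ :=
  ⨅ (c : ℕ) (_ : ∃ f : V → ℕ, IsPackingColoring G c f), (c : ℕ∞)

end SierpinskiPacking

/-! Everything rests on an explicit distance formula. The graph ST_3^{n+1} consists of three copies
of ST_3^n, any two of them sharing a corner. A geodesic between two copies therefore either passes
through the shared corner or crosses the third copy, whose corners are 2^n apart; inside one copy,
distances are those of the copy. `edist_vertex` proves this formula on words, and all later
arguments use only `wordDist`.

The upper bounds come from explicit colorings stored as trees. That a class of color c is a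
c-packing is checked recursively: two copies interact only through their shared corner and through
the third copy, so for each copy it suffices to know lower bounds on the distances from the class to
the three corners (`ClassBounds.glue`, `Tri.classBounds`). For n ≥ 6 a single 20-coloring of ST_3^6
is enough: its corners have the same color, so its copies can be glued again and again, and since 20
< 2^6 only elements near a common corner can conflict (`Tri.packingChromaticNumber_add_le`).

For the lower bound 12, ST_3^3 embeds isometrically into ST_3^n for n ≥ 3, so it suffices to exclude
11 colors on its 42 vertices (`not_good`). Call a color large if it is at least 4. Each copy of
ST_3^2 has diameter 4, so a large color occurs at most three times; ST_3^3 has diameter 8, so the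
colors 8 to 11 occur at most once. Hence at most 16 vertices are large. On the other side, colors 1,
2, 3 cannot cover many vertices, and an exhaustive search over these three colors measures this: -
three vertices of color 7 would be the three corners, but no coloring with large corners has at most
16 large vertices, so color 7 occurs at most twice; - three vertices of color 6 contain a corner or
form, up to reflection, one particular triple. With these vertices large, at least 15 vertices are
large, so every large class has its maximal size, and the classes 5, 6, 7 do not fit into any set of
15 vertices that the search finds; so color 6 occurs at most twice; - now at most 14 vertices can be
large, and the same contradiction arises. The search is a kernel computation whose soundness is
`search_sound`. The bounds 8 and 4 use it on ST_3^2 and ST_3^1. -/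

namespace SierpinskiPacking

/-! ### Distances in the Sierpiński triangle graphs -/

/-- The words of length `n + 1`, which represent the vertices of `ST_3^n`. -/
abbrev Word (n : ℕ) := Fin (n + 1) → Fin 3

/-- The vertex of `ST_3^n` represented by a word. -/
def vertex {n : ℕ} (u : Word n) :
    Quotient (contractionSetoid (IsNonCliqueEdge (sierpinskiGraph (n + 1)))) :=
  Quotient.mk _ u

/-- The distance from the vertex represented by `u` to the corner `j` of `ST_3^n`. -/
def cornerDist : (n : ℕ) → Fin 3 → Word n → ℕ
  | 0, j, u => if u 0 = j then 0 else 1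
  | n + 1, j, u => (if u 0 = j then 0 else 2 ^ n) + cornerDist n j (Fin.tail u)

/-- The letter different from two given distinct letters. -/
def third (a b : Fin 3) : Fin 3 := -(a + b)

/-- The distance in `ST_3^n` between the vertices represented by two words. -/
def wordDist : (n : ℕ) → Word n → Word n → ℕ
  | 0, u, v => if u 0 = v 0 then 0 else 1
  | n + 1, u, v =>
    if u 0 = v 0 then wordDist n (Fin.tail u) (Fin.tail v)
    -- Directly through the shared corner, or across the third copy between two corners at distance
    -- `2 ^ n`.
    else min (cornerDist n (v 0) (Fin.tail u) + cornerDist n (u 0) (Fin.tail v))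
      (cornerDist n (third (u 0) (v 0)) (Fin.tail u) + 2 ^ n +
        cornerDist n (third (u 0) (v 0)) (Fin.tail v))

/-- The word representing the corner `j`. -/
def corner (n : ℕ) (j : Fin 3) : Word n := fun _ => j

/-- Prefixing a letter to a word. -/
def pre {n : ℕ} (i : Fin 3) (u : Word n) : Word (n + 1) := Fin.cons i u

@[simp] lemma pre_zero {n : ℕ} (i : Fin 3) (u : Word n) : pre i u 0 = i := rfl

@[simp] lemma tail_pre {n : ℕ} (i : Fin 3) (u : Word n) : Fin.tail (pre i u) = u :=
  rfl

lemma pre_tail {n : ℕ} (u : Word (n + 1)) : pre (u 0) (Fin.tail u) = u := Fin.cons_self_tail u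

@[simp] lemma tail_corner (n : ℕ) (j : Fin 3) : Fin.tail (corner (n + 1) j) = corner n j := rfl

lemma pre_corner (n : ℕ) (j : Fin 3) : pre j (corner n j) = corner (n + 1) j :=
  pre_tail (corner (n + 1) j)

lemma word_zero_ext {u v : Word 0} (h : u 0 = v 0) : u = v :=
  funext fun k => by rw [Fin.fin_one_eq_zero k]; exact h

lemma third_ne_left : ∀ {a b : Fin 3}, a ≠ b → third a b ≠ a := by decide

lemma third_ne_right : ∀ {a b : Fin 3}, a ≠ b → third a b ≠ b := by decide

lemma third_comm : ∀ (a b : Fin 3), third a b = third b a := by decide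

lemma eq_third : ∀ {a b c : Fin 3}, a ≠ b → c ≠ a → c ≠ b → c = third a b := by decide

lemma cornerDist_corner_self (n : ℕ) (j : Fin 3) : cornerDist n j (corner n j) = 0 := by
  induction n with
  | zero => simp [cornerDist, corner]
  | succ n ih => simp [cornerDist, ih]; rfl

lemma cornerDist_corner_ne (n : ℕ) {i j : Fin 3} (h : i ≠ j) :
    cornerDist n j (corner n i) = 2 ^ n := by
  induction n with
  | zero => simp [cornerDist, corner, h]
  | succ n ih =>
    have : corner (n + 1) i 0 = i := rfl
    simp [cornerDist, ih, this, h]; ring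

lemma cornerDist_le (n : ℕ) (j : Fin 3) (u : Word n) : cornerDist n j u ≤ 2 ^ n := by
  induction n with
  | zero => simp only [cornerDist]; split <;> simp
  | succ n ih =>
    have := ih (Fin.tail u)
    simp only [cornerDist, pow_succ]; split <;> omega

lemma cornerDist_eq_zero {n : ℕ} {j : Fin 3} {u : Word n} (h : cornerDist n j u = 0) :
    u = corner n j := by
  induction n with
  | zero =>
    refine word_zero_ext (by_contra fun hne => ?_)
    simp only [cornerDist] at h
    rw [if_neg (show ¬ u 0 = j from hne)] at h
    exact one_ne_zero h
  | succ n ih =>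
    simp only [cornerDist, Nat.add_eq_zero_iff] at h
    obtain ⟨h0, h1⟩ := h
    have h0' : u 0 = j := by
      by_contra hne
      rw [if_neg hne] at h0
      exact (pow_pos two_pos n).ne' h0
    rw [← pre_tail u, ih h1, h0', pre_corner]

lemma wordDist_self (n : ℕ) (u : Word n) : wordDist n u u = 0 := by
  induction n with
  | zero => simp [wordDist]
  | succ n ih => simp [wordDist, ih]

lemma wordDist_comm (n : ℕ) (u v : Word n) : wordDist n u v = wordDist n v u := by
  induction n with
  | zero => simp only [wordDist, eq_comm]
  | succ n ih =>
    simp only [wordDist]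
    by_cases h : u 0 = v 0
    · rw [if_pos h, if_pos h.symm, ih]
    · rw [if_neg h, if_neg (Ne.symm h), third_comm (v 0)]
      congr 1 <;> omega

lemma wordDist_corner (n : ℕ) (j : Fin 3) (u : Word n) :
    wordDist n (corner n j) u = cornerDist n j u := by
  induction n with
  | zero =>
    have : corner 0 j 0 = j := rfl
    simp only [wordDist, cornerDist, this, eq_comm]
  | succ n ih =>
    have h0 : corner (n + 1) j 0 = j := rfl
    simp only [wordDist, cornerDist, h0, tail_corner]
    by_cases h : j = u 0
    · rw [if_pos h, if_pos h.symm, ih, zero_add]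
    · rw [if_neg h, if_neg (Ne.symm h), cornerDist_corner_ne n h,
        cornerDist_corner_ne n (third_ne_left h).symm]
      -- The direct path costs at most `2 * 2 ^ n`, which the detour alone already exceeds or
      -- equals.
      have := cornerDist_le n j (Fin.tail u)
      omega

/-! #### Adjacency and non-clique edges along the recursive structure -/

lemma adj_succ {n : ℕ} {u v : Word (n + 1)} :
    (sierpinskiGraph (n + 2)).Adj u v ↔
      (u 0 = v 0 ∧ (sierpinskiGraph (n + 1)).Adj (Fin.tail u) (Fin.tail v)) ∨
        (u 0 ≠ v 0 ∧ Fin.tail u = corner n (v 0) ∧ Fin.tail v = corner n (u 0)) := by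
  refine (Iff.rfl : _ ↔ (_ ∨ (_ ∧ (∀ k, Fin.tail u k = v 0) ∧
    (∀ k, Fin.tail v k = u 0)))).trans ?_
  simp only [funext_iff, corner]

lemma adj_zero {u v : Word 0} : (sierpinskiGraph 1).Adj u v ↔ u 0 ≠ v 0 := by
  constructor
  · rintro (h | h)
    · exact absurd h.2 (by simp [sierpinskiGraph])
    · exact h.1
  · exact fun h => Or.inr ⟨h, fun k => k.elim0, fun k => k.elim0⟩

lemma not_isNonCliqueEdge_zero {u v : Word 0} : ¬ IsNonCliqueEdge (sierpinskiGraph 1) u v := by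
  rintro ⟨h, hw⟩
  rw [adj_zero] at h
  refine hw (fun _ => third (u 0) (v 0)) ⟨?_, ?_⟩ <;> rw [adj_zero]
  · exact (third_ne_left h).symm
  · exact (third_ne_right h).symm

/-- A crossing edge lies in no triangle because each corner of a copy has at most one neighbor
outside the copy. For the same reason an inner edge acquires no new common neighbor. So contraction
glues the copies at their common corners, at every level of the recursion. -/
lemma isNonCliqueEdge_succ {n : ℕ} {u v : Word (n + 1)} :
    IsNonCliqueEdge (sierpinskiGraph (n + 2)) u v ↔
      (u 0 = v 0 ∧ IsNonCliqueEdge (sierpinskiGraph (n + 1)) (Fin.tail u) (Fin.tail v)) ∨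
        (u 0 ≠ v 0 ∧ Fin.tail u = corner n (v 0) ∧ Fin.tail v = corner n (u 0)) := by
  have corner_inj : ∀ {a b : Fin 3}, corner n a = corner n b → a = b := fun h => congrFun h 0
  constructor
  · rintro ⟨h, hw⟩
    rw [adj_succ] at h
    refine h.imp_left fun ⟨h0, h1⟩ => ⟨h0, h1, fun w hww => ?_⟩
    refine hw (pre (u 0) w) ⟨adj_succ.2 (Or.inl ?_), adj_succ.2 (Or.inl ?_)⟩
    · simpa using hww.1
    · simpa [h0] using hww.2
  · rintro (⟨h0, h1, hw⟩ | ⟨h0, h1, h2⟩)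
    · refine ⟨adj_succ.2 (Or.inl ⟨h0, h1⟩), fun w hww => ?_⟩
      obtain ⟨hu, hv⟩ := hww
      rw [adj_succ] at hu hv
      rcases hu with hu | hu <;> rcases hv with hv | hv
      · exact hw _ ⟨hu.2, hv.2⟩
      · exact hv.1 (h0.symm.trans hu.1)
      · exact hu.1 (h0.trans hv.1)
      · exact h1.ne (hu.2.1.trans hv.2.1.symm)
    · refine ⟨adj_succ.2 (Or.inr ⟨h0, h1, h2⟩), fun w hww => ?_⟩
      obtain ⟨hu, hv⟩ := hww
      rw [adj_succ] at hu hv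
      rcases hu with hu | hu <;> rcases hv with hv | hv
      · exact h0 (hu.1.trans hv.1.symm)
      · exact (h1 ▸ hu.2.ne) (by rw [hv.2.2])
      · exact (h2 ▸ hv.2.ne) (by rw [hu.2.2])
      · exact h0 (corner_inj (hu.2.2.symm.trans hv.2.2))

/-! #### Lower bound for the distance -/

/-- The two ends of a crossing edge are both at distance `2 ^ n` from the outer corners of their two
copies, and both at `2 * 2 ^ n` from the remaining corner. -/
lemma cornerDist_eq_of_isNonCliqueEdge {n : ℕ} {v w : Word n} (j : Fin 3)
    (h : IsNonCliqueEdge (sierpinskiGraph (n + 1)) v w) : cornerDist n j v = cornerDist n j w := by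
  induction n with
  | zero => exact absurd h not_isNonCliqueEdge_zero
  | succ n ih =>
    rcases isNonCliqueEdge_succ.1 h with ⟨h0, h1⟩ | ⟨h0, h1, h2⟩
    · simp only [cornerDist, h0, ih h1]
    · simp only [cornerDist, h1, h2]
      by_cases hv : v 0 = j
      · have hw : w 0 ≠ j := fun hw => h0 (hv.trans hw.symm)
        rw [if_pos hv, if_neg hw, cornerDist_corner_ne n hw, hv, cornerDist_corner_self]
        omega
      · by_cases hw : w 0 = j
        · rw [if_neg hv, if_pos hw, cornerDist_corner_ne n hv, hw, cornerDist_corner_self]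
          omega
        · rw [if_neg hv, if_neg hw, cornerDist_corner_ne n hv, cornerDist_corner_ne n hw]

lemma cornerDist_le_of_adj {n : ℕ} {v w : Word n} (j : Fin 3)
    (h : (sierpinskiGraph (n + 1)).Adj v w) : cornerDist n j w ≤ cornerDist n j v + 1 := by
  induction n with
  | zero => simp only [cornerDist]; split <;> split <;> omega
  | succ n ih =>
    rcases adj_succ.1 h with ⟨h0, h1⟩ | h1
    · have := ih h1
      simp only [cornerDist, h0]; omega
    · rw [cornerDist_eq_of_isNonCliqueEdge j (isNonCliqueEdge_succ.2 (Or.inr h1))]; omega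

lemma wordDist_eq_of_isNonCliqueEdge {n : ℕ} (u : Word n) {v w : Word n}
    (h : IsNonCliqueEdge (sierpinskiGraph (n + 1)) v w) : wordDist n u v = wordDist n u w := by
  induction n with
  | zero => exact absurd h not_isNonCliqueEdge_zero
  | succ n ih =>
    rcases isNonCliqueEdge_succ.1 h with ⟨h0, h1⟩ | ⟨h0, h1, h2⟩
    · simp only [wordDist, h0, ih _ h1, cornerDist_eq_of_isNonCliqueEdge _ h1]
    · simp only [wordDist, h1, h2]
      -- If `u` is in the copy of one end, the formula applied to the other end must return the
      -- distance inside the copy: the direct path ends at the shared corner, and the detour is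
      -- never shorter.
      have key : ∀ a b : Fin 3, a ≠ b → wordDist n (Fin.tail u) (corner n b) =
          min (cornerDist n b (Fin.tail u) + cornerDist n a (corner n a))
            (cornerDist n (third a b) (Fin.tail u) + 2 ^ n +
              cornerDist n (third a b) (corner n a)) := fun a b hab => by
        rw [wordDist_comm, wordDist_corner, cornerDist_corner_self,
          cornerDist_corner_ne n (third_ne_left hab).symm]
        have := cornerDist_le n b (Fin.tail u)
        omega
      by_cases hv : u 0 = v 0
      · have hw : u 0 ≠ w 0 := hv ▸ h0
        rw [if_pos hv, if_neg hw, hv]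
        exact key _ _ h0
      · by_cases hw : u 0 = w 0
        · rw [if_neg hv, if_pos hw, hw]
          exact (key _ _ h0.symm).symm
        -- Here `u` is in the third copy, and passing from `v` to `w` exchanges the direct path with
        -- the detour.
        · rw [if_neg hv, if_neg hw, ← eq_third hv (Ne.symm hw) h0.symm,
            ← eq_third hw (Ne.symm hv) h0, cornerDist_corner_self, cornerDist_corner_self,
            cornerDist_corner_ne n (Ne.symm hv), cornerDist_corner_ne n (Ne.symm hw)]
          omega

lemma wordDist_le_of_adj {n : ℕ} (u : Word n) {v w : Word n}
    (h : (sierpinskiGraph (n + 1)).Adj v w) : wordDist n u w ≤ wordDist n u v + 1 := by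
  induction n with
  | zero => simp only [wordDist]; split <;> split <;> omega
  | succ n ih =>
    rcases adj_succ.1 h with ⟨h0, h1⟩ | h1
    · have h2 := ih (Fin.tail u) h1
      have h3 := fun j => cornerDist_le_of_adj j h1
      simp only [wordDist, h0]
      split
      · exact h2
      · have h4 := h3 (u 0)
        have h5 := h3 (third (u 0) (w 0))
        omega
    · rw [wordDist_eq_of_isNonCliqueEdge u (isNonCliqueEdge_succ.2 (Or.inr h1))]; omega

/-- A function on words that is constant along non-clique edges is constant on the classes. -/
lemma eq_of_eqvGen {n : ℕ} {α : Type*} {f : Word n → α}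
    (hf : ∀ v w, IsNonCliqueEdge (sierpinskiGraph (n + 1)) v w → f v = f w) {v w : Word n}
    (h : Relation.EqvGen (IsNonCliqueEdge (sierpinskiGraph (n + 1))) v w) : f v = f w := by
  induction h with
  | rel _ _ h => exact hf _ _ h
  | refl _ => rfl
  | symm _ _ _ ih => exact ih.symm
  | trans _ _ _ _ _ ih₁ ih₂ => exact ih₁.trans ih₂

/-- The function on the vertices of `ST_3^n` induced by a function on words. -/
def liftVertex {n : ℕ} {α : Type*} (f : Word n → α)
    (hf : ∀ v w, IsNonCliqueEdge (sierpinskiGraph (n + 1)) v w → f v = f w) :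
    Quotient (contractionSetoid (IsNonCliqueEdge (sierpinskiGraph (n + 1)))) → α :=
  Quotient.lift f fun _ _ h => eq_of_eqvGen hf h

lemma le_edist_of_lipschitz {V : Type*} {G : SimpleGraph V} {h : V → ℕ}
    (hh : ∀ a b, G.Adj a b → h b ≤ h a + 1) (a b : V) (ha : h a = 0) :
    (h b : ℕ∞) ≤ G.edist a b := by
  have key : ∀ {a b : V} (p : G.Walk a b), h b ≤ h a + p.length := by
    intro a b p
    induction p with
    | nil => simp
    | cons hadj p ih =>
      have := hh _ _ hadj
      rw [SimpleGraph.Walk.length_cons]; omega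
  refine le_iInf fun p => ?_
  have := key p
  exact_mod_cast (by omega : h b ≤ p.length)

/-- The function `wordDist n u` descends to the contracted graph and grows by at most one along an
edge, so it bounds the length of every walk from `u`. -/
lemma wordDist_le_edist {n : ℕ} (u v : Word n) :
    (wordDist n u v : ℕ∞) ≤ (sierpinskiTriangleGraph n).edist (vertex u) (vertex v) := by
  refine le_edist_of_lipschitz
    (h := liftVertex (wordDist n u) fun _ _ => wordDist_eq_of_isNonCliqueEdge u) ?_ _ _
    (wordDist_self n u)
  rintro _ _ ⟨-, x, y, hxy, rfl, rfl⟩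
  exact wordDist_le_of_adj u hxy

/-! #### Upper bound for the distance -/

/-- `Reach n u v k`: the word `v` can be reached from `u` along `k` edges and any number of
non-clique edges. -/
inductive Reach (n : ℕ) : Word n → Word n → ℕ → Prop
  | refl (u : Word n) : Reach n u u 0
  | contracted {u v w : Word n} {k : ℕ} (h : IsNonCliqueEdge (sierpinskiGraph (n + 1)) u v)
      (hr : Reach n v w k) : Reach n u w k
  | edge {u v w : Word n} {k : ℕ} (h : (sierpinskiGraph (n + 1)).Adj u v)
      (hr : Reach n v w k) : Reach n u w (k + 1)

lemma Reach.trans {n : ℕ} {u v w : Word n} {k l : ℕ} (h : Reach n u v k) (h' : Reach n v w l) :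
    Reach n u w (k + l) := by
  induction h with
  | refl => simpa using h'
  | contracted h _ ih => exact .contracted h (ih h')
  | edge h _ ih =>
    rw [Nat.add_right_comm]
    exact .edge h (ih h')

lemma IsNonCliqueEdge.symm {V : Type*} {G : SimpleGraph V} {u v : V} (h : IsNonCliqueEdge G u v) :
    IsNonCliqueEdge G v u :=
  ⟨h.1.symm, fun w hw => h.2 w hw.symm⟩

lemma Reach.symm {n : ℕ} {u v : Word n} {k : ℕ} (h : Reach n u v k) : Reach n v u k := by
  induction h with
  | refl => exact .refl _
  | contracted h _ ih => simpa using ih.trans (.contracted h.symm (.refl _))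
  | edge h _ ih => exact ih.trans (.edge h.symm (.refl _))

lemma Reach.pre {n : ℕ} (i : Fin 3) {u v : Word n} {k : ℕ} (h : Reach n u v k) :
    Reach (n + 1) (pre i u) (pre i v) k := by
  induction h with
  | refl => exact .refl _
  | contracted h _ ih =>
    refine .contracted (isNonCliqueEdge_succ.2 (Or.inl ⟨?_, ?_⟩)) ih
    · rfl
    · simpa using h
  | edge h _ ih =>
    refine .edge (adj_succ.2 (Or.inl ⟨?_, ?_⟩)) ih
    · rfl
    · simpa using h

lemma reach_cross {n : ℕ} {i j : Fin 3} (h : i ≠ j) :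
    Reach (n + 1) (pre i (corner n j)) (pre j (corner n i)) 0 := by
  refine .contracted (v := pre j (corner n i)) (isNonCliqueEdge_succ.2 (Or.inr ?_)) (.refl _)
  exact ⟨h, rfl, rfl⟩

lemma reach_corner (n : ℕ) (j : Fin 3) (u : Word n) :
    Reach n (corner n j) u (cornerDist n j u) := by
  induction n with
  | zero =>
    simp only [cornerDist]
    split
    · next h =>
      rw [word_zero_ext (v := corner 0 j) h]
      exact .refl _
    · next h => exact .edge (adj_zero.2 (Ne.symm h)) (.refl _)
  | succ n ih =>
    simp only [cornerDist]
    rw [← pre_tail u, ← pre_corner]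
    by_cases h : u 0 = j
    · simpa [h] using (ih (Fin.tail u)).pre j
    · have h1 := (ih (corner n (u 0))).pre j
      rw [cornerDist_corner_ne n h] at h1
      simpa [h] using (h1.trans (reach_cross (Ne.symm h))).trans ((ih (Fin.tail u)).pre (u 0))

lemma reach_wordDist (n : ℕ) (u v : Word n) : Reach n u v (wordDist n u v) := by
  induction n with
  | zero =>
    simp only [wordDist]
    split
    · next h =>
      rw [word_zero_ext h]
      exact .refl _
    · next h => exact .edge (adj_zero.2 h) (.refl _)
  | succ n ih =>
    simp only [wordDist]
    by_cases h : u 0 = v 0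
    · have h1 := (ih (Fin.tail u) (Fin.tail v)).pre (v 0)
      rw [pre_tail, ← h, pre_tail] at h1
      rwa [if_pos h]
    · rw [if_neg h]
      have hl := (((reach_corner n (v 0) (Fin.tail u)).symm.pre (u 0)).trans (reach_cross h)).trans
        ((reach_corner n (u 0) (Fin.tail v)).pre (v 0))
      have hul := third_ne_left h
      have hvl := third_ne_right h
      generalize third (u 0) (v 0) = c at *
      have h1 := (((reach_corner n c (Fin.tail u)).symm.pre (u 0)).trans
        (reach_cross hul.symm))
      have h2 := (reach_corner n (u 0) (corner n (v 0))).pre c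
      rw [cornerDist_corner_ne n (Ne.symm h)] at h2
      have hr := ((h1.trans h2).trans (reach_cross hvl)).trans
        ((reach_corner n c (Fin.tail v)).pre (v 0))
      simp only [Nat.add_zero, pre_tail] at hl hr
      rcases min_choice (cornerDist n (v 0) (Fin.tail u) + cornerDist n (u 0) (Fin.tail v))
        (cornerDist n c (Fin.tail u) + 2 ^ n + cornerDist n c (Fin.tail v)) with hm | hm
      · rw [hm]; exact hl
      · rw [hm]; exact hr

lemma Reach.edist_le {n : ℕ} {u v : Word n} {k : ℕ} (h : Reach n u v k) :
    (sierpinskiTriangleGraph n).edist (vertex u) (vertex v) ≤ k := by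
  induction h with
  | refl => simp
  | @contracted u v w k h _ ih =>
    have : vertex u = vertex v := Quotient.sound (Relation.EqvGen.rel _ _ h)
    rwa [this]
  | @edge u v w k h _ ih =>
    -- An edge whose ends become one vertex costs nothing.
    by_cases huv : vertex u = vertex v
    · rw [huv]
      exact ih.trans (by exact_mod_cast k.le_succ)
    · have hadj : (sierpinskiTriangleGraph n).Adj (vertex u) (vertex v) :=
        ⟨huv, u, v, h, rfl, rfl⟩
      refine (SimpleGraph.edist_triangle (v := vertex v)).trans ?_
      rw [SimpleGraph.edist_eq_one_iff_adj.2 hadj, add_comm]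
      push_cast
      gcongr

theorem edist_vertex {n : ℕ} (u v : Word n) :
    (sierpinskiTriangleGraph n).edist (vertex u) (vertex v) = wordDist n u v :=
  le_antisymm (reach_wordDist n u v).edist_le (wordDist_le_edist u v)

lemma vertex_eq_iff {n : ℕ} {u v : Word n} : vertex u = vertex v ↔ wordDist n u v = 0 := by
  rw [← SimpleGraph.edist_eq_zero_iff (G := sierpinskiTriangleGraph n), edist_vertex]
  exact_mod_cast Iff.rfl

/-! ### Packing colorings that need not use all colors -/

/-- `f` is a packing coloring of `G` with colors in `{1, …, c}`, not necessarily using all of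
them. -/
def IsPackingInto {V : Type*} (G : SimpleGraph V) (c : ℕ) (f : V → ℕ) : Prop :=
  (∀ v, 1 ≤ f v ∧ f v ≤ c) ∧ ∀ u v, u ≠ v → f u = f v → (f u : ℕ∞) < G.edist u v

/-- If some color `i` is unused, the class of the largest color can be given color `i`: the distance
requirement only becomes weaker. Repeating this removes all gaps, so surjectivity onto `{1, …, c}`
is no restriction on the minimum. -/
lemma IsPackingInto.exists_isPackingColoring {V : Type*} [Nonempty V] {G : SimpleGraph V} {c : ℕ}
    {f : V → ℕ} (hf : IsPackingInto G c f) : ∃ c' ≤ c, ∃ f', IsPackingColoring G c' f' := by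
  induction c generalizing f with
  | zero =>
    have := hf.1 (Classical.arbitrary V)
    omega
  | succ c ih =>
    by_cases hr : ∀ i ∈ Set.Icc 1 (c + 1), i ∈ Set.range f
    · exact ⟨c + 1, le_rfl, f, Set.Subset.antisymm (Set.range_subset_iff.2 hf.1) hr, hf.2⟩
    · push Not at hr
      obtain ⟨i, hi, hif⟩ := hr
      have hif' : ∀ v, f v ≠ i := fun v hv => hif ⟨v, hv⟩
      have hinto : IsPackingInto G c (fun v => if f v = c + 1 then i else f v) := by
        refine ⟨fun v => ?_, fun u v huv h => ?_⟩
        · have h1 := hf.1 v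
          have h2 := hif' v
          have h3 := hi.1
          have h4 := hi.2
          dsimp only
          split <;> omega
        · have hu := hif' u
          have hv := hif' v
          dsimp only at h ⊢
          split_ifs at h ⊢ with h1 h2 h2
          · have := hf.2 u v huv (h1.trans h2.symm)
            refine lt_of_le_of_lt ?_ this
            rw [h1]
            exact_mod_cast hi.2
          · exact absurd h.symm hv
          · exact absurd h hu
          · exact hf.2 u v huv h
      obtain ⟨c', hc', h⟩ := ih hinto
      exact ⟨c', hc'.trans c.le_succ, h⟩

lemma IsPackingInto.packingChromaticNumber_le {V : Type*} [Nonempty V] {G : SimpleGraph V} {c : ℕ}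
    {f : V → ℕ} (hf : IsPackingInto G c f) : packingChromaticNumber G ≤ c := by
  obtain ⟨c', hc', hf'⟩ := hf.exists_isPackingColoring
  exact (iInf₂_le c' hf').trans (by exact_mod_cast hc')

lemma le_packingChromaticNumber {V : Type*} {G : SimpleGraph V} {c : ℕ}
    (h : ∀ f, ¬ IsPackingInto G c f) : ((c + 1 : ℕ) : ℕ∞) ≤ packingChromaticNumber G := by
  refine le_iInf₂ fun c' hc' => ?_
  obtain ⟨f, hf⟩ := hc'
  by_contra hlt
  have hlt' : c' ≤ c := by
    have : c' < c + 1 := by exact_mod_cast not_le.1 hlt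
    omega
  refine h f ⟨fun v => ?_, hf.2⟩
  have hv : f v ∈ Set.Icc 1 c' := hf.1 ▸ Set.mem_range_self v
  exact ⟨hv.1, hv.2.trans hlt'⟩

instance (n : ℕ) :
    Nonempty (Quotient (contractionSetoid (IsNonCliqueEdge (sierpinskiGraph (n + 1))))) :=
  ⟨vertex (corner n 0)⟩

/-- A coloring of words that is constant on the words representing the same vertex. -/
def Consistent {n : ℕ} (f : Word n → ℕ) : Prop := ∀ u v, wordDist n u v = 0 → f u = f v

lemma packingChromaticNumber_le_of_word {n c : ℕ} (f : Word n → ℕ)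
    (hc : ∀ u, 1 ≤ f u ∧ f u ≤ c) (h0 : Consistent f)
    (h : ∀ u v, f u = f v → wordDist n u v = 0 ∨ f u < wordDist n u v) :
    packingChromaticNumber (sierpinskiTriangleGraph n) ≤ c := by
  have hf : ∀ v w, IsNonCliqueEdge (sierpinskiGraph (n + 1)) v w → f v = f w := fun v w hvw =>
    h0 v w (by rw [← wordDist_eq_of_isNonCliqueEdge v hvw, wordDist_self])
  refine IsPackingInto.packingChromaticNumber_le (f := liftVertex f hf) ⟨?_, ?_⟩
  · rintro ⟨u⟩
    exact hc u
  · rintro ⟨u⟩ ⟨v⟩ huv hfuv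
    rcases h u v hfuv with h | h
    · exact absurd (vertex_eq_iff.2 h) huv
    · exact lt_of_lt_of_eq (by exact_mod_cast h) (edist_vertex u v).symm

/-! ### Gluing colorings of the three copies of `ST_3^n` in `ST_3^{n+1}` -/

/-- The coloring of `ST_3^{n+1}` that restricts to `F i` on the copy `i` of `ST_3^n`. -/
def glue {n : ℕ} (F : Fin 3 → Word n → ℕ) : Word (n + 1) → ℕ := fun u => F (u 0) (Fin.tail u)

/-- The color class `c` of `f` is a `c`-packing; `m` bounds the distances of its non-corner
elements to the corners and `M` those of all its elements. -/
structure ClassBounds {n : ℕ} (c : ℕ) (f : Word n → ℕ) (m M : Fin 3 → ℕ) : Prop where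
  le_of_ne : ∀ j u, f u = c → cornerDist n j u ≠ 0 → m j ≤ cornerDist n j u
  le : ∀ j u, f u = c → M j ≤ cornerDist n j u
  packing : ∀ u v, f u = c → f v = c → wordDist n u v = 0 ∨ c < wordDist n u v

lemma Consistent.glue {n : ℕ} {F : Fin 3 → Word n → ℕ} (hF : ∀ i, Consistent (F i))
    (hc : ∀ i j, i ≠ j → F i (corner n j) = F j (corner n i)) : Consistent (glue F) := by
  intro u v h
  simp only [wordDist] at h
  simp only [SierpinskiPacking.glue]
  by_cases h0 : u 0 = v 0
  · rw [if_pos h0] at h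
    rw [h0]
    exact hF _ _ _ h
  · rw [if_neg h0] at h
    -- The detour has positive length, so distance zero can only come from the shared corner.
    have hpos : 0 < 2 ^ n := by positivity
    have h1 : cornerDist n (v 0) (Fin.tail u) = 0 := by omega
    have h2 : cornerDist n (u 0) (Fin.tail v) = 0 := by omega
    rw [cornerDist_eq_zero h1, cornerDist_eq_zero h2]
    exact hc _ _ h0

/-- For elements of two copies, `hm` controls the path through the shared corner and `hM` the path
through the third copy. Since corner distances are at most `2 ^ n`, the alternatives `2 ^ n < m i j`
in `hM` mean that the copy contains no element of the class except possibly the shared corner. The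
shared corner belongs to both copies; a pair containing it is handled inside one copy, which is why
`m` ignores corners. -/
lemma ClassBounds.glue {n c : ℕ} {F : Fin 3 → Word n → ℕ}
    (hc : ∀ i j, i ≠ j → F i (corner n j) = F j (corner n i))
    {m M : Fin 3 → Fin 3 → ℕ} (hF : ∀ i, ClassBounds c (F i) (m i) (M i))
    (hm : ∀ i j, i ≠ j → c < m i j + m j i)
    (hM : ∀ i j, i ≠ j → c < M i (third i j) + 2 ^ n + M j (third i j) ∨ 2 ^ n < m i j ∨
      2 ^ n < m j i)
    {m' M' : Fin 3 → ℕ} (h1 : ∀ k, m' k ≤ m k k) (h2 : ∀ j k, j ≠ k → m' k ≤ 2 ^ n + M j k)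
    (h3 : ∀ k, M' k ≤ M k k) (h4 : ∀ j k, j ≠ k → M' k ≤ 2 ^ n + M j k) :
    ClassBounds c (glue F) m' M' where
  le_of_ne := by
    intro j u hu hne
    simp only [cornerDist, SierpinskiPacking.glue] at *
    by_cases h0 : u 0 = j
    · rw [if_pos h0, zero_add] at *
      rw [h0] at hu
      exact (h1 j).trans ((hF j).le_of_ne j _ hu hne)
    · rw [if_neg h0]
      have := (hF _).le j _ hu
      have := h2 _ _ h0
      omega
  le := by
    intro j u hu
    simp only [cornerDist, SierpinskiPacking.glue] at *
    by_cases h0 : u 0 = j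
    · rw [if_pos h0, zero_add] at *
      rw [h0] at hu
      exact (h3 j).trans ((hF j).le j _ hu)
    · rw [if_neg h0]
      have := (hF _).le j _ hu
      have := h4 _ _ h0
      omega
  packing := by
    intro u v hu hv
    simp only [wordDist, SierpinskiPacking.glue] at *
    by_cases h0 : u 0 = v 0
    · rw [if_pos h0]
      rw [h0] at hu
      exact (hF _).packing _ _ hu hv
    · rw [if_neg h0]
      have hpos : 0 < 2 ^ n := by positivity
      have hfar := hM _ _ h0
      have hu' := (hF _).le (third (u 0) (v 0)) _ hu
      have hv' := (hF _).le (third (u 0) (v 0)) _ hv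
      by_cases hcu : cornerDist n (v 0) (Fin.tail u) = 0
      · by_cases hcv : cornerDist n (u 0) (Fin.tail v) = 0
        · left; omega
        · right
          -- The element `u` is the shared corner, so it can be replaced by its representative in
          -- the copy of `v`.
          have hco : F (v 0) (corner n (u 0)) = c := by
            rw [← hc _ _ h0, ← cornerDist_eq_zero hcu, hu]
          have hp := (hF _).packing _ _ hco hv
          rw [wordDist_corner] at hp
          have := cornerDist_le n (u 0) (Fin.tail v)
          rw [cornerDist_eq_zero hcu, cornerDist_corner_ne n (third_ne_right h0).symm]
          omega
      · right
        by_cases hcv : cornerDist n (u 0) (Fin.tail v) = 0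
        · have hco : F (u 0) (corner n (v 0)) = c := by
            rw [hc _ _ h0, ← cornerDist_eq_zero hcv, hv]
          have hp := (hF _).packing _ _ hco hu
          rw [wordDist_corner] at hp
          have := cornerDist_le n (v 0) (Fin.tail u)
          rw [cornerDist_eq_zero hcv, cornerDist_corner_ne n (third_ne_left h0).symm]
          omega
        · have h5 := (hF _).le_of_ne _ _ hu hcu
          have h6 := (hF _).le_of_ne _ _ hv hcv
          have h7 := hm _ _ h0
          have h8 := cornerDist_le n (v 0) (Fin.tail u)
          have h9 := cornerDist_le n (u 0) (Fin.tail v)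
          omega

/-! ### Explicit colorings -/

/-- A coloring of `ST_3^n` as a tree of colorings of the triangles `ST_3^0`. -/
inductive Tri : ℕ → Type
  | leaf (a b c : ℕ) : Tri 0
  | node {n : ℕ} (s t w : Tri n) : Tri (n + 1)

/-- The entry of a triple at an index. -/
def sel {α : Type*} (a b c : α) (j : Fin 3) : α := if j = 0 then a else if j = 1 then b else c

/-- The coloring of words given by a tree. -/
def Tri.color : {n : ℕ} → Tri n → Word n → ℕ
  | _, .leaf a b c => fun u => sel a b c (u 0)
  | _, .node s t w => glue (sel s.color t.color w.color)

/-- Conjunction, reduced lazily. -/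
abbrev both (a b : Bool) : Bool := Bool.rec (motive := fun _ => Bool) false b a

lemma both_eq_true {a b : Bool} : both a b = true ↔ a = true ∧ b = true := by
  cases a <;> cases b <;> simp [both]

/-- Disjunction, reduced lazily. -/
abbrev either (a b : Bool) : Bool := Bool.rec (motive := fun _ => Bool) b true a

lemma either_eq_true {a b : Bool} : either a b = true ↔ a = true ∨ b = true := by
  cases a <;> cases b <;> simp [either]

/-- The color of the corner `j`. -/
def Tri.cornerColor (j : ℕ) : {n : ℕ} → Tri n → ℕ
  | _, .leaf a b c => if j = 0 then a else if j = 1 then b else c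
  | _, .node s t w => if j = 0 then s.cornerColor j else if j = 1 then t.cornerColor j
      else w.cornerColor j

/-- All colors are in `{1, …, c}` and the three copies agree at their common corners. -/
def Tri.consistent (c : ℕ) : {n : ℕ} → Tri n → Bool
  | _, .leaf a b d => both (both (both (Nat.ble 1 a) (Nat.ble a c))
      (both (Nat.ble 1 b) (Nat.ble b c))) (both (Nat.ble 1 d) (Nat.ble d c))
  | _, .node s t w => both (both (s.consistent c) (both (t.consistent c) (w.consistent c)))
      (both (Nat.beq (s.cornerColor 1) (t.cornerColor 0))
        (both (Nat.beq (s.cornerColor 2) (w.cornerColor 0))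
          (Nat.beq (t.cornerColor 2) (w.cornerColor 1))))

lemma Tri.color_corner {n : ℕ} (t : Tri n) (j : Fin 3) :
    t.color (corner n j) = t.cornerColor j := by
  induction t with
  | leaf a b c => fin_cases j <;> rfl
  | node s t w hs ht hw =>
    fin_cases j
    · exact hs
    · exact ht
    · exact hw

lemma Tri.color_mem {c n : ℕ} (t : Tri n) (h : t.consistent c = true) (u : Word n) :
    1 ≤ t.color u ∧ t.color u ≤ c := by
  induction t with
  | leaf a b d =>
    simp only [consistent, both_eq_true, Nat.ble_eq] at h
    simp only [color, sel]
    split_ifs <;> tauto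
  | node s t w hs ht hw =>
    simp only [consistent, both_eq_true] at h
    simp only [color, glue, sel]
    split_ifs
    · exact hs h.1.1 _
    · exact ht h.1.2.1 _
    · exact hw h.1.2.2 _

lemma Tri.corner_match {c n : ℕ} {s t w : Tri n} (h : (Tri.node s t w).consistent c = true)
    (i j : Fin 3) (hij : i ≠ j) :
    sel s.color t.color w.color i (corner n j) = sel s.color t.color w.color j (corner n i) := by
  simp only [consistent, both_eq_true, Nat.beq_eq] at h
  obtain ⟨-, h1, h2, h3⟩ := h
  fin_cases i <;> fin_cases j <;> simp_all [sel, color_corner]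

lemma forall_sel {α : Type*} {p : α → Prop} {a b c : α} (ha : p a) (hb : p b) (hc : p c)
    (i : Fin 3) : p (sel a b c i) := by
  unfold sel
  split_ifs
  exacts [ha, hb, hc]

lemma Tri.color_consistent {c n : ℕ} (t : Tri n) (h : t.consistent c = true) :
    Consistent t.color := by
  induction t with
  | leaf a b d =>
    intro u v huv
    simp only [wordDist] at huv
    have : u 0 = v 0 := by
      by_contra hne
      rw [if_neg hne] at huv
      exact one_ne_zero huv
    simp only [color, this]
  | node s t w hs ht hw =>
    have h' := h
    simp only [consistent, both_eq_true] at h'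
    exact Consistent.glue (forall_sel (hs h'.1.1) (ht h'.1.2.1) (hw h'.1.2.2)) (corner_match h)

/-! ### Recursive verification of color classes -/

/-- The data computed for a color class: whether it is a packing, and the bounds of
`ClassBounds`. -/
structure Profile where
  ok : Bool
  m₀ : ℕ
  m₁ : ℕ
  m₂ : ℕ
  M₀ : ℕ
  M₁ : ℕ
  M₂ : ℕ

/-- The bounds on the distances of the non-corner elements. -/
def Profile.m (p : Profile) : Fin 3 → ℕ := sel p.m₀ p.m₁ p.m₂

/-- The bounds on the distances of all elements. -/
def Profile.M (p : Profile) : Fin 3 → ℕ := sel p.M₀ p.M₁ p.M₂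

/-- The minimum, reduced lazily. -/
abbrev natMin (a b : ℕ) : ℕ := Bool.rec (motive := fun _ => ℕ) b a (Nat.ble a b)

lemma natMin_eq (a b : ℕ) : natMin a b = min a b := by
  unfold natMin
  cases h : Nat.ble a b
  · have : ¬ a ≤ b := fun hab => by rw [Nat.ble_eq_true_of_le hab] at h; cases h
    exact (min_eq_right (le_of_not_ge this)).symm
  · exact (min_eq_left (Nat.le_of_ble_eq_true h)).symm

/-- The profile of a color class of a glued coloring; `s` is the side length of the copies. -/
def Profile.glue (c s : ℕ) (p q r : Profile) : Profile where
  ok := both (both p.ok (both q.ok r.ok))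
    (both (both (Nat.ble c.succ (p.m₁ + q.m₀)) (both (Nat.ble c.succ (p.m₂ + r.m₀))
      (Nat.ble c.succ (q.m₂ + r.m₁))))
      (both (far p.M₂ q.M₂ p.m₁ q.m₀) (both (far p.M₁ r.M₁ p.m₂ r.m₀)
        (far q.M₀ r.M₀ q.m₂ r.m₁))))
  m₀ := natMin p.m₀ (natMin (s + q.M₀) (s + r.M₀))
  m₁ := natMin q.m₁ (natMin (s + p.M₁) (s + r.M₁))
  m₂ := natMin r.m₂ (natMin (s + p.M₂) (s + q.M₂))
  M₀ := natMin p.M₀ (natMin (s + q.M₀) (s + r.M₀))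
  M₁ := natMin q.M₁ (natMin (s + p.M₁) (s + r.M₁))
  M₂ := natMin r.M₂ (natMin (s + p.M₂) (s + q.M₂))
where
  /-- The elements in two copies are far apart along the paths through the third copy. -/
  far (M N m l : ℕ) : Bool := either (Nat.ble c.succ (M + s + N))
    (either (Nat.ble s.succ m) (Nat.ble s.succ l))

/-- A bound on the distance of two points of a triangle that is only valid if one of them is not
present. -/
abbrev absent (b : Bool) (k : ℕ) : ℕ := Bool.rec (motive := fun _ => ℕ) 1000 k b

/-- The profile of the color class `c` of a coloring. -/
def Tri.profile (c : ℕ) : {n : ℕ} → Tri n → Profile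
  | _, .leaf a b d =>
    { ok := both (both (absentPair a b) (absentPair a d)) (absentPair b d)
      -- The value 1000 from `absent` plays the role of infinity. A bound for an absent color is
      -- vacuous, so any number is sound; this one exceeds all colors and side lengths of the
      -- colorings below.
      m₀ := natMin (absent (Nat.beq b c) 1) (absent (Nat.beq d c) 1)
      m₁ := natMin (absent (Nat.beq a c) 1) (absent (Nat.beq d c) 1)
      m₂ := natMin (absent (Nat.beq a c) 1) (absent (Nat.beq b c) 1)
      M₀ := natMin (absent (Nat.beq a c) 0)
        (natMin (absent (Nat.beq b c) 1) (absent (Nat.beq d c) 1))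
      M₁ := natMin (absent (Nat.beq b c) 0)
        (natMin (absent (Nat.beq a c) 1) (absent (Nat.beq d c) 1))
      M₂ := natMin (absent (Nat.beq d c) 0)
        (natMin (absent (Nat.beq a c) 1) (absent (Nat.beq b c) 1)) }
  | _, @Tri.node n s t w => Profile.glue c (2 ^ n) (s.profile c) (t.profile c) (w.profile c)
where
  /-- The two colors are not both equal to `c`. -/
  absentPair (a b : ℕ) : Bool := Bool.rec (motive := fun _ => Bool) true
    (Bool.rec (motive := fun _ => Bool) true false (Nat.beq b c)) (Nat.beq a c)

lemma Tri.classBounds {c d n : ℕ} (t : Tri n) (hcons : t.consistent d = true)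
    (h : (t.profile c).ok = true) :
    ClassBounds c t.color (t.profile c).m (t.profile c).M := by
  induction t with
  | leaf a b e =>
    have hbeq : ∀ x : ℕ, Nat.beq x c = decide (x = c) := fun x => by
      rw [Bool.eq_iff_iff]; simp
    simp only [profile, profile.absentPair, both_eq_true, hbeq] at h
    refine ⟨fun j u hu => ?_, fun j u hu => ?_, fun u v hu hv => ?_⟩
    · simp only [color, cornerDist, Profile.m, profile, natMin_eq, hbeq] at *
      generalize u 0 = x at *
      fin_cases j <;> fin_cases x <;> simp_all [sel, absent]
    · simp only [color, cornerDist, Profile.M, profile, natMin_eq, hbeq] at *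
      generalize u 0 = x at *
      fin_cases j <;> fin_cases x <;> simp_all [sel, absent]
    · simp only [color, wordDist] at *
      generalize u 0 = x at *
      generalize v 0 = y at *
      fin_cases x <;> fin_cases y <;> simp_all [sel]
  | @node n s t w hs ht hw =>
    have hcons' := hcons
    simp only [consistent, both_eq_true] at hcons'
    simp only [profile, Profile.glue, Profile.glue.far, both_eq_true, either_eq_true,
      Nat.ble_eq] at h
    obtain ⟨⟨hps, hpt, hpw⟩, ⟨h01, h02, h12⟩, g01, g02, g12⟩ := h
    have key : ∀ i, ClassBounds c (sel s.color t.color w.color i)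
        (sel (s.profile c).m (t.profile c).m (w.profile c).m i)
        (sel (s.profile c).M (t.profile c).M (w.profile c).M i) := by
      intro i
      fin_cases i
      · exact hs hcons'.1.1 hps
      · exact ht hcons'.1.2.1 hpt
      · exact hw hcons'.1.2.2 hpw
    have hmatch := corner_match hcons
    clear hs ht hw hcons hcons' hps hpt hpw
    simp only [profile]
    generalize s.profile c = p at *
    generalize t.profile c = q at *
    generalize w.profile c = r at *
    refine ClassBounds.glue hmatch key ?_ ?_ ?_ ?_ ?_ ?_ <;> clear hmatch key
    · intro i j hij
      fin_cases i <;> fin_cases j <;>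
        first | exact absurd rfl hij | (simp [sel, Profile.m]; omega)
    · intro i j hij
      have e₁ : (-1 : Fin 3) = 2 := rfl
      have e₂ : (-2 : Fin 3) = 1 := rfl
      fin_cases i <;> fin_cases j <;>
        first | exact absurd rfl hij | (simp [sel, Profile.m, Profile.M, third, e₁, e₂]; omega)
    · intro k
      fin_cases k <;> simp [sel, Profile.m, Profile.glue, natMin_eq]
    · intro j k hjk
      fin_cases j <;> fin_cases k <;>
        first | exact absurd rfl hjk | simp [sel, Profile.m, Profile.M, Profile.glue, natMin_eq]
    · intro k
      fin_cases k <;> simp [sel, Profile.M, Profile.glue, natMin_eq]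
    · intro j k hjk
      fin_cases j <;> fin_cases k <;>
        first | exact absurd rfl hjk | simp [sel, Profile.M, Profile.glue, natMin_eq]

/-- The coloring is a packing coloring with colors in `{1, …, d}`. -/
def Tri.check (d : ℕ) {n : ℕ} (t : Tri n) : Bool :=
  both (t.consistent d) ((List.range d).all fun c => (t.profile c.succ).ok)

lemma Tri.profile_ok {d n : ℕ} {t : Tri n} (h : t.check d = true) {c : ℕ} (h1 : 1 ≤ c)
    (hc : c ≤ d) : (t.profile c).ok = true := by
  rw [check, both_eq_true, List.all_eq_true] at h
  obtain ⟨c, rfl⟩ : ∃ k, c = k + 1 := ⟨c - 1, by omega⟩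
  exact h.2 c (List.mem_range.2 hc)

theorem Tri.packingChromaticNumber_le {d n : ℕ} (t : Tri n) (h : t.check d = true) :
    packingChromaticNumber (sierpinskiTriangleGraph n) ≤ d := by
  have hcons : t.consistent d = true := (both_eq_true.1 h).1
  refine packingChromaticNumber_le_of_word t.color (t.color_mem hcons) (t.color_consistent hcons)
    fun u v huv => ?_
  have hmem := t.color_mem hcons u
  exact (t.classBounds hcons (profile_ok h hmem.1 hmem.2)).packing u v rfl huv.symm

/-! ### Repeating one coloring for all larger n -/

/-- All corners have the same color, and the copies of the coloring on adjacent triangles form a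
packing coloring. -/
def Tri.periodic (d : ℕ) {n : ℕ} (t : Tri n) : Bool :=
  both (both (Nat.beq (t.cornerColor 0) (t.cornerColor 1))
    (Nat.beq (t.cornerColor 1) (t.cornerColor 2))) ((List.range d).all fun c =>
      both (Nat.ble c.succ.succ ((t.profile c.succ).m₀ + (t.profile c.succ).m₁))
        (both (Nat.ble c.succ.succ ((t.profile c.succ).m₁ + (t.profile c.succ).m₂))
          (Nat.ble c.succ.succ ((t.profile c.succ).m₀ + (t.profile c.succ).m₂))))

/-- The coloring of `ST_3^{n+k}` that repeats a coloring of `ST_3^n`. -/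
def Tri.iterate {n : ℕ} (t : Tri n) : (k : ℕ) → Word (n + k) → ℕ
  | 0 => t.color
  | k + 1 => glue fun _ => t.iterate k

/-- All copies carry the same coloring, so the condition at a common corner is the same at every
level. A path across a third copy has length at least `2 ^ n > d` and never creates a conflict, so
`M` may be taken to be zero. -/
theorem Tri.packingChromaticNumber_add_le {d n : ℕ} (t : Tri n) (h : t.check d = true)
    (hper : t.periodic d = true) (hd : d < 2 ^ n) (k : ℕ) :
    packingChromaticNumber (sierpinskiTriangleGraph (n + k)) ≤ d := by
  have hcons : t.consistent d = true := (both_eq_true.1 h).1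
  simp only [periodic, both_eq_true, Nat.beq_eq, List.all_eq_true, List.mem_range, Nat.ble_eq]
    at hper
  obtain ⟨⟨hc01, hc12⟩, hm⟩ := hper
  have hmem : ∀ k u, 1 ≤ t.iterate k u ∧ t.iterate k u ≤ d := fun k => by
    induction k with
    | zero => exact t.color_mem hcons
    | succ k ih => exact fun u => ih _
  have hcorner : ∀ k i, t.iterate k (corner _ i) = t.cornerColor 0 := fun k => by
    induction k with
    | zero =>
      intro i
      refine (t.color_corner i).trans ?_
      fin_cases i
      · rfl
      · exact hc01.symm
      · exact (hc01.trans hc12).symm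
    | succ k ih => exact fun i => ih i
  have hconsistent : ∀ k, Consistent (t.iterate k) := fun k => by
    induction k with
    | zero => exact t.color_consistent hcons
    | succ k ih => exact Consistent.glue (fun _ => ih) fun i j _ =>
        (hcorner k j).trans (hcorner k i).symm
  have hbounds : ∀ c, 1 ≤ c → c ≤ d → ∀ k, ClassBounds c (t.iterate k)
      -- With the cap `2 ^ n` the bound is stable under gluing: near the corner `i` nothing changes,
      -- and the other two copies are at least `2 ^ n` away from it.
      (fun i => min ((t.profile c).m i) (2 ^ n)) (fun _ => 0) := fun c hc1 hcd k => by
    have hpow : ∀ k, 2 ^ n ≤ 2 ^ (n + k) := fun k =>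
      Nat.pow_le_pow_right two_pos (Nat.le_add_right n k)
    induction k with
    | zero =>
      have hb := t.classBounds hcons (profile_ok h hc1 hcd)
      exact ⟨fun j u hu hne => (min_le_left _ _).trans (hb.le_of_ne j u hu hne),
        fun _ _ _ => Nat.zero_le _, hb.packing⟩
    | succ k ih =>
      have hk := hpow k
      refine ClassBounds.glue (fun i j _ => by rw [hcorner, hcorner]) (fun _ => ih)
        ?_ ?_ ?_ ?_ ?_ ?_
      · intro i j hij
        obtain ⟨e, rfl⟩ : ∃ e, c = e + 1 := ⟨c - 1, by omega⟩
        obtain ⟨h1, h2, h3⟩ := hm e hcd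
        generalize t.profile (e + 1) = p at *
        have : e + 1 < p.m i + p.m j := by
          fin_cases i <;> fin_cases j <;>
            first | exact absurd rfl hij | (simp [Profile.m, sel]; omega)
        omega
      · intros; omega
      · exact fun _ => le_rfl
      · intros; omega
      · exact fun _ => le_rfl
      · intros; omega
  refine packingChromaticNumber_le_of_word (t.iterate k) (hmem k) (hconsistent k) fun u v huv => ?_
  have hu := hmem k u
  exact (hbounds _ hu.1 hu.2 k).packing u v rfl huv.symm

/-! ### Coloring data and the upper bounds -/

open Tri

/-- A packing 3-coloring of `ST_3^0`. -/
def coloringZero : Tri 0 :=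
  leaf 1 2 3

/-- A packing 4-coloring of `ST_3^1`. -/
def coloringOne : Tri 1 :=
  node (leaf 1 4 3) (leaf 4 1 2) (leaf 3 2 1)

/-- A packing 8-coloring of `ST_3^2`. -/
def coloringTwo : Tri 2 :=
  node (node (leaf 1 8 2) (leaf 8 7 1) (leaf 2 1 6)) (node (leaf 7 3 5) (leaf 3 2 1) (leaf 5 1 4))
    (node (leaf 6 1 3) (leaf 1 4 2) (leaf 3 2 1))

/-- A packing 12-coloring of `ST_3^3`. -/
def coloringThree : Tri 3 :=
  node (node (node (leaf 7 3 1) (leaf 3 1 5) (leaf 1 5 2)) (node (leaf 1 4 2) (leaf 4 1 6) (leaf 2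
    6 1)) (node (leaf 2 11 1) (leaf 11 1 3) (leaf 1 3 9))) (node (node (leaf 1 2 3) (leaf 2 12 1)
    (leaf 3 1 8)) (node (leaf 12 1 5) (leaf 1 2 3) (leaf 5 3 1)) (node (leaf 8 2 1) (leaf 2 1 4)
    (leaf 1 4 7))) (node (node (leaf 9 1 4) (leaf 1 10 2) (leaf 4 2 1)) (node (leaf 10 3 1) (leaf
    3 7 2) (leaf 1 2 6)) (node (leaf 1 5 3) (leaf 5 6 1) (leaf 3 1 2)))

/-- A packing 15-coloring of `ST_3^4`. -/
def coloringFour : Tri 4 :=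
  node (node (node (node (leaf 1 3 2) (leaf 3 9 1) (leaf 2 1 7)) (node (leaf 9 2 1) (leaf 2 1 5)
    (leaf 1 5 4)) (node (leaf 7 1 6) (leaf 1 4 2) (leaf 6 2 1))) (node (node (leaf 1 3 12) (leaf 3
    1 10) (leaf 12 10 1)) (node (leaf 1 2 6) (leaf 2 1 7) (leaf 6 7 1)) (node (leaf 1 2 4) (leaf 2
    1 3) (leaf 4 3 1))) (node (node (leaf 1 3 14) (leaf 3 11 1) (leaf 14 1 2)) (node (leaf 11 2 1)
    (leaf 2 1 5) (leaf 1 5 8)) (node (leaf 2 1 4) (leaf 1 8 3) (leaf 4 3 1)))) (node (node (node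
    (leaf 1 5 3) (leaf 5 15 1) (leaf 3 1 2)) (node (leaf 15 2 1) (leaf 2 1 3) (leaf 1 3 4)) (node
    (leaf 2 1 8) (leaf 1 4 9) (leaf 8 9 1))) (node (node (leaf 1 13 6) (leaf 13 1 2) (leaf 6 2 1))
    (node (leaf 1 3 4) (leaf 3 2 5) (leaf 4 5 1)) (node (leaf 1 7 3) (leaf 7 1 2) (leaf 3 2 10)))
    (node (node (leaf 1 3 2) (leaf 3 1 5) (leaf 2 5 1)) (node (leaf 1 14 2) (leaf 14 10 1) (leaf 2
    1 11)) (node (leaf 1 4 6) (leaf 4 11 1) (leaf 6 1 2)))) (node (node (node (leaf 1 2 13) (leaf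
    2 6 1) (leaf 13 1 7)) (node (leaf 6 3 1) (leaf 3 1 9) (leaf 1 9 2)) (node (leaf 7 1 3) (leaf 1
    2 4) (leaf 3 4 1))) (node (node (leaf 1 2 5) (leaf 2 1 4) (leaf 5 4 1)) (node (leaf 1 3 12)
    (leaf 3 2 1) (leaf 12 1 7)) (node (leaf 1 2 3) (leaf 2 7 1) (leaf 3 1 8))) (node (node (leaf 1
    5 2) (leaf 5 1 10) (leaf 2 10 1)) (node (leaf 1 2 6) (leaf 2 8 1) (leaf 6 1 4)) (node (leaf 1
    3 15) (leaf 3 4 2) (leaf 15 2 1))))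

/-- A packing 19-coloring of `ST_3^5`. -/
def coloringFive : Tri 5 :=
  node (node (node (node (node (leaf 3 1 4) (leaf 1 6 2) (leaf 4 2 1)) (node (leaf 6 10 1) (leaf
    10 1 3) (leaf 1 3 2)) (node (leaf 1 11 5) (leaf 11 2 1) (leaf 5 1 12))) (node (node (leaf 1 2
    4) (leaf 2 13 1) (leaf 4 1 19)) (node (leaf 13 3 1) (leaf 3 1 8) (leaf 1 8 2)) (node (leaf 19
    1 3) (leaf 1 2 5) (leaf 3 5 1))) (node (node (leaf 12 3 1) (leaf 3 1 2) (leaf 1 2 7)) (node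
    (leaf 1 6 9) (leaf 6 1 2) (leaf 9 2 1)) (node (leaf 7 4 1) (leaf 4 1 3) (leaf 1 3 2)))) (node
    (node (node (leaf 1 7 2) (leaf 7 1 4) (leaf 2 4 1)) (node (leaf 1 3 2) (leaf 3 14 1) (leaf 2 1
    17)) (node (leaf 1 6 5) (leaf 6 17 1) (leaf 5 1 2))) (node (node (leaf 14 2 1) (leaf 2 1 5)
    (leaf 1 5 9)) (node (leaf 1 15 4) (leaf 15 1 6) (leaf 4 6 1)) (node (leaf 9 2 1) (leaf 2 1 3)
    (leaf 1 3 8))) (node (node (leaf 2 3 1) (leaf 3 1 4) (leaf 1 4 11)) (node (leaf 1 2 12) (leaf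
    2 8 1) (leaf 12 1 7)) (node (leaf 11 1 2) (leaf 1 7 3) (leaf 2 3 1)))) (node (node (node (leaf
    2 5 1) (leaf 5 1 8) (leaf 1 8 15)) (node (leaf 1 2 3) (leaf 2 18 1) (leaf 3 1 4)) (node (leaf
    15 1 2) (leaf 1 4 6) (leaf 2 6 1))) (node (node (leaf 18 1 10) (leaf 1 2 3) (leaf 10 3 1))
    (node (leaf 2 5 1) (leaf 5 1 6) (leaf 1 6 4)) (node (leaf 1 2 13) (leaf 2 4 1) (leaf 13 1 9)))
    (node (node (leaf 1 14 3) (leaf 14 2 1) (leaf 3 1 16)) (node (leaf 2 1 5) (leaf 1 9 3) (leaf 5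
    3 1)) (node (leaf 16 4 1) (leaf 4 1 2) (leaf 1 2 7))))) (node (node (node (node (leaf 1 2 3)
    (leaf 2 7 1) (leaf 3 1 10)) (node (leaf 7 1 4) (leaf 1 16 2) (leaf 4 2 1)) (node (leaf 10 5 1)
    (leaf 5 1 13) (leaf 1 13 2))) (node (node (leaf 16 1 3) (leaf 1 6 2) (leaf 3 2 1)) (node (leaf
    6 8 1) (leaf 8 1 3) (leaf 1 3 2)) (node (leaf 1 4 12) (leaf 4 2 1) (leaf 12 1 5))) (node (node
    (leaf 2 1 3) (leaf 1 9 6) (leaf 3 6 1)) (node (leaf 9 1 2) (leaf 1 5 3) (leaf 2 3 1)) (node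
    (leaf 1 4 2) (leaf 4 1 7) (leaf 2 7 1)))) (node (node (node (leaf 1 11 2) (leaf 11 1 4) (leaf
    2 4 1)) (node (leaf 1 3 2) (leaf 3 1 14) (leaf 2 14 1)) (node (leaf 1 7 3) (leaf 7 1 5) (leaf
    3 5 1))) (node (node (leaf 1 2 9) (leaf 2 6 1) (leaf 9 1 19)) (node (leaf 6 1 3) (leaf 1 4 2)
    (leaf 3 2 1)) (node (leaf 19 5 1) (leaf 5 1 15) (leaf 1 15 2))) (node (node (leaf 1 10 2)
    (leaf 10 1 6) (leaf 2 6 1)) (node (leaf 1 3 13) (leaf 3 2 1) (leaf 13 1 8)) (node (leaf 1 4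
    18) (leaf 4 8 1) (leaf 18 1 2)))) (node (node (node (leaf 1 8 3) (leaf 8 2 1) (leaf 3 1 5))
    (node (leaf 2 1 4) (leaf 1 6 3) (leaf 4 3 1)) (node (leaf 5 2 1) (leaf 2 1 11) (leaf 1 11
    14))) (node (node (leaf 6 1 2) (leaf 1 5 9) (leaf 2 9 1)) (node (leaf 5 1 3) (leaf 1 2 12)
    (leaf 3 12 1)) (node (leaf 1 4 17) (leaf 4 1 2) (leaf 17 2 1))) (node (node (leaf 14 1 3)
    (leaf 1 2 4) (leaf 3 4 1)) (node (leaf 2 7 1) (leaf 7 1 3) (leaf 1 3 5)) (node (leaf 1 6 2)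
    (leaf 6 5 1) (leaf 2 1 10))))) (node (node (node (node (leaf 7 1 3) (leaf 1 2 12) (leaf 3 12
    1)) (node (leaf 2 1 5) (leaf 1 10 3) (leaf 5 3 1)) (node (leaf 1 2 6) (leaf 2 1 4) (leaf 6 4
    1))) (node (node (leaf 10 1 8) (leaf 1 4 2) (leaf 8 2 1)) (node (leaf 4 3 1) (leaf 3 1 2)
    (leaf 1 2 11)) (node (leaf 1 6 19) (leaf 6 11 1) (leaf 19 1 2))) (node (node (leaf 1 2 3)
    (leaf 2 9 1) (leaf 3 1 17)) (node (leaf 9 1 5) (leaf 1 2 3) (leaf 5 3 1)) (node (leaf 17 2 1)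
    (leaf 2 1 4) (leaf 1 4 7)))) (node (node (node (leaf 1 7 5) (leaf 7 1 2) (leaf 5 2 1)) (node
    (leaf 1 3 4) (leaf 3 15 1) (leaf 4 1 2)) (node (leaf 1 13 3) (leaf 13 2 1) (leaf 3 1 6)))
    (node (node (leaf 15 2 1) (leaf 2 1 9) (leaf 1 9 5)) (node (leaf 1 3 4) (leaf 3 10 1) (leaf 4
    1 2)) (node (leaf 5 1 3) (leaf 1 2 16) (leaf 3 16 1))) (node (node (leaf 6 1 2) (leaf 1 4 12)
    (leaf 2 12 1)) (node (leaf 4 2 1) (leaf 2 1 8) (leaf 1 8 7)) (node (leaf 1 3 5) (leaf 3 7 1)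
    (leaf 5 1 2)))) (node (node (node (leaf 7 2 1) (leaf 2 1 6) (leaf 1 6 3)) (node (leaf 1 5 14)
    (leaf 5 3 1) (leaf 14 1 2)) (node (leaf 3 1 8) (leaf 1 2 4) (leaf 8 4 1))) (node (node (leaf 3
    2 1) (leaf 2 1 10) (leaf 1 10 9)) (node (leaf 1 4 11) (leaf 4 2 1) (leaf 11 1 3)) (node (leaf
    9 1 18) (leaf 1 3 2) (leaf 18 2 1))) (node (node (leaf 1 2 13) (leaf 2 3 1) (leaf 13 1 15))
    (node (leaf 3 5 1) (leaf 5 1 4) (leaf 1 4 7)) (node (leaf 15 1 2) (leaf 1 7 6) (leaf 2 6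
    1)))))

/-- A packing 20-coloring of `ST_3^6` whose corners have the same color. -/
def coloringSix : Tri 6 :=
  node (node (node (node (node (node (leaf 14 1 10) (leaf 1 5 2) (leaf 10 2 1)) (node (leaf 5 3 1)
    (leaf 3 1 8) (leaf 1 8 2)) (node (leaf 1 4 3) (leaf 4 2 1) (leaf 3 1 6))) (node (node (leaf 1
    2 9) (leaf 2 1 4) (leaf 9 4 1)) (node (leaf 1 3 6) (leaf 3 1 5) (leaf 6 5 1)) (node (leaf 1 2
    3) (leaf 2 1 19) (leaf 3 19 1))) (node (node (leaf 6 2 1) (leaf 2 1 5) (leaf 1 5 11)) (node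
    (leaf 1 12 4) (leaf 12 1 2) (leaf 4 2 1)) (node (leaf 11 3 1) (leaf 3 1 7) (leaf 1 7 2))))
    (node (node (node (leaf 1 2 7) (leaf 2 1 4) (leaf 7 4 1)) (node (leaf 1 3 10) (leaf 3 1 11)
    (leaf 10 11 1)) (node (leaf 1 16 3) (leaf 16 1 2) (leaf 3 2 1))) (node (node (leaf 1 2 5)
    (leaf 2 6 4) (leaf 5 4 1)) (node (leaf 6 1 3) (leaf 1 2 7) (leaf 3 7 1)) (node (leaf 1 2 9)
    (leaf 2 1 17) (leaf 9 17 1))) (node (node (leaf 1 5 8) (leaf 5 1 2) (leaf 8 2 1)) (node (leaf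
    1 3 4) (leaf 3 1 2) (leaf 4 2 1)) (node (leaf 1 6 3) (leaf 6 1 12) (leaf 3 12 1)))) (node
    (node (node (leaf 2 20 1) (leaf 20 1 3) (leaf 1 3 4)) (node (leaf 1 2 6) (leaf 2 1 9) (leaf 6
    9 1)) (node (leaf 4 5 1) (leaf 5 1 2) (leaf 1 2 8))) (node (node (leaf 1 3 13) (leaf 3 1 4)
    (leaf 13 4 1)) (node (leaf 1 2 7) (leaf 2 1 18) (leaf 7 18 1)) (node (leaf 1 2 5) (leaf 2 1 3)
    (leaf 5 3 1))) (node (node (leaf 8 3 1) (leaf 3 1 15) (leaf 1 15 2)) (node (leaf 1 2 10) (leaf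
    2 1 6) (leaf 10 6 1)) (node (leaf 2 4 1) (leaf 4 1 3) (leaf 1 3 14))))) (node (node (node
    (node (leaf 2 8 1) (leaf 8 1 3) (leaf 1 3 13)) (node (leaf 1 2 5) (leaf 2 1 14) (leaf 5 14 1))
    (node (leaf 13 4 1) (leaf 4 1 2) (leaf 1 2 15))) (node (node (leaf 1 6 3) (leaf 6 2 1) (leaf 3
    1 4)) (node (leaf 2 1 7) (leaf 1 11 3) (leaf 7 3 1)) (node (leaf 4 2 1) (leaf 2 1 9) (leaf 1 9
    5))) (node (node (leaf 15 1 3) (leaf 1 10 2) (leaf 3 2 1)) (node (leaf 10 1 20) (leaf 1 5 3)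
    (leaf 20 3 1)) (node (leaf 1 6 4) (leaf 6 1 2) (leaf 4 2 1)))) (node (node (node (leaf 11 4 1)
    (leaf 4 1 2) (leaf 1 2 5)) (node (leaf 1 3 18) (leaf 3 6 1) (leaf 18 1 2)) (node (leaf 5 1 3)
    (leaf 1 2 12) (leaf 3 12 1))) (node (node (leaf 6 1 2) (leaf 1 5 13) (leaf 2 13 1)) (node
    (leaf 5 2 1) (leaf 2 1 3) (leaf 1 3 15)) (node (leaf 1 4 10) (leaf 4 15 1) (leaf 10 1 2)))
    (node (node (leaf 1 2 4) (leaf 2 1 7) (leaf 4 7 1)) (node (leaf 1 3 8) (leaf 3 2 1) (leaf 8 1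
    5)) (node (leaf 1 2 6) (leaf 2 5 1) (leaf 6 1 3)))) (node (node (node (leaf 1 3 8) (leaf 3 1
    5) (leaf 8 5 2)) (node (leaf 1 7 2) (leaf 7 11 1) (leaf 2 1 4)) (node (leaf 2 1 19) (leaf 1 4
    3) (leaf 19 3 1))) (node (node (leaf 11 1 3) (leaf 1 2 16) (leaf 3 16 1)) (node (leaf 2 1 4)
    (leaf 1 3 9) (leaf 4 9 1)) (node (leaf 1 2 5) (leaf 2 1 17) (leaf 5 17 1))) (node (node (leaf
    1 2 12) (leaf 2 1 6) (leaf 12 6 1)) (node (leaf 1 3 4) (leaf 3 1 2) (leaf 4 2 1)) (node (leaf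
    1 10 2) (leaf 10 1 7) (leaf 2 7 1))))) (node (node (node (node (leaf 14 1 5) (leaf 1 7 2)
    (leaf 5 2 1)) (node (leaf 7 3 1) (leaf 3 1 9) (leaf 1 9 2)) (node (leaf 1 4 3) (leaf 4 2 1)
    (leaf 3 1 11))) (node (node (leaf 1 2 6) (leaf 2 4 1) (leaf 6 1 12)) (node (leaf 4 1 8) (leaf
    1 2 10) (leaf 8 10 1)) (node (leaf 12 3 1) (leaf 3 1 2) (leaf 1 2 5))) (node (node (leaf 11 17
    1) (leaf 17 1 2) (leaf 1 2 6)) (node (leaf 1 4 3) (leaf 4 5 1) (leaf 3 1 7)) (node (leaf 6 1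
    13) (leaf 1 7 2) (leaf 13 2 1)))) (node (node (node (leaf 2 3 1) (leaf 3 1 5) (leaf 1 5 7))
    (node (leaf 1 2 4) (leaf 2 1 18) (leaf 4 18 1)) (node (leaf 7 2 1) (leaf 2 1 3) (leaf 1 3
    11))) (node (node (leaf 1 9 3) (leaf 9 2 1) (leaf 3 1 6)) (node (leaf 2 5 1) (leaf 5 1 3)
    (leaf 1 3 4)) (node (leaf 6 1 2) (leaf 1 4 13) (leaf 2 13 1))) (node (node (leaf 11 1 2) (leaf
    1 15 4) (leaf 2 4 1)) (node (leaf 15 3 1) (leaf 3 1 8) (leaf 1 8 2)) (node (leaf 1 5 3) (leaf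
    5 2 1) (leaf 3 1 14)))) (node (node (node (leaf 1 19 3) (leaf 19 1 8) (leaf 3 8 1)) (node
    (leaf 1 9 2) (leaf 9 1 3) (leaf 2 3 1)) (node (leaf 1 4 5) (leaf 4 1 16) (leaf 5 16 1))) (node
    (node (leaf 1 2 10) (leaf 2 7 1) (leaf 10 1 5)) (node (leaf 7 6 1) (leaf 6 14 2) (leaf 1 2 4))
    (node (leaf 5 1 2) (leaf 1 4 3) (leaf 2 3 1))) (node (node (leaf 1 3 2) (leaf 3 1 6) (leaf 2 6
    1)) (node (leaf 1 12 2) (leaf 12 1 20) (leaf 2 20 1)) (node (leaf 1 4 7) (leaf 4 1 3) (leaf 7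
    3 1)))))) (node (node (node (node (node (leaf 1 9 7) (leaf 9 1 4) (leaf 7 4 1)) (node (leaf 1
    3 6) (leaf 3 1 5) (leaf 6 5 1)) (node (leaf 1 2 3) (leaf 2 1 11) (leaf 3 11 1))) (node (node
    (leaf 1 8 2) (leaf 8 1 4) (leaf 2 4 1)) (node (leaf 1 3 2) (leaf 3 1 7) (leaf 2 7 1)) (node
    (leaf 1 12 3) (leaf 12 1 10) (leaf 3 10 1))) (node (node (leaf 1 2 14) (leaf 2 4 1) (leaf 14 1
    19)) (node (leaf 4 16 1) (leaf 16 1 5) (leaf 1 5 6)) (node (leaf 19 1 2) (leaf 1 6 3) (leaf 2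
    3 1)))) (node (node (node (leaf 1 2 5) (leaf 2 4 1) (leaf 5 1 6)) (node (leaf 4 3 1) (leaf 3 1
    13) (leaf 1 13 2)) (node (leaf 6 1 3) (leaf 1 2 9) (leaf 3 9 1))) (node (node (leaf 1 18 2)
    (leaf 18 1 5) (leaf 2 5 1)) (node (leaf 1 3 2) (leaf 3 1 11) (leaf 2 11 1)) (node (leaf 1 14
    4) (leaf 14 1 6) (leaf 4 6 1))) (node (node (leaf 1 17 2) (leaf 17 8 1) (leaf 2 1 4)) (node
    (leaf 8 2 1) (leaf 2 1 3) (leaf 1 3 10)) (node (leaf 4 1 5) (leaf 1 10 2) (leaf 5 2 1))))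
    (node (node (node (leaf 1 20 7) (leaf 20 2 1) (leaf 7 1 4)) (node (leaf 2 3 1) (leaf 3 1 5)
    (leaf 1 5 9)) (node (leaf 4 1 3) (leaf 1 9 2) (leaf 3 2 1))) (node (node (leaf 1 4 2) (leaf 4
    6 1) (leaf 2 1 15)) (node (leaf 6 3 1) (leaf 3 1 7) (leaf 1 7 2)) (node (leaf 15 1 3) (leaf 1
    2 12) (leaf 3 12 1))) (node (node (leaf 1 8 13) (leaf 8 1 2) (leaf 13 2 1)) (node (leaf 1 11
    4) (leaf 11 1 2) (leaf 4 2 1)) (node (leaf 1 5 3) (leaf 5 1 6) (leaf 3 6 1))))) (node (node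
    (node (node (leaf 1 2 7) (leaf 2 1 12) (leaf 7 12 1)) (node (leaf 1 3 4) (leaf 3 1 19) (leaf 4
    19 1)) (node (leaf 1 5 3) (leaf 5 1 2) (leaf 3 2 1))) (node (node (leaf 1 2 10) (leaf 2 6 1)
    (leaf 10 1 20)) (node (leaf 6 1 3) (leaf 1 16 7) (leaf 3 7 1)) (node (leaf 20 4 1) (leaf 4 1
    2) (leaf 1 2 5))) (node (node (leaf 1 6 9) (leaf 6 1 2) (leaf 9 2 1)) (node (leaf 1 3 8) (leaf
    3 5 1) (leaf 8 1 2)) (node (leaf 1 4 3) (leaf 4 2 1) (leaf 3 1 15)))) (node (node (node (leaf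
    16 2 1) (leaf 2 1 3) (leaf 1 3 5)) (node (leaf 1 9 4) (leaf 9 1 2) (leaf 4 2 1)) (node (leaf 5
    8 1) (leaf 8 1 11) (leaf 1 11 2))) (node (node (leaf 1 6 3) (leaf 6 2 1) (leaf 3 1 5)) (node
    (leaf 2 1 13) (leaf 1 14 3) (leaf 13 3 1)) (node (leaf 5 4 1) (leaf 4 1 2) (leaf 1 2 17)))
    (node (node (leaf 2 1 3) (leaf 1 12 4) (leaf 3 4 1)) (node (leaf 12 1 2) (leaf 1 17 3) (leaf 2
    3 1)) (node (leaf 1 6 2) (leaf 6 1 7) (leaf 2 7 1)))) (node (node (node (leaf 15 2 1) (leaf 2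
    1 7) (leaf 1 7 5)) (node (leaf 1 6 4) (leaf 6 3 1) (leaf 4 1 2)) (node (leaf 5 1 3) (leaf 1 2
    14) (leaf 3 14 1))) (node (node (leaf 3 10 1) (leaf 10 1 2) (leaf 1 2 8)) (node (leaf 1 5 4)
    (leaf 5 1 3) (leaf 4 3 1)) (node (leaf 8 9 1) (leaf 9 1 2) (leaf 1 2 18))) (node (node (leaf 1
    11 2) (leaf 11 1 4) (leaf 2 4 1)) (node (leaf 1 3 2) (leaf 3 18 1) (leaf 2 1 5)) (node (leaf 1
    6 3) (leaf 6 5 1) (leaf 3 1 2))))) (node (node (node (node (leaf 1 2 10) (leaf 2 4 1) (leaf 10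
    1 7)) (node (leaf 4 3 1) (leaf 3 1 9) (leaf 1 9 2)) (node (leaf 7 1 3) (leaf 1 2 5) (leaf 3 5
    1))) (node (node (leaf 1 14 2) (leaf 14 1 6) (leaf 2 6 1)) (node (leaf 1 2 3) (leaf 2 16 1)
    (leaf 3 1 7)) (node (leaf 1 4 5) (leaf 4 7 1) (leaf 5 1 2))) (node (node (leaf 1 4 2) (leaf 4
    1 18) (leaf 2 18 6)) (node (leaf 1 3 8) (leaf 3 2 1) (leaf 8 1 17)) (node (leaf 6 1 3) (leaf 1
    17 2) (leaf 3 2 1)))) (node (node (node (leaf 16 1 11) (leaf 1 2 3) (leaf 11 3 1)) (node (leaf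
    2 1 19) (leaf 1 10 6) (leaf 19 6 1)) (node (leaf 1 2 5) (leaf 2 1 4) (leaf 5 4 1))) (node
    (node (leaf 10 3 1) (leaf 3 1 2) (leaf 1 2 8)) (node (leaf 1 7 12) (leaf 7 2 1) (leaf 12 1 4))
    (node (leaf 8 1 5) (leaf 1 4 2) (leaf 5 2 1))) (node (node (leaf 1 2 3) (leaf 2 9 1) (leaf 3 1
    7)) (node (leaf 9 13 1) (leaf 13 1 3) (leaf 1 3 2)) (node (leaf 7 1 20) (leaf 1 2 4) (leaf 20
    4 1)))) (node (node (node (leaf 1 5 4) (leaf 5 7 1) (leaf 4 1 2)) (node (leaf 7 3 1) (leaf 3 1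
    2) (leaf 1 2 9)) (node (leaf 2 1 3) (leaf 1 9 12) (leaf 3 12 1))) (node (node (leaf 1 10 4)
    (leaf 10 6 2) (leaf 4 2 1)) (node (leaf 6 3 1) (leaf 3 1 2) (leaf 1 2 5)) (node (leaf 1 8 3)
    (leaf 8 5 1) (leaf 3 1 2))) (node (node (leaf 1 2 6) (leaf 2 4 1) (leaf 6 1 15)) (node (leaf 4
    1 11) (leaf 1 2 14) (leaf 11 14 1)) (node (leaf 15 2 5) (leaf 2 1 3) (leaf 5 3 1)))))) (node
    (node (node (node (node (leaf 1 2 5) (leaf 2 1 11) (leaf 5 11 1)) (node (leaf 1 3 4) (leaf 3 2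
    1) (leaf 4 1 9)) (node (leaf 1 2 3) (leaf 2 9 1) (leaf 3 1 10))) (node (node (leaf 2 6 1)
    (leaf 6 1 18) (leaf 1 18 5)) (node (leaf 1 4 2) (leaf 4 1 7) (leaf 2 7 1)) (node (leaf 5 3 1)
    (leaf 3 1 17) (leaf 1 17 2))) (node (node (leaf 10 2 1) (leaf 2 1 13) (leaf 1 13 6)) (node
    (leaf 1 4 3) (leaf 4 2 1) (leaf 3 1 8)) (node (leaf 6 1 5) (leaf 1 8 2) (leaf 5 2 1)))) (node
    (node (node (leaf 1 3 2) (leaf 3 1 12) (leaf 2 12 1)) (node (leaf 1 8 2) (leaf 8 1 4) (leaf 2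
    4 1)) (node (leaf 1 10 5) (leaf 10 1 3) (leaf 5 3 1))) (node (node (leaf 1 2 3) (leaf 2 15 1)
    (leaf 3 1 11)) (node (leaf 15 6 1) (leaf 6 1 4) (leaf 1 4 13)) (node (leaf 11 1 5) (leaf 1 13
    2) (leaf 5 2 1))) (node (node (leaf 1 6 16) (leaf 6 2 1) (leaf 16 1 9)) (node (leaf 2 3 1)
    (leaf 3 1 7) (leaf 1 7 4)) (node (leaf 9 1 3) (leaf 1 4 2) (leaf 3 2 1)))) (node (node (node
    (leaf 1 3 4) (leaf 3 2 1) (leaf 4 1 15)) (node (leaf 2 7 1) (leaf 7 1 19) (leaf 1 19 12))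
    (node (leaf 15 2 1) (leaf 2 12 3) (leaf 1 3 9))) (node (node (leaf 1 3 2) (leaf 3 1 14) (leaf
    2 14 1)) (node (leaf 1 5 2) (leaf 5 1 8) (leaf 2 8 1)) (node (leaf 1 6 4) (leaf 6 1 3) (leaf 4
    3 1))) (node (node (leaf 9 5 1) (leaf 5 1 2) (leaf 1 2 4)) (node (leaf 1 10 11) (leaf 10 1 2)
    (leaf 11 2 1)) (node (leaf 4 3 1) (leaf 3 1 7) (leaf 1 7 2))))) (node (node (node (node (leaf
    1 2 3) (leaf 2 9 1) (leaf 3 1 5)) (node (leaf 9 1 7) (leaf 1 2 3) (leaf 7 3 1)) (node (leaf 5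
    2 1) (leaf 2 1 4) (leaf 1 4 14))) (node (node (leaf 2 8 1) (leaf 8 1 12) (leaf 1 12 5)) (node
    (leaf 1 4 2) (leaf 4 6 1) (leaf 2 1 3)) (node (leaf 5 1 2) (leaf 1 3 11) (leaf 2 11 1))) (node
    (node (leaf 14 3 1) (leaf 3 1 6) (leaf 1 6 2)) (node (leaf 1 20 2) (leaf 20 1 4) (leaf 2 4 1))
    (node (leaf 2 10 1) (leaf 10 1 3) (leaf 1 3 5)))) (node (node (node (leaf 6 1 2) (leaf 1 5 3)
    (leaf 2 3 7)) (node (leaf 5 2 1) (leaf 2 1 19) (leaf 1 19 4)) (node (leaf 7 1 17) (leaf 1 4 2)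
    (leaf 17 2 1))) (node (node (leaf 1 3 10) (leaf 3 1 13) (leaf 10 13 1)) (node (leaf 1 2 4)
    (leaf 2 1 7) (leaf 4 7 1)) (node (leaf 1 2 6) (leaf 2 1 3) (leaf 6 3 1))) (node (node (leaf 1
    3 9) (leaf 3 5 1) (leaf 9 1 2)) (node (leaf 5 16 1) (leaf 16 1 2) (leaf 1 2 4)) (node (leaf 2
    1 8) (leaf 1 4 3) (leaf 8 3 1)))) (node (node (node (leaf 5 2 1) (leaf 2 1 4) (leaf 1 4 9))
    (node (leaf 1 7 3) (leaf 7 18 1) (leaf 3 1 2)) (node (leaf 9 1 8) (leaf 1 2 6) (leaf 8 6 1)))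
    (node (node (leaf 18 1 2) (leaf 1 5 3) (leaf 2 3 1)) (node (leaf 5 11 1) (leaf 11 1 2) (leaf 1
    2 6)) (node (leaf 1 12 4) (leaf 12 6 1) (leaf 4 1 2))) (node (node (leaf 1 2 3) (leaf 2 5 1)
    (leaf 3 1 4)) (node (leaf 5 1 15) (leaf 1 2 3) (leaf 15 3 1)) (node (leaf 4 2 1) (leaf 2 1 7)
    (leaf 1 7 13))))) (node (node (node (node (leaf 2 6 1) (leaf 6 1 3) (leaf 1 3 8)) (node (leaf
    1 2 5) (leaf 2 1 20) (leaf 5 20 1)) (node (leaf 8 4 1) (leaf 4 1 2) (leaf 1 2 13))) (node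
    (node (leaf 1 17 3) (leaf 17 1 2) (leaf 3 2 1)) (node (leaf 1 4 7) (leaf 4 2 1) (leaf 7 1 5))
    (node (leaf 1 12 10) (leaf 12 5 1) (leaf 10 1 2))) (node (node (leaf 13 1 3) (leaf 1 9 2)
    (leaf 3 2 1)) (node (leaf 9 1 6) (leaf 1 2 3) (leaf 6 3 1)) (node (leaf 1 4 5) (leaf 4 1 2)
    (leaf 5 2 1)))) (node (node (node (leaf 2 1 3) (leaf 1 11 14) (leaf 3 14 1)) (node (leaf 11 1
    2) (leaf 1 9 3) (leaf 2 3 1)) (node (leaf 1 6 2) (leaf 6 1 4) (leaf 2 4 1))) (node (node (leaf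
    9 5 1) (leaf 5 1 4) (leaf 1 4 2)) (node (leaf 1 3 2) (leaf 3 13 1) (leaf 2 1 10)) (node (leaf
    2 1 8) (leaf 1 10 6) (leaf 8 6 1))) (node (node (leaf 1 5 3) (leaf 5 19 1) (leaf 3 1 2)) (node
    (leaf 19 2 1) (leaf 2 1 3) (leaf 1 3 4)) (node (leaf 2 1 7) (leaf 1 4 16) (leaf 7 16 1))))
    (node (node (node (leaf 1 7 3) (leaf 7 1 11) (leaf 3 11 1)) (node (leaf 1 2 4) (leaf 2 1 3)
    (leaf 4 3 1)) (node (leaf 1 2 8) (leaf 2 1 6) (leaf 8 6 1))) (node (node (leaf 1 5 18) (leaf 5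
    1 2) (leaf 18 2 1)) (node (leaf 1 3 12) (leaf 3 1 2) (leaf 12 2 6)) (node (leaf 1 9 4) (leaf 9
    6 1) (leaf 4 1 2))) (node (node (leaf 1 2 3) (leaf 2 5 1) (leaf 3 1 4)) (node (leaf 5 1 15)
    (leaf 1 2 3) (leaf 15 3 1)) (node (leaf 4 2 1) (leaf 2 1 7) (leaf 1 7 14))))))

lemma packingChromaticNumber_zero_le : packingChromaticNumber (sierpinskiTriangleGraph 0) ≤ 3 :=
  coloringZero.packingChromaticNumber_le (by decide +kernel)

lemma packingChromaticNumber_one_le : packingChromaticNumber (sierpinskiTriangleGraph 1) ≤ 4 :=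
  coloringOne.packingChromaticNumber_le (by decide +kernel)

lemma packingChromaticNumber_two_le : packingChromaticNumber (sierpinskiTriangleGraph 2) ≤ 8 :=
  coloringTwo.packingChromaticNumber_le (by decide +kernel)

lemma packingChromaticNumber_three_le : packingChromaticNumber (sierpinskiTriangleGraph 3) ≤ 12 :=
  coloringThree.packingChromaticNumber_le (by decide +kernel)

lemma packingChromaticNumber_four_le : packingChromaticNumber (sierpinskiTriangleGraph 4) ≤ 15 :=
  coloringFour.packingChromaticNumber_le (by decide +kernel)

lemma packingChromaticNumber_five_le : packingChromaticNumber (sierpinskiTriangleGraph 5) ≤ 19 :=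
  coloringFive.packingChromaticNumber_le (by decide +kernel)

lemma packingChromaticNumber_le_of_six_le {n : ℕ} (hn : 6 ≤ n) :
    packingChromaticNumber (sierpinskiTriangleGraph n) ≤ 20 := by
  obtain ⟨k, rfl⟩ := Nat.exists_eq_add_of_le hn
  exact coloringSix.packingChromaticNumber_add_le (by decide +kernel) (by decide +kernel)
    (by norm_num) k

/-! ### The graph `ST_3^3` -/

/-- The words representing the 42 vertices of `ST_3^3`, as numbers in base 3. -/
def vertexCodes : List ℕ :=
  -- Vertices are numbered by position, each given by the smaller code of its words. Vertices 0, 22,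
  -- 41 are the corners; 8, 14, 28 are the common corners of the copies 0 and 1, 0 and 2, 1 and 2.
  -- The first 15 vertices form the copy 0, the first 6 the copy 00.
  [0, 1, 2, 4, 5, 8, 10, 11, 13, 14, 17, 19, 20, 23, 26, 28, 29, 31, 32, 35, 37, 38, 40, 41, 44,
    46, 47, 50, 53, 55, 56, 58, 59, 62, 64, 65, 68, 71, 73, 74, 77, 80]

/-- The word of length 4 representing the vertex `v` of `ST_3^3`. -/
def rep (v : ℕ) : Word 3 := fun k => Fin.ofNat 3 (vertexCodes.getD v 0 / 3 ^ (3 - k.val))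

/-- The distance between two vertices of `ST_3^3`. -/
def dist (u v : ℕ) : ℕ := wordDist 3 (rep u) (rep v)

/-- Bit masks for a vertex `v`. The bit `u + 42 * (i - 1)` of a mask says whether the vertex `u` can
have the color `i`, where `4` stands for all colors that are at least 4. -/
structure VertexData where
  bit₁ : ℕ
  bit₂ : ℕ
  bit₃ : ℕ
  bit₄ : ℕ
  keep₁ : ℕ
  keep₂ : ℕ
  keep₃ : ℕ
  far₅ : ℕ
  far₆ : ℕ
  far₇ : ℕ

/-- The masks of all vertices of `ST_3^3`. -/
def vertexTable : List VertexData := [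
  ⟨(nat_lit 1), (nat_lit 4398046511104), (nat_lit 19342813113834066795298816), (nat_lit
    85070591730234615865843651857942052864), (nat_lit
    374144419156711147060143317175368453031918731001848), (nat_lit
    374144419156711147060143317175368452754841800802303), (nat_lit
    374144419156711147060019542514253028838495613878271), (nat_lit 4396435767296), (nat_lit
    4381402464256), (nat_lit 3505125326848)⟩,
  ⟨(nat_lit 2), (nat_lit 8796093022208), (nat_lit 38685626227668133590597632), (nat_lit
    170141183460469231731687303715884105728), (nat_lit
    374144419156711147060143317175368453031918731001824), (nat_lit
    374144419156711147060143317175368451910416870670335), (nat_lit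
    374144419156711147059984880193153038190798438399999), (nat_lit 4396434849792), (nat_lit
    4381298655232), (nat_lit 3504693313536)⟩,
  ⟨(nat_lit 4), (nat_lit 17592186044416), (nat_lit 77371252455336267181195264), (nat_lit
    340282366920938463463374607431768211456), (nat_lit
    374144419156711147060143317175368453031918731001800), (nat_lit
    374144419156711147060143317175368425733244036579327), (nat_lit
    374144419156711147059524366498538876728535964188671), (nat_lit 4381403381760), (nat_lit
    3505229135872), (nat_lit 163577856)⟩,
  ⟨(nat_lit 8), (nat_lit 35184372088832), (nat_lit 154742504910672534362390528), (nat_lit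
    680564733841876926926749214863536422912), (nat_lit
    374144419156711147060143317175368453031918731001637), (nat_lit
    374144419156711147060143317175368444029117522771967), (nat_lit
    374144419156711147057924947967782165413366295691263), (nat_lit 4396331040768), (nat_lit
    4380866641920), (nat_lit 3435973836800)⟩,
  ⟨(nat_lit 16), (nat_lit 70368744177664), (nat_lit 309485009821345068724781056), (nat_lit
    1361129467683753853853498429727072845824), (nat_lit
    374144419156711147060143317175368453031918731001793), (nat_lit
    374144419156711147060143317175368424888819106447359), (nat_lit
    374144419156711147059509511218067452165237174697983), (nat_lit 4381402464256), (nat_lit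
    3505125326848), (nat_lit 0)⟩,
  ⟨(nat_lit 32), (nat_lit 140737488355328), (nat_lit 618970019642690137449562112), (nat_lit
    2722258935367507707706996859454145691648), (nat_lit
    374144419156711147060143317175368453031918730995659), (nat_lit
    374144419156711147060143317175368313143253352316927), (nat_lit
    374144419156711115905733311769258822503358795874303), (nat_lit 3505230053376), (nat_lit
    267386880), (nat_lit 29360128)⟩,
  ⟨(nat_lit 64), (nat_lit 281474976710656), (nat_lit 1237940039285380274899124224), (nat_lit
    5444517870735015415413993718908291383296), (nat_lit
    374144419156711147060143317175368453031918731000887), (nat_lit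
    374144419156711147060143317175368011846281016115199), (nat_lit
    374144419156711147040257067727101218130005994766335), (nat_lit 4395899027456), (nat_lit
    4294967296000), (nat_lit 3298534883328)⟩,
  ⟨(nat_lit 128), (nat_lit 562949953421312), (nat_lit 2475880078570760549798248448), (nat_lit
    10889035741470030830827987437816582766592), (nat_lit
    374144419156711147060143317175368453031918731000119), (nat_lit
    374144419156711147060143317175368399155848969977855), (nat_lit
    374144419156711147057608035317725108062992119889919), (nat_lit 4381298655232), (nat_lit
    3504693313536), (nat_lit 0)⟩,
  ⟨(nat_lit 256), (nat_lit 1125899906842624), (nat_lit 4951760157141521099596496896), (nat_lit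
    21778071482940061661655974875633165533184), (nat_lit
    374144419156711147060143317175368453031918730902719), (nat_lit
    374144419156711147060143317175363976700179729350655), (nat_lit
    374144419156711145032299232649671058019699543506943), (nat_lit 4309999681536), (nat_lit
    4123168604160), (nat_lit 2199023255552)⟩,
  ⟨(nat_lit 512), (nat_lit 2251799813685248), (nat_lit 9903520314283042199192993792), (nat_lit
    43556142965880123323311949751266331066368), (nat_lit
    374144419156711147060143317175368453031918730999871), (nat_lit
    374144419156711147060143317175367966889449579610111), (nat_lit
    374144419156711147039861023628595465612372251508735), (nat_lit 4380866641920), (nat_lit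
    3435973836800), (nat_lit 0)⟩,
  ⟨(nat_lit 1024), (nat_lit 4503599627370496), (nat_lit 19807040628566084398385987584), (nat_lit
    87112285931760246646623899502532662132736), (nat_lit
    374144419156711147060143317175368453031918730989951), (nat_lit
    374144419156711147060143317175368309022283771412479), (nat_lit
    374144419156711115903826903451572450714080939868159), (nat_lit 3505125326848), (nat_lit 0),
    (nat_lit 0)⟩,
  ⟨(nat_lit 2048), (nat_lit 9007199254740992), (nat_lit 39614081257132168796771975168), (nat_lit
    174224571863520493293247799005065324265472), (nat_lit
    374144419156711147060143317175368453031918730986463), (nat_lit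
    374144419156711147060143317175368310376882096832511), (nat_lit
    374144419156711115905728360009101680982259199377407), (nat_lit 3505229135872), (nat_lit
    163577856), (nat_lit 0)⟩,
  ⟨(nat_lit 4096), (nat_lit 18014398509481984), (nat_lit 79228162514264337593543950336), (nat_lit
    348449143727040986586495598010130648530944), (nat_lit
    374144419156711147060143317175368453031918730971103), (nat_lit
    374144419156711147060143317168284763467327396118527), (nat_lit
    374144419156710825137110471758950910175839258673151), (nat_lit 268304384), (nat_lit 66060288),
    (nat_lit 12582912)⟩,
  ⟨(nat_lit 8192), (nat_lit 36028797018963968), (nat_lit 158456325028528675187087900672), (nat_lit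
    696898287454081973172991196020261297061888), (nat_lit
    374144419156711147060143317175368453031918730970111), (nat_lit
    374144419156711147060143317168284760740538559234047), (nat_lit
    374144419156710825137104340087193824776665148948479), (nat_lit 267386880), (nat_lit 29360128),
    (nat_lit 0)⟩,
  ⟨(nat_lit 16384), (nat_lit 72057594037927936), (nat_lit 316912650057057350374175801344),
    (nat_lit 1393796574908163946345982392040522594123776), (nat_lit
    374144419156711147060143317175368453031917120360447), (nat_lit
    374144419156711147060143317102171632795113293348863), (nat_lit
    374144419156693877480164426852515638810555432566783), (nat_lit 66977792), (nat_lit 15728640),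
    (nat_lit 4194304)⟩,
  ⟨(nat_lit 32768), (nat_lit 144115188075855872), (nat_lit 633825300114114700748351602688),
    (nat_lit 2787593149816327892691964784081045188247552), (nat_lit
    374144419156711147060143317175368453031918730510079), (nat_lit
    374144419156711147060143317175350146743858400067583), (nat_lit
    374144419156711144464590182324345996006362682753023), (nat_lit 4311610294272), (nat_lit
    4136053506048), (nat_lit 2748779069440)⟩,
  ⟨(nat_lit 65536), (nat_lit 288230376151711744), (nat_lit 1267650600228229401496703205376),
    (nat_lit 5575186299632655785383929568162090376495104), (nat_lit
    374144419156711147060143317175368453031918730116863), (nat_lit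
    374144419156711147060143317174921259944144652992511), (nat_lit
    374144419156711136919533809765924598297985204355071), (nat_lit 4137664118784), (nat_lit
    2757369004032), (nat_lit 0)⟩,
  ⟨(nat_lit 131072), (nat_lit 576460752303423488), (nat_lit 2535301200456458802993406410752),
    (nat_lit 11150372599265311570767859136324180752990208), (nat_lit
    374144419156711147060143317175368453031918727430143), (nat_lit
    374144419156711147060143317175221022068617223602175), (nat_lit
    374144419156711141868464190720144229258597064769535), (nat_lit 4311610314789), (nat_lit
    4137664118784), (nat_lit 2757369004032)⟩,
  ⟨(nat_lit 262144), (nat_lit 1152921504606846976), (nat_lit 5070602400912917605986812821504),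
    (nat_lit 22300745198530623141535718272648361505980416), (nat_lit
    374144419156711147060143317175368453031918729986047), (nat_lit
    374144419156711147060143317174907427419364161224703), (nat_lit
    374144419156711136676167332185316600728100735549439), (nat_lit 4137664139301), (nat_lit
    2758442745856), (nat_lit 0)⟩,
  ⟨(nat_lit 524288), (nat_lit 2305843009213693952), (nat_lit 10141204801825835211973625643008),
    (nat_lit 44601490397061246283071436545296723011960832), (nat_lit
    374144419156711147060143317175368453031918629486591), (nat_lit
    374144419156711147060143317173076588070048488226815), (nat_lit
    374144419156709475222302239455082152665064390262783), (nat_lit 2758442766373), (nat_lit 0),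
    (nat_lit 0)⟩,
  ⟨(nat_lit 1048576), (nat_lit 4611686018427387904), (nat_lit 20282409603651670423947251286016),
    (nat_lit 89202980794122492566142873090593446023921664), (nat_lit
    374144419156711147060143317175368453031918715142143), (nat_lit
    374144419156711147060143317175223617267902495850495), (nat_lit
    374144419156711143166549546814204704813695239192575), (nat_lit 4311610325047), (nat_lit
    4137664139301), (nat_lit 2758442745856)⟩,
  ⟨(nat_lit 2097152), (nat_lit 9223372036854775808), (nat_lit 40564819207303340847894502572032),
    (nat_lit 178405961588244985132285746181186892047843328), (nat_lit
    374144419156711147060143317175368453031918702559231), (nat_lit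
    374144419156711147060143317174485747504954113785855), (nat_lit
    374144419156711136676178473645670169150574827667455), (nat_lit 4137664149559), (nat_lit
    2758442766373), (nat_lit 0)⟩,
  ⟨(nat_lit 4194304), (nat_lit 18446744073709551616), (nat_lit 81129638414606681695789005144064),
    (nat_lit 356811923176489970264571492362373784095686656), (nat_lit
    374144419156711147060143317175368453031918717370367), (nat_lit
    374144419156711147060143317175224914304595178553343), (nat_lit
    374144419156711143177963353976415910948265164537855), (nat_lit 4311610326207), (nat_lit
    4137664149559), (nat_lit 2758442766373)⟩,
  ⟨(nat_lit 8388608), (nat_lit 36893488147419103232), (nat_lit 162259276829213363391578010288128),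
    (nat_lit 713623846352979940529142984724747568191373312), (nat_lit
    374144419156711147060143317175368453031918698495999), (nat_lit
    374144419156711147060143317174487044541646796488703), (nat_lit
    374144419156711136677451076006055540073171127369727), (nat_lit 4137664150719), (nat_lit
    2758442776631), (nat_lit 4133)⟩,
  ⟨(nat_lit 16777216), (nat_lit 73786976294838206464), (nat_lit
    324518553658426726783156020576256), (nat_lit 1427247692705959881058285969449495136382746624),
    (nat_lit 374144419156711147060143317175368453031918535966719), (nat_lit
    374144419156711147060143317173008999172740818665471), (nat_lit
    374144419156709475141188694260986180912849073733631), (nat_lit 2758442777791), (nat_lit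
    14391), (nat_lit 37)⟩,
  ⟨(nat_lit 33554432), (nat_lit 147573952589676412928), (nat_lit
    649037107316853453566312041152512), (nat_lit 2854495385411919762116571938898990272765493248),
    (nat_lit 374144419156711147060143317175368453031918478819327), (nat_lit
    374144419156711147060143317173031192911704500469759), (nat_lit
    374144419156709475141183742500829039391749477236735), (nat_lit 2758442776631), (nat_lit 4133),
    (nat_lit 0)⟩,
  ⟨(nat_lit 67108864), (nat_lit 295147905179352825856), (nat_lit
    1298074214633706907132624082305024), (nat_lit 5708990770823839524233143877797980545530986496),
    (nat_lit 374144419156711147060143317175368453031918227161087), (nat_lit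
    374144419156711147060143316795287991142317157253119), (nat_lit
    374144419156706110634231459950784103749864399044607), (nat_lit 14391), (nat_lit 37), (nat_lit
    0)⟩,
  ⟨(nat_lit 134217728), (nat_lit 590295810358705651712), (nat_lit
    2596148429267413814265248164610048), (nat_lit
    11417981541647679048466287755595961091061972992), (nat_lit
    374144419156711147060143317175368453031918210908159), (nat_lit
    374144419156711147060143316795243315434013641932799), (nat_lit
    374144419156706110533458188992797007851976090714111), (nat_lit 15551), (nat_lit 2103),
    (nat_lit 5)⟩,
  ⟨(nat_lit 268435456), (nat_lit 1180591620717411303424), (nat_lit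
    5192296858534827628530496329220096), (nat_lit
    22835963083295358096932575511191922182123945984), (nat_lit
    374144419156711147060143317175368453031832361893887), (nat_lit
    374144419156711147060143316030266062069315391193087), (nat_lit
    374144419156679432616146386267156429084566220701695), (nat_lit 3263), (nat_lit 23), (nat_lit
    1)⟩,
  ⟨(nat_lit 536870912), (nat_lit 2361183241434822606848), (nat_lit
    10384593717069655257060992658440192), (nat_lit
    45671926166590716193865151022383844364247891968), (nat_lit
    374144419156711147060143317175368453031910677921791), (nat_lit
    374144419156711147060143316875498055268906693558271), (nat_lit
    374144419156689884603892979826724429342963159531519), (nat_lit 16220160), (nat_lit 5373952),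
    (nat_lit 0)⟩,
  ⟨(nat_lit 1073741824), (nat_lit 4722366482869645213696), (nat_lit
    20769187434139310514121985316880384), (nat_lit
    91343852333181432387730302044767688728495783936), (nat_lit
    374144419156711147060143317175368453031904235470847), (nat_lit
    374144419156711147060143313475394187602762139697151), (nat_lit
    374144419156627416080387947315525578941626312556543), (nat_lit 67076096), (nat_lit 16121856),
    (nat_lit 5242880)⟩,
  ⟨(nat_lit 2147483648), (nat_lit 9444732965739290427392), (nat_lit
    41538374868278621028243970633760768), (nat_lit
    182687704666362864775460604089535377456991567872), (nat_lit
    374144419156711147060143317175368453031860212072447), (nat_lit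
    374144419156711147060143315967623152980412929671167), (nat_lit
    374144419156668613061797817363542587975459034628095), (nat_lit 5407051), (nat_lit 0), (nat_lit
    0)⟩,
  ⟨(nat_lit 4294967296), (nat_lit 18889465931478580854784), (nat_lit
    83076749736557242056487941267521536), (nat_lit
    365375409332725729550921208179070754913983135744), (nat_lit
    374144419156711147060143317175368453031902088003583), (nat_lit
    374144419156711147060143313248720650468214697885695), (nat_lit
    374144419156626081660155343956730387547402310516735), (nat_lit 16220491), (nat_lit 5406720),
    (nat_lit 0)⟩,
  ⟨(nat_lit 8589934592), (nat_lit 37778931862957161709568), (nat_lit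
    166153499473114484112975882535043072), (nat_lit
    730750818665451459101842416358141509827966271488), (nat_lit
    374144419156711147060143317175368453031080138637311), (nat_lit
    374144419156711147060143298363821496463092984315903), (nat_lit
    374144419156626086852452202491558016077898639736831), (nat_lit 67076427), (nat_lit 16220160),
    (nat_lit 5373952)⟩,
  ⟨(nat_lit 17179869184), (nat_lit 75557863725914323419136), (nat_lit
    332306998946228968225951765070086144), (nat_lit
    1461501637330902918203684832716283019655932542976), (nat_lit
    374144419156711147060143317175368453031796055998463), (nat_lit
    374144419156711147060143316009239079668295716044799), (nat_lit
    374144419156679245902304915400962595883280221863935), (nat_lit 735), (nat_lit 11), (nat_lit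
    0)⟩,
  ⟨(nat_lit 34359738368), (nat_lit 151115727451828646838272), (nat_lit
    664613997892457936451903530140172288), (nat_lit
    2923003274661805836407369665432566039311865085952), (nat_lit
    374144419156711147060143317175368453031658885480447), (nat_lit
    374144419156711147060143309965495425310687900991487), (nat_lit
    374144419156626077766170384543152459162310695452671), (nat_lit 5407711), (nat_lit 75),
    (nat_lit 0)⟩,
  ⟨(nat_lit 68719476736), (nat_lit 302231454903657293676544), (nat_lit
    1329227995784915872903807060280344576), (nat_lit
    5846006549323611672814739330865132078623730171904), (nat_lit
    374144419156711147060143317175368453031660764528639), (nat_lit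
    374144419156711147060143309985860630768063245975551), (nat_lit
    374144419156626097551977865555414015073228500762623), (nat_lit 3839), (nat_lit 159), (nat_lit
    3)⟩,
  ⟨(nat_lit 137438953472), (nat_lit 604462909807314587353088), (nat_lit
    2658455991569831745807614120560689152), (nat_lit
    11692013098647223345629478661730264157247460343808), (nat_lit
    374144419156711147060143317175368453030303823298559), (nat_lit
    374144419156711147060143297859708946474352395681791), (nat_lit
    374144419156626077766487297193209516512684871254015), (nat_lit 5410815), (nat_lit 735),
    (nat_lit 11)⟩,
  ⟨(nat_lit 274877906944), (nat_lit 1208925819614629174706176), (nat_lit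
    5316911983139663491615228241121378304), (nat_lit
    23384026197294446691258957323460528314494920687616), (nat_lit
    374144419156711147060143317175368453029848556765183), (nat_lit
    374144419156711147060143297922280302372375194763263), (nat_lit
    374144419156626081660393028444273180560182942367743), (nat_lit 16221151), (nat_lit 5407051),
    (nat_lit 0)⟩,
  ⟨(nat_lit 549755813888), (nat_lit 2417851639229258349412352), (nat_lit
    10633823966279326983230456482242756608), (nat_lit
    46768052394588893382517914646921056628989841375232), (nat_lit
    374144419156711147060143317175368453027786972463103), (nat_lit
    374144419156711147060143298375627484727861135278079), (nat_lit
    374144419156626419159688833208069035042444341673983), (nat_lit 67077087), (nat_lit 16220491),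
    (nat_lit 5406720)⟩,
  ⟨(nat_lit 1099511627776), (nat_lit 4835703278458516698824704), (nat_lit
    21267647932558653966460912964485513216), (nat_lit
    93536104789177786765035829293842113257979682750464), (nat_lit
    374144419156711147060143317175368453027658123444223), (nat_lit
    374144419156711147060143297945892134786723420831743), (nat_lit
    374144419156626092045303658163985494971549776609279), (nat_lit 16224255), (nat_lit 5407711),
    (nat_lit 75)⟩,
  ⟨(nat_lit 2199023255552), (nat_lit 9671406556917033397649408), (nat_lit
    42535295865117307932921825928971026432), (nat_lit
    187072209578355573530071658587684226515959365500928), (nat_lit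
    374144419156711147060143317175368453028070440304639), (nat_lit
    374144419156711147060143298399239317142209361346559), (nat_lit
    374144419156626471082974331206402377697781809676287), (nat_lit 67080191), (nat_lit 16221151),
    (nat_lit 5407051)⟩]

/-- The masks of a vertex. -/
def vertexData (v : ℕ) : VertexData := vertexTable.getD v ⟨0, 0, 0, 0, 0, 0, 0, 0, 0, 0⟩

/-- The conditions on the masks of `v` that concern `v` itself. -/
def VertexData.bitsOk (d : VertexData) (v : ℕ) : Bool :=
  both (both (Nat.beq d.bit₁ (2 ^ v)) (Nat.beq d.bit₂ (2 ^ (v + 42))))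
    (both (Nat.beq d.bit₃ (2 ^ (v + 84))) (Nat.beq d.bit₄ (2 ^ (v + 126))))

/-- The conditions on the masks of `v` that concern a vertex `u` at distance `k`. -/
def VertexData.masksOk (d : VertexData) (u k : ℕ) : Bool :=
  both (keepOk d.keep₁ 1) (both (keepOk d.keep₂ 2) (both (keepOk d.keep₃ 3)
    (both (either (Nat.ble k 5) (d.far₅.testBit u)) (both (either (Nat.ble k 6) (d.far₆.testBit u))
      (either (Nat.ble k 7) (d.far₇.testBit u))))))
where
  /-- The condition on the mask that is kept if the color `i` is given to `v`. -/
  keepOk (m i : ℕ) : Bool :=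
    both (either (both (Nat.beq i 1) (Nat.ble k 1)) (m.testBit u))
      (both (either (both (Nat.beq i 2) (Nat.ble k 2)) (m.testBit (u + 42)))
        (both (either (both (Nat.beq i 3) (Nat.ble k 3)) (m.testBit (u + 84)))
          (m.testBit (u + 126))))

lemma bitsOk_vertexData : ∀ v < 42, (vertexData v).bitsOk v = true := by decide +kernel

/-- This ties the precomputed masks to `dist`. Only one direction is tested, that no admissible
color is removed, because soundness of the search needs nothing else. -/
lemma masksOk_vertexData :
    ∀ v < 42, ∀ u < 42, u = v ∨ (vertexData v).masksOk u (dist v u) = true := by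
  decide +kernel

/-! ### Exhaustive search -/

/-- Implication, reduced lazily. -/
abbrev implies (a b : Bool) : Bool := Bool.rec (motive := fun _ => Bool) true b a

lemma implies_eq_true {a b : Bool} : implies a b = true ↔ (a = true → b = true) := by
  cases a <;> cases b <;> simp [implies]

/-- The mask `a` has no element in common with `b`. -/
abbrev disjoint (a b : ℕ) : Bool := Nat.beq (Nat.land a b) (nat_lit 0)

/-- Search through all colorings of the vertices in the list, where the colors from 4 on are not
distinguished. The entries of the list are pairs `(v, m)` such that at least `m` vertices from `v`
on have a color that is at least 4. The argument `a` is a mask of admissible colors, `b` is the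
number of vertices that may still get a color that is at least 4, and `R` collects these
vertices. -/
noncomputable def search (cont : ℕ → ℕ → List ℕ → Bool) (l : List (ℕ × ℕ)) :
    ℕ → ℕ → List ℕ → Bool :=
  List.rec (motive := fun _ => ℕ → ℕ → List ℕ → Bool) cont
    (fun e _ ih => Prod.rec (motive := fun _ => ℕ → ℕ → List ℕ → Bool) (fun v m =>
      VertexData.rec (motive := fun _ => ℕ → ℕ → List ℕ → Bool)
        (fun b₁ b₂ b₃ b₄ k₁ k₂ k₃ _ _ _ a b R =>
          -- Prune when the remaining budget is below the number of large vertices still required.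
          implies (Nat.ble m b)
            (both (either (disjoint a b₁) (ih (Nat.land a k₁) b R))
              (both (either (disjoint a b₂) (ih (Nat.land a k₂) b R))
                (both (either (disjoint a b₃) (ih (Nat.land a k₃) b R))
                  -- A large color spends one unit of the budget and leaves the mask unchanged;
                  -- without budget the branch is closed.
                  (either (disjoint a b₄)
                    (Nat.rec (motive := fun _ => Bool) true (fun b' _ => ih a b' (v :: R)) b))))))
        (vertexData v)) e) l

/-- All colors are admissible, except that the vertices in `l` have a color that is at most 3. -/
noncomputable def start (l : List ℕ) : ℕ :=
  List.rec (motive := fun _ => ℕ) (2 ^ 168 - 1) (fun v _ a => a - 2 ^ (v + 126)) l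

/-- The mask allows all colors, except that the vertices in `l` have a color that is at most 3. -/
def startOk (l : List ℕ) (a : ℕ) : Bool := (List.range 42).all fun u =>
  both (a.testBit u) (both (a.testBit (u + 42)) (both (a.testBit (u + 84))
    (either (l.elem u) (a.testBit (u + 126)))))

/-- The pairs of elements of `l` outside `s` with the trivial bound. -/
def extra (l : List ℕ) (s : List (ℕ × ℕ)) : List (ℕ × ℕ) :=
  (l.filter fun v => !(s.map Prod.fst).elem v).map fun v => (v, 0)

/-- Check that the numbers in the list of pairs are valid bounds, if the vertices in `non` have
colors that are at most 3; of these, only those in `l` are used. -/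
noncomputable def validate (non l : List ℕ) (s : List (ℕ × ℕ)) : Bool :=
  List.rec (motive := fun _ => Bool) true
    (fun e s ih => both ih (Nat.rec (motive := fun _ => Bool) true (fun m _ =>
      -- A bound `m + 1` is proved by showing that budget `m` admits no coloring. The search is
      -- pruned by the bounds of the tail, verified before, while the entry itself gets the trivial
      -- bound 0.
      search (fun _ _ _ => false) ((e.1, 0) :: (s ++ extra l (e :: s))) (start non) m []) e.2)) s

/-! #### Soundness of the search -/

/-- The vertices of a list of pairs. -/
abbrev verts (s : List (ℕ × ℕ)) : List ℕ := s.map Prod.fst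

/-- `g` is a packing coloring of the vertices in `U`. -/
structure Packs (g : ℕ → ℕ) (U : List ℕ) : Prop where
  lt : ∀ u ∈ U, u < 42
  one_le : ∀ u ∈ U, 1 ≤ g u
  lt_dist : ∀ u ∈ U, ∀ v ∈ U, u ≠ v → g u = g v → g u < dist u v

lemma Packs.mono {g : ℕ → ℕ} {U V : List ℕ} (h : Packs g U) (hV : V ⊆ U) : Packs g V :=
  ⟨fun u hu => h.lt u (hV hu), fun u hu => h.one_le u (hV hu),
    fun u hu v hv => h.lt_dist u (hV hu) v (hV hv)⟩

/-- The mask `a` allows the colors of the vertices in `U`. -/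
structure Allows (g : ℕ → ℕ) (a : ℕ) (U : List ℕ) : Prop where
  one : ∀ u ∈ U, g u = 1 → a.testBit u = true
  two : ∀ u ∈ U, g u = 2 → a.testBit (u + 42) = true
  three : ∀ u ∈ U, g u = 3 → a.testBit (u + 84) = true
  four : ∀ u ∈ U, 4 ≤ g u → a.testBit (u + 126) = true

lemma Allows.mono {g : ℕ → ℕ} {a : ℕ} {U V : List ℕ} (h : Allows g a U) (hV : V ⊆ U) :
    Allows g a V :=
  ⟨fun u hu => h.one u (hV hu), fun u hu => h.two u (hV hu), fun u hu => h.three u (hV hu),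
    fun u hu => h.four u (hV hu)⟩

/-- The number of vertices whose color is at least 4. -/
def countLarge (g : ℕ → ℕ) (U : List ℕ) : ℕ := U.countP fun v => 4 ≤ g v

/-- The given bounds on the number of vertices with colors from 4 on are valid. -/
def Bounded (g : ℕ → ℕ) : List (ℕ × ℕ) → Prop
  | [] => True
  | e :: s => e.2 ≤ countLarge g (verts (e :: s)) ∧ Bounded g s

lemma disjoint_two_pow {a i : ℕ} (h : a.testBit i = true) : disjoint a (2 ^ i) = false := by
  have h1 : Nat.land a (2 ^ i) = 2 ^ i := by
    refine (Nat.and_two_pow a i).trans ?_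
    rw [h]; simp
  have h2 : (2 : ℕ) ^ i ≠ 0 := by positivity
  simp only [disjoint, h1]
  exact Bool.eq_false_iff.2 fun h => h2 (Nat.eq_of_beq_eq_true h)

lemma testBit_land {a b i : ℕ} (ha : a.testBit i = true) (hb : b.testBit i = true) :
    (Nat.land a b).testBit i = true := by
  refine (Nat.testBit_and a b i).trans ?_
  rw [ha, hb]; rfl

lemma search_cons {cont : ℕ → ℕ → List ℕ → Bool} {v m a b : ℕ} {s : List (ℕ × ℕ)} {R : List ℕ}
    (hv : v < 42) (hb : m ≤ b) (h : search cont ((v, m) :: s) a b R = true) :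
    (a.testBit v = true → search cont s (Nat.land a (vertexData v).keep₁) b R = true) ∧
    (a.testBit (v + 42) = true → search cont s (Nat.land a (vertexData v).keep₂) b R = true) ∧
    (a.testBit (v + 84) = true → search cont s (Nat.land a (vertexData v).keep₃) b R = true) ∧
    (a.testBit (v + 126) = true → 0 < b → search cont s a (b - 1) (v :: R) = true) := by
  have hbits := bitsOk_vertexData v hv
  simp only [VertexData.bitsOk, both_eq_true, Nat.beq_eq] at hbits
  obtain ⟨⟨e₁, e₂⟩, e₃, e₄⟩ := hbits
  have hcons : search cont ((v, m) :: s) a b R = implies (Nat.ble m b)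
      (both (either (disjoint a (vertexData v).bit₁)
          (search cont s (Nat.land a (vertexData v).keep₁) b R))
        (both (either (disjoint a (vertexData v).bit₂)
            (search cont s (Nat.land a (vertexData v).keep₂) b R))
          (both (either (disjoint a (vertexData v).bit₃)
              (search cont s (Nat.land a (vertexData v).keep₃) b R))
            (either (disjoint a (vertexData v).bit₄)
              (Nat.rec (motive := fun _ => Bool) true
                (fun b' _ => search cont s a b' (v :: R)) b))))) := rfl
  rw [hcons, implies_eq_true] at h
  have h' := h (Nat.ble_eq_true_of_le hb)
  simp only [both_eq_true, either_eq_true, e₁, e₂, e₃, e₄] at h'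
  obtain ⟨h₁, h₂, h₃, h₄⟩ := h'
  refine ⟨fun ht => ?_, fun ht => ?_, fun ht => ?_, fun ht hpos => ?_⟩
  · exact h₁.resolve_left (by rw [disjoint_two_pow ht]; exact Bool.false_ne_true)
  · exact h₂.resolve_left (by rw [disjoint_two_pow ht]; exact Bool.false_ne_true)
  · exact h₃.resolve_left (by rw [disjoint_two_pow ht]; exact Bool.false_ne_true)
  · have h₅ := h₄.resolve_left (by rw [disjoint_two_pow ht]; exact Bool.false_ne_true)
    cases b with
    | zero => exact absurd hpos (lt_irrefl 0)
    | succ b => exact h₅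

lemma Allows.land {g : ℕ → ℕ} {a m : ℕ} {U : List ℕ} (h : Allows g a U)
    (h₁ : ∀ u ∈ U, g u = 1 → m.testBit u = true)
    (h₂ : ∀ u ∈ U, g u = 2 → m.testBit (u + 42) = true)
    (h₃ : ∀ u ∈ U, g u = 3 → m.testBit (u + 84) = true)
    (h₄ : ∀ u ∈ U, 4 ≤ g u → m.testBit (u + 126) = true) : Allows g (Nat.land a m) U :=
  ⟨fun u hu hg => testBit_land (h.one u hu hg) (h₁ u hu hg),
    fun u hu hg => testBit_land (h.two u hu hg) (h₂ u hu hg),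
    fun u hu hg => testBit_land (h.three u hu hg) (h₃ u hu hg),
    fun u hu hg => testBit_land (h.four u hu hg) (h₄ u hu hg)⟩

lemma masks_spec {u v : ℕ} (hu : u < 42) (hv : v < 42) (huv : u ≠ v) :
    (vertexData v).masksOk u (dist v u) = true :=
  (masksOk_vertexData v hv u hu).resolve_left huv

lemma Allows.assign {g : ℕ → ℕ} {a v : ℕ} {U : List ℕ} (hp : Packs g (v :: U)) (hv : v ∉ U)
    (h : Allows g a U) :
    (g v = 1 → Allows g (Nat.land a (vertexData v).keep₁) U) ∧
    (g v = 2 → Allows g (Nat.land a (vertexData v).keep₂) U) ∧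
    (g v = 3 → Allows g (Nat.land a (vertexData v).keep₃) U) := by
  have hv' : v < 42 := hp.lt v List.mem_cons_self
  have hmask : ∀ u ∈ U, (vertexData v).masksOk u (dist v u) = true ∧
      (g u = g v → g v < dist v u) := fun u hu => by
    have hne : u ≠ v := fun h => hv (h ▸ hu)
    refine ⟨masks_spec (hp.lt u (List.mem_cons_of_mem _ hu)) hv' hne, fun hg => ?_⟩
    exact hp.lt_dist v List.mem_cons_self u (List.mem_cons_of_mem _ hu) hne.symm hg.symm
  simp only [VertexData.masksOk, VertexData.masksOk.keepOk, both_eq_true, either_eq_true,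
    Nat.beq_eq, Nat.ble_eq] at hmask
  refine ⟨fun hg => h.land ?_ ?_ ?_ ?_, fun hg => h.land ?_ ?_ ?_ ?_,
    fun hg => h.land ?_ ?_ ?_ ?_⟩ <;> intro u hu hgu <;> have hm := hmask u hu
  · exact hm.1.1.1.resolve_left fun hh => by have := hm.2 (by omega); omega
  · exact hm.1.1.2.1.resolve_left fun hh => by omega
  · exact hm.1.1.2.2.1.resolve_left fun hh => by omega
  · exact hm.1.1.2.2.2
  · exact hm.1.2.1.1.resolve_left fun hh => by omega
  · exact hm.1.2.1.2.1.resolve_left fun hh => by have := hm.2 (by omega); omega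
  · exact hm.1.2.1.2.2.1.resolve_left fun hh => by omega
  · exact hm.1.2.1.2.2.2
  · exact hm.1.2.2.1.1.resolve_left fun hh => by omega
  · exact hm.1.2.2.1.2.1.resolve_left fun hh => by omega
  · exact hm.1.2.2.1.2.2.1.resolve_left fun hh => by have := hm.2 (by omega); omega
  · exact hm.1.2.2.1.2.2.2

/-- The vertices in `l` whose color is at least 4, in front of the list `R`. -/
def collect (g : ℕ → ℕ) : List ℕ → List ℕ → List ℕ
  | [], R => R
  | v :: l, R => if 4 ≤ g v then collect g l (v :: R) else collect g l R

lemma collect_perm (g : ℕ → ℕ) (l R : List ℕ) :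
    (collect g l R).Perm (l.filter (fun v => 4 ≤ g v) ++ R) := by
  induction l generalizing R with
  | nil => exact .refl _
  | cons v l ih =>
    simp only [collect]
    split
    · next h =>
      rw [List.filter_cons_of_pos (by simpa using h)]
      exact (ih (v :: R)).trans List.perm_middle
    · next h =>
      rw [List.filter_cons_of_neg (by simpa using h)]
      exact ih R

/-- Follow the branch that agrees with `g`: the masks never exclude a color used by `g`, and valid
bounds never prune this branch. A successful search therefore forces `cont` to succeed on the large
vertices of `g`; if `cont` is constantly false, no such `g` exists. -/
theorem search_sound {g : ℕ → ℕ} {cont : ℕ → ℕ → List ℕ → Bool} (s : List (ℕ × ℕ)) (U : List ℕ)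
    {a b : ℕ} {R : List ℕ} (hnd : (verts s ++ U).Nodup) (hp : Packs g (verts s ++ U))
    (ha : Allows g a (verts s ++ U)) (hb : countLarge g (verts s) ≤ b) (hs : Bounded g s)
    (h : search cont s a b R = true) :
    ∃ a', Allows g a' U ∧
      cont a' (b - countLarge g (verts s)) (collect g (verts s) R) = true := by
  induction s generalizing a b R with
  | nil => exact ⟨a, ha, h⟩
  | cons e s ih =>
    obtain ⟨v, m⟩ := e
    have hnd' := List.nodup_cons.1 hnd
    have hv : v < 42 := hp.lt v List.mem_cons_self
    have h1 : 1 ≤ g v := hp.one_le v List.mem_cons_self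
    have htail : verts s ++ U ⊆ verts ((v, m) :: s) ++ U := List.subset_cons_self _ _
    have ha' := ha.mono htail
    have hassign := Allows.assign hp hnd'.1 ha'
    obtain ⟨h₁, h₂, h₃, h₄⟩ := search_cons hv (hs.1.trans hb) h
    by_cases hg : 4 ≤ g v
    · have hcount : countLarge g (verts ((v, m) :: s)) = countLarge g (verts s) + 1 :=
        List.countP_cons_of_pos (by simpa using hg)
      rw [hcount] at hb
      obtain ⟨a', ha'', hc⟩ := ih hnd'.2 (hp.mono htail) ha' (by omega) hs.2
        (h₄ (ha.four v List.mem_cons_self hg) (by omega))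
      refine ⟨a', ha'', ?_⟩
      rw [hcount, Nat.add_comm, ← Nat.sub_sub]
      simpa [collect, hg] using hc
    · have hcount : countLarge g (verts ((v, m) :: s)) = countLarge g (verts s) :=
        List.countP_cons_of_neg (by simpa using hg)
      rw [hcount] at hb ⊢
      have hcol : collect g (verts ((v, m) :: s)) R = collect g (verts s) R := by
        simp [collect, hg]
      rw [hcol]
      have hcases : g v = 1 ∨ g v = 2 ∨ g v = 3 := by omega
      rcases hcases with hg' | hg' | hg'
      · exact ih hnd'.2 (hp.mono htail) (hassign.1 hg') hb hs.2
          (h₁ (ha.one v List.mem_cons_self hg'))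
      · exact ih hnd'.2 (hp.mono htail) (hassign.2.1 hg') hb hs.2
          (h₂ (ha.two v List.mem_cons_self hg'))
      · exact ih hnd'.2 (hp.mono htail) (hassign.2.2 hg') hb hs.2
          (h₃ (ha.three v List.mem_cons_self hg'))

lemma allows_start {g : ℕ → ℕ} {non U : List ℕ} (h : startOk non (start non) = true)
    (hU : ∀ u ∈ U, u < 42) (hnon : ∀ v ∈ non, g v ≤ 3) : Allows g (start non) U := by
  simp only [startOk, List.all_eq_true, List.mem_range, both_eq_true, either_eq_true] at h
  refine ⟨fun u hu _ => (h u (hU u hu)).1, fun u hu _ => (h u (hU u hu)).2.1,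
    fun u hu _ => (h u (hU u hu)).2.2.1, fun u hu hg => ?_⟩
  refine (h u (hU u hu)).2.2.2.resolve_left fun hmem => ?_
  have := hnon u (List.elem_iff.1 hmem)
  omega

lemma Bounded.append_zero {g : ℕ → ℕ} {s t : List (ℕ × ℕ)} (hs : Bounded g s)
    (ht : ∀ e ∈ t, e.2 = 0) : Bounded g (s ++ t) := by
  induction s with
  | nil =>
    induction t with
    | nil => trivial
    | cons e t ih =>
      refine ⟨?_, ih fun e he => ht e (List.mem_cons_of_mem _ he)⟩
      rw [ht e List.mem_cons_self]
      exact Nat.zero_le _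
  | cons e s ih =>
    refine ⟨hs.1.trans ?_, ih hs.2⟩
    exact List.Sublist.countP_le (by simp)

/-- If a bound failed, `g` would survive a search with too small a budget. The additional vertices
from `l` have small colors, so they constrain the search without using any budget. -/
theorem validate_sound {g : ℕ → ℕ} {non l : List ℕ} {s : List (ℕ × ℕ)}
    (hstart : startOk non (start non) = true) (hnon : ∀ v ∈ non, g v ≤ 3) (hl : l ⊆ non)
    (hlnd : l.Nodup) (hnd : (verts s).Nodup) (hp : Packs g (verts s ++ l))
    (h : validate non l s = true) : Bounded g s := by
  induction s with
  | nil => trivial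
  | cons e s ih =>
    obtain ⟨v, m⟩ := e
    have hcons : validate non l ((v, m) :: s) = both (validate non l s)
      (Nat.rec (motive := fun _ => Bool) true (fun m _ => search (fun _ _ _ => false)
        ((v, 0) :: (s ++ extra l ((v, m) :: s))) (start non) m []) m) := rfl
    rw [hcons, both_eq_true] at h
    have hs := ih (List.nodup_cons.1 hnd).2 (hp.mono (List.subset_cons_self _ _)) h.1
    refine ⟨?_, hs⟩
    cases m with
    | zero => exact Nat.zero_le _
    | succ m =>
      by_contra hlt
      replace hlt : countLarge g (verts ((v, m + 1) :: s)) ≤ m := by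
        simpa [Nat.lt_succ_iff] using hlt
      have hext : verts (extra l ((v, m + 1) :: s)) =
          l.filter fun u => !(verts ((v, m + 1) :: s)).elem u := by
        simp [extra, verts, Function.comp_def]
      have hsub : verts (extra l ((v, m + 1) :: s)) ⊆ l := by
        rw [hext]; exact List.filter_subset_self _
      have hverts : verts ((v, 0) :: (s ++ extra l ((v, m + 1) :: s))) =
          verts ((v, m + 1) :: s) ++ verts (extra l ((v, m + 1) :: s)) := by simp
      have hpack : Packs g (verts ((v, 0) :: (s ++ extra l ((v, m + 1) :: s))) ++ []) := by
        refine hp.mono ?_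
        rw [List.append_nil, hverts]
        exact List.append_subset.2 ⟨List.subset_append_left _ _,
          List.Subset.trans hsub (List.subset_append_right _ _)⟩
      have hzero : countLarge g (verts (extra l ((v, m + 1) :: s))) = 0 := by
        refine List.countP_eq_zero.2 fun u hu => ?_
        have := hnon u (hl (hsub hu))
        simp; omega
      have hsound := search_sound (g := g) _ [] ?_ hpack
        (allows_start hstart hpack.lt hnon) (b := m) ?_ ⟨Nat.zero_le _, hs.append_zero ?_⟩ h.2
      · obtain ⟨_, _, hfalse⟩ := hsound
        exact Bool.false_ne_true hfalse
      · rw [List.append_nil, hverts]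
        refine List.Nodup.append hnd (by rw [hext]; exact hlnd.filter _) ?_
        intro u hu hu'
        rw [hext, List.mem_filter] at hu'
        simp at hu'
        simp at hu
        tauto
      · rw [hverts]
        unfold countLarge at *
        rw [List.countP_append, hzero]
        exact hlt
      · intro e he
        simp only [extra, List.mem_map] at he
        obtain ⟨_, _, rfl⟩ := he
        rfl

/-! ### Staged search through the colorings of `ST_3^3` -/

/-- Lists of the vertices of the three copies of `ST_3^2` in `ST_3^3`, each with the vertex that is
common to the other two copies. -/
structure Stages where
  o₁ : ℕ
  s₁ : List (ℕ × ℕ)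
  o₂ : ℕ
  s₂ : List (ℕ × ℕ)
  o₃ : ℕ
  s₃ : List (ℕ × ℕ)

/-- The bound at the beginning of the list. -/
def bound (s : List (ℕ × ℕ)) : ℕ := (s.map Prod.snd).headD 0

/-- Search through the colorings of `ST_3^3` with at most `c` vertices of color at least 4,
including those in `must` and excluding those in `non`. -/
noncomputable def Stages.search (d : Stages) (leaf : List ℕ → Bool) (c : ℕ)
    (must non : List ℕ) : Bool :=
  -- While one copy is searched, the large vertices that later copies are known to need are held in
  -- reserve; each reserve is released when its copy is entered.
  SierpinskiPacking.search (fun a b R => SierpinskiPacking.search (fun a b R =>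
    SierpinskiPacking.search (fun _ _ R => leaf R) d.s₃ a (b + bound d.s₃) R) d.s₂ a
      (b + bound d.s₂) R) d.s₁ (start non) (c - must.length - bound d.s₂ - bound d.s₃) must

/-- The elements different from `o`. -/
def without (o : ℕ) (l : List ℕ) : List ℕ := l.filter fun v => !Nat.beq v o

/-- The search succeeds, and its data are valid. -/
noncomputable def Stages.check (d : Stages) (leaf : List ℕ → Bool) (c : ℕ)
    (must non : List ℕ) : Bool :=
  both (both (startOk non (start non))
    ((must ++ (verts d.s₁ ++ (verts d.s₂ ++ verts d.s₃))).isPerm (List.range 42)))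
    -- A common corner is listed in at most one stage, but if its color is small it still constrains
    -- both copies containing it. Only the one opposite to the copy is left out.
    (both (both (validate non (without d.o₁ non) d.s₁) (both (validate non (without d.o₂ non) d.s₂)
      (validate non (without d.o₃ non) d.s₃))) (d.search leaf c must non))

lemma Bounded.bound_le {g : ℕ → ℕ} {s : List (ℕ × ℕ)} (h : Bounded g s) :
    bound s ≤ countLarge g (verts s) := by
  cases s with
  | nil => exact Nat.zero_le _
  | cons e s => exact h.1

lemma countLarge_append (g : ℕ → ℕ) (l l' : List ℕ) :
    countLarge g (l ++ l') = countLarge g l + countLarge g l' := List.countP_append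

theorem Stages.check_sound {g : ℕ → ℕ} {d : Stages} {leaf : List ℕ → Bool} {c : ℕ}
    {must non : List ℕ} (hp : Packs g (List.range 42)) (hmust : ∀ v ∈ must, 4 ≤ g v)
    (hnon : ∀ v ∈ non, v < 42 ∧ g v ≤ 3) (hnd : non.Nodup) (hc : countLarge g (List.range 42) ≤ c)
    (h : d.check leaf c must non = true) :
    ∃ R : List ℕ, R.Perm ((List.range 42).filter fun v => 4 ≤ g v) ∧ leaf R = true := by
  simp only [check, both_eq_true, List.isPerm_iff] at h
  obtain ⟨⟨hstart, hperm⟩, ⟨hv₁, hv₂, hv₃⟩, hsearch⟩ := h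
  have hlarge : ∀ v ∈ non, g v ≤ 3 := fun v hv => (hnon v hv).2
  have hnodup := hperm.nodup_iff.2 List.nodup_range
  have hsub : must ++ (verts d.s₁ ++ (verts d.s₂ ++ verts d.s₃)) ⊆ List.range 42 := hperm.subset
  have hsub₀ := (List.append_subset.1 hsub).2
  have hsub₁ := (List.append_subset.1 hsub₀).1
  have hsub₂ := (List.append_subset.1 (List.append_subset.1 hsub₀).2).1
  have hsub₃ := (List.append_subset.1 (List.append_subset.1 hsub₀).2).2
  have hnd₀ := hnodup.of_append_right
  have hnd₁ := hnd₀.of_append_left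
  have hnd₂ := hnd₀.of_append_right.of_append_left
  have hnd₃ := hnd₀.of_append_right.of_append_right
  have hvalid : ∀ (o : ℕ) (s : List (ℕ × ℕ)), verts s ⊆ List.range 42 → (verts s).Nodup →
      validate non (without o non) s = true → Bounded g s := fun o s hs hsnd hv => by
    have hwo : without o non ⊆ non := List.filter_subset_self _
    refine validate_sound hstart hlarge hwo (hnd.filter _) hsnd
      (hp.mono (List.append_subset.2 ⟨hs, ?_⟩)) hv
    exact fun v hv => List.mem_range.2 (hnon v (hwo hv)).1
  have hb₁ := hvalid _ _ hsub₁ hnd₁ hv₁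
  have hb₂ := hvalid _ _ hsub₂ hnd₂ hv₂
  have hb₃ := hvalid _ _ hsub₃ hnd₃ hv₃
  have hcount : must.length + (countLarge g (verts d.s₁) + (countLarge g (verts d.s₂) +
      countLarge g (verts d.s₃))) ≤ c := by
    have hm : countLarge g must = must.length :=
      List.countP_eq_length.2 fun v hv => by simpa using hmust v hv
    rw [← hm, ← countLarge_append, ← countLarge_append, ← countLarge_append]
    exact (hperm.countP_eq _).trans_le hc
  have hle₂ := hb₂.bound_le
  have hle₃ := hb₃.bound_le
  obtain ⟨a₁, ha₁, h₁⟩ := search_sound d.s₁ (verts d.s₂ ++ verts d.s₃) hnd₀ (hp.mono hsub₀)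
    (allows_start hstart (hp.mono hsub₀).lt hlarge) (by omega) hb₁ hsearch
  have hsub₂₃ := (List.append_subset.1 hsub₀).2
  obtain ⟨a₂, ha₂, h₂⟩ := search_sound d.s₂ (verts d.s₃) hnd₀.of_append_right
    (hp.mono hsub₂₃) ha₁ (by omega) hb₂ h₁
  obtain ⟨a₃, ha₃, h₃⟩ := search_sound d.s₃ [] (by simpa using hnd₃)
    (hp.mono (by simpa using hsub₃)) (by simpa using ha₂) (by omega) hb₃ h₂
  refine ⟨_, ?_, h₃⟩
  have hm : must.filter (fun v => 4 ≤ g v) = must :=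
    List.filter_eq_self.2 fun v hv => by simpa using hmust v hv
  refine ((collect_perm g _ _).trans ?_).trans (hperm.filter _)
  simp only [List.filter_append, hm]
  refine (List.Perm.append_left _ ((collect_perm g _ _).trans
    (List.Perm.append_left _ (collect_perm g _ _)))).trans ?_
  generalize List.filter (fun v => decide (4 ≤ g v)) (verts d.s₁) = A
  generalize List.filter (fun v => decide (4 ≤ g v)) (verts d.s₂) = B
  generalize List.filter (fun v => decide (4 ≤ g v)) (verts d.s₃) = C
  -- As multisets, concatenations are sums, and reordering them is commutativity.
  rw [← Multiset.coe_eq_coe]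
  simp only [← Multiset.coe_add]
  abel

/-! #### Color classes of prescribed size -/

/-- Search for all ways to choose `c` elements of a list that are far apart, and continue with the
remaining elements. -/
noncomputable def pick (far : VertexData → ℕ) (cont : List ℕ → Bool) (l : List ℕ) :
    ℕ → ℕ → List ℕ → Bool :=
  List.rec (motive := fun _ => ℕ → ℕ → List ℕ → Bool)
    (fun c _ R => Nat.rec (motive := fun _ => Bool) (cont R) (fun _ _ => true) c)
    (fun v _ ih c a R => both (ih c a (v :: R)) (either (disjoint a (vertexData v).bit₁)
      (Nat.rec (motive := fun _ => Bool) true (fun c' _ =>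
        ih c' (Nat.land a (far (vertexData v))) R) c))) l

/-- The branch that picks exactly the vertices of color `k` is never cut off, since these are
pairwise at distance more than `k`. It reaches `cont` with the vertices of all other colors. -/
theorem pick_sound {g : ℕ → ℕ} {far : VertexData → ℕ} {cont : List ℕ → Bool} {k : ℕ}
    (hfar : ∀ v < 42, ∀ u < 42, u ≠ v → k < dist v u → (far (vertexData v)).testBit u = true)
    {l : List ℕ} {c a : ℕ} {R : List ℕ} (hnd : l.Nodup) (hp : Packs g l)
    (ha : ∀ u ∈ l, g u = k → a.testBit u = true) (hc : l.countP (fun v => g v = k) = c)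
    (h : pick far cont l c a R = true) :
    ∃ R' : List ℕ, R'.Perm (l.filter (fun v => g v ≠ k) ++ R) ∧ cont R' = true := by
  induction l generalizing c a R with
  | nil =>
    subst hc
    exact ⟨R, .refl _, h⟩
  | cons v l ih =>
    have hcons : pick far cont (v :: l) c a R = both (pick far cont l c a (v :: R))
      (either (disjoint a (vertexData v).bit₁) (Nat.rec (motive := fun _ => Bool) true (fun c' _ =>
        pick far cont l c' (Nat.land a (far (vertexData v))) R) c)) := rfl
    rw [hcons, both_eq_true, either_eq_true] at h
    have hnd' := List.nodup_cons.1 hnd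
    have hp' : Packs g l := hp.mono (List.subset_cons_self _ _)
    have hv : v < 42 := hp.lt v List.mem_cons_self
    by_cases hg : g v = k
    · have hbits := bitsOk_vertexData v hv
      simp only [VertexData.bitsOk, both_eq_true, Nat.beq_eq] at hbits
      rw [hbits.1.1, disjoint_two_pow (ha v List.mem_cons_self hg)] at h
      have h' := h.2.resolve_left Bool.false_ne_true
      rw [List.countP_cons_of_pos (by simpa using hg)] at hc
      subst hc
      rw [List.filter_cons_of_neg (by simpa using hg)]
      refine ih hnd'.2 hp' (fun u hu hgu => ?_) rfl h'
      have hne : u ≠ v := fun huv => hnd'.1 (huv ▸ hu)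
      have hmem := List.mem_cons_of_mem v hu
      refine testBit_land (ha u hmem hgu) (hfar v hv u (hp.lt u hmem) hne ?_)
      rw [← hg]
      exact hp.lt_dist v List.mem_cons_self u hmem hne.symm (hg.trans hgu.symm)
    · rw [List.countP_cons_of_neg (by simpa using hg)] at hc
      rw [List.filter_cons_of_pos (by simpa using hg)]
      obtain ⟨R', hR', hcont⟩ := ih hnd'.2 hp'
        (fun u hu => ha u (List.mem_cons_of_mem v hu)) hc h.1
      exact ⟨R', hR'.trans List.perm_middle, hcont⟩

lemma far_spec (v : ℕ) (hv : v < 42) (u : ℕ) (hu : u < 42) (huv : u ≠ v) :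
    (5 < dist v u → (vertexData v).far₅.testBit u = true) ∧
    (6 < dist v u → (vertexData v).far₆.testBit u = true) ∧
    (7 < dist v u → (vertexData v).far₇.testBit u = true) := by
  have h := masks_spec hu hv huv
  simp only [VertexData.masksOk, both_eq_true, either_eq_true, Nat.ble_eq] at h
  obtain ⟨-, -, -, h₅, h₆, h₇⟩ := h
  exact ⟨fun hk => h₅.resolve_left (by omega), fun hk => h₆.resolve_left (by omega),
    fun hk => h₇.resolve_left (by omega)⟩

/-- There are exactly `c + 12` vertices, and one cannot choose disjoint color classes of `c`
vertices of color 6, two vertices of color 7 and three vertices of color 5 among them. -/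
noncomputable def leafCheck (c : ℕ) (R : List ℕ) : Bool :=
  -- The total comes from at most 3 vertices for each of the colors 4 and 5, `c` for color 6, 2 for
  -- color 7, and one for each of the colors 8 to 11.
  both (Nat.beq R.length (c + 12)) (pick VertexData.far₆ (fun R => pick VertexData.far₇ (fun R =>
    pick VertexData.far₅ (fun _ => false) R 3 (2 ^ 42 - 1) []) R 2 (2 ^ 42 - 1) []) R c
      (2 ^ 42 - 1) [])

/-- The number of vertices of color `k`. -/
def classSize (g : ℕ → ℕ) (R : List ℕ) (k : ℕ) : ℕ := R.countP fun v => g v = k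

lemma classSize_filter_ne {g : ℕ → ℕ} {R : List ℕ} {j k : ℕ} (hjk : j ≠ k) :
    classSize g (R.filter fun v => g v ≠ k) j = classSize g R j := by
  unfold classSize
  rw [List.countP_filter]
  refine List.countP_congr fun v _ => ?_
  simp only [Bool.and_eq_true, decide_eq_true_eq]
  exact ⟨fun h => h.1, fun h => ⟨h, h.trans_ne hjk⟩⟩

lemma testBit_full {u : ℕ} (hu : u < 42) : (2 ^ 42 - 1).testBit u = true := by
  rw [Nat.testBit_two_pow_sub_one]
  simpa using hu

lemma leafCheck_sound {g : ℕ → ℕ} {R : List ℕ} {c : ℕ} (hnd : R.Nodup) (hp : Packs g R)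
    (h₆ : classSize g R 6 = c) (h₇ : classSize g R 7 = 2) (h₅ : classSize g R 5 = 3)
    (h : leafCheck c R = true) : False := by
  rw [leafCheck, both_eq_true] at h
  obtain ⟨R₁, hR₁, h₁⟩ := pick_sound (k := 6)
    (fun v hv u hu huv => (far_spec v hv u hu huv).2.1) hnd hp
    (fun u hu _ => testBit_full (hp.lt u hu)) h₆ h.2
  rw [List.append_nil] at hR₁
  have hnd₁ := hR₁.nodup_iff.2 (hnd.filter _)
  have hp₁ : Packs g R₁ := hp.mono (List.Subset.trans hR₁.subset (List.filter_subset_self _))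
  have hs₁ : ∀ j, j ≠ 6 → classSize g R₁ j = classSize g R j := fun j hj =>
    (hR₁.countP_eq _).trans (classSize_filter_ne hj)
  obtain ⟨R₂, hR₂, h₂⟩ := pick_sound (k := 7)
    (fun v hv u hu huv => (far_spec v hv u hu huv).2.2) hnd₁ hp₁
    (fun u hu _ => testBit_full (hp₁.lt u hu)) ((hs₁ 7 (by decide)).trans h₇) h₁
  rw [List.append_nil] at hR₂
  have hnd₂ := hR₂.nodup_iff.2 (hnd₁.filter _)
  have hp₂ : Packs g R₂ := hp₁.mono (List.Subset.trans hR₂.subset (List.filter_subset_self _))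
  have hs₂ : classSize g R₂ 5 = 3 :=
    ((hR₂.countP_eq _).trans (classSize_filter_ne (by decide))).trans ((hs₁ 5 (by decide)).trans h₅)
  obtain ⟨_, _, hfalse⟩ := pick_sound (k := 5)
    (fun v hv u hu huv => (far_spec v hv u hu huv).1) hnd₂ hp₂
    (fun u hu _ => testBit_full (hp₂.lt u hu)) hs₂ h₂
  exact Bool.false_ne_true hfalse

/-! ### At least 12 colors are needed for `ST_3^3`

In a packing coloring with 11 colors, the colors 4, 5, 6, 7 are used at most three times and the
colors 8, …, 11 at most once, so there are few vertices of color at least 4. The search determines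
all possible sets of such vertices, and `leafCheck` shows that they cannot be split into color
classes of the required sizes. -/

/-- The data of the search through the colorings of `ST_3^3`. The arguments say
which of the vertices 28, 14 and 8 have a color that is at least 4. -/
def stages : Bool → Bool → Bool → Stages
  -- The order of copies and vertices is a free choice; the bounds are verified by `validate`.
  | false, false, false => ⟨28, [(13, 5), (12, 4), (14, 3), (11, 3), (10, 3), (5, 2), (9, 2), (7,
    1), (8, 1), (6, 1), (4, 1), (3, 0), (2, 0), (1, 0), (0, 0)], 8, [(34, 5), (36, 4), (28, 3),
    (35, 3), (31, 3), (37, 2), (29, 2), (32, 1), (30, 1), (38, 1), (33, 0), (40, 0), (39, 0), (41,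
    0)], 14, [(16, 5), (15, 4), (18, 3), (19, 3), (17, 2), (26, 2), (25, 1), (27, 1), (21, 1),
    (24, 0), (20, 0), (23, 0), (22, 0)]⟩
  | true, false, false => ⟨14, [(16, 4), (15, 3), (8, 3), (18, 3), (19, 2), (17, 2), (26, 2), (25,
    1), (27, 1), (21, 1), (24, 0), (20, 0), (23, 0), (22, 0)], 8, [(34, 4), (36, 3), (35, 3), (31,
    3), (37, 2), (29, 2), (32, 1), (14, 1), (30, 1), (38, 1), (33, 0), (40, 0), (39, 0), (41, 0)],
    28, [(13, 5), (12, 4), (11, 3), (10, 3), (5, 2), (9, 2), (7, 1), (6, 1), (4, 1), (3, 0), (2,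
    0), (1, 0), (0, 0)]⟩
  | false, true, false => ⟨8, [(34, 4), (36, 3), (28, 3), (35, 3), (31, 2), (37, 2), (29, 2), (32,
    1), (30, 1), (38, 1), (33, 0), (40, 0), (39, 0), (41, 0)], 28, [(13, 4), (12, 3), (11, 3),
    (10, 3), (5, 2), (9, 2), (7, 1), (8, 1), (6, 1), (4, 1), (3, 0), (2, 0), (1, 0), (0, 0)], 14,
    [(16, 5), (15, 4), (18, 3), (19, 3), (17, 2), (26, 2), (25, 1), (27, 1), (21, 1), (24, 0),
    (20, 0), (23, 0), (22, 0)]⟩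
  | true, true, false => ⟨28, [(13, 4), (12, 3), (11, 3), (10, 3), (5, 2), (9, 2), (7, 1), (8, 1),
    (6, 1), (4, 1), (3, 0), (2, 0), (1, 0), (0, 0)], 14, [(16, 4), (15, 3), (18, 3), (19, 2), (17,
    2), (26, 2), (25, 1), (27, 1), (21, 1), (24, 0), (20, 0), (23, 0), (22, 0)], 8, [(34, 4), (36,
    3), (35, 3), (31, 2), (37, 2), (29, 2), (32, 1), (30, 1), (38, 1), (33, 0), (40, 0), (39, 0),
    (41, 0)]⟩
  | false, false, true => ⟨28, [(13, 4), (12, 3), (14, 3), (11, 3), (10, 2), (5, 2), (9, 2), (7,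
    1), (6, 1), (4, 1), (3, 0), (2, 0), (1, 0), (0, 0)], 14, [(16, 4), (15, 3), (18, 3), (19, 3),
    (17, 2), (26, 2), (25, 1), (28, 1), (27, 1), (21, 1), (24, 0), (20, 0), (23, 0), (22, 0)], 8,
    [(34, 5), (36, 4), (35, 3), (31, 3), (37, 2), (29, 2), (32, 1), (30, 1), (38, 1), (33, 0),
    (40, 0), (39, 0), (41, 0)]⟩
  | true, false, true => ⟨8, [(34, 4), (36, 3), (35, 3), (31, 3), (37, 2), (29, 2), (32, 1), (14,
    1), (30, 1), (38, 1), (33, 0), (40, 0), (39, 0), (41, 0)], 28, [(13, 4), (12, 3), (11, 3),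
    (10, 2), (5, 2), (9, 2), (7, 1), (6, 1), (4, 1), (3, 0), (2, 0), (1, 0), (0, 0)], 14, [(16,
    4), (15, 3), (18, 3), (19, 2), (17, 2), (26, 2), (25, 1), (27, 1), (21, 1), (24, 0), (20, 0),
    (23, 0), (22, 0)]⟩
  | false, true, true => ⟨14, [(16, 4), (15, 3), (18, 3), (19, 3), (17, 2), (26, 2), (25, 1), (28,
    1), (27, 1), (21, 1), (24, 0), (20, 0), (23, 0), (22, 0)], 8, [(34, 4), (36, 3), (35, 3), (31,
    2), (37, 2), (29, 2), (32, 1), (30, 1), (38, 1), (33, 0), (40, 0), (39, 0), (41, 0)], 28,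
    [(13, 4), (12, 3), (11, 3), (10, 2), (5, 2), (9, 2), (7, 1), (6, 1), (4, 1), (3, 0), (2, 0),
    (1, 0), (0, 0)]⟩
  | true, true, true => ⟨28, [(13, 4), (12, 3), (11, 3), (10, 2), (5, 2), (9, 2), (7, 1), (6, 1),
    (4, 1), (3, 0), (2, 0), (1, 0), (0, 0)], 14, [(16, 4), (15, 3), (18, 3), (19, 2), (17, 2),
    (26, 2), (25, 1), (27, 1), (21, 1), (24, 0), (20, 0), (23, 0), (22, 0)], 8, [(34, 4), (36, 3),
    (35, 3), (31, 2), (37, 2), (29, 2), (32, 1), (30, 1), (38, 1), (33, 0), (40, 0), (39, 0), (41,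
    0)]⟩

/-- The data of the search through the colorings whose color at the corner `0` is at least 4. The
arguments say which of the vertices 28, 14 and 8 have a color that is at least 4. -/
def stagesCorner : Bool → Bool → Bool → Stages
  | false, false, false => ⟨28, [(13, 4), (12, 4), (14, 3), (11, 3), (10, 2), (5, 2), (9, 2), (7,
    1), (8, 1), (6, 1), (4, 0), (3, 0), (2, 0), (1, 0)], 8, [(34, 5), (36, 4), (28, 3), (35, 3),
    (31, 3), (37, 2), (29, 2), (32, 1), (30, 1), (38, 1), (33, 0), (40, 0), (39, 0), (41, 0)], 14,
    [(16, 5), (15, 4), (18, 3), (19, 3), (17, 2), (26, 2), (25, 1), (27, 1), (21, 1), (24, 0),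
    (20, 0), (23, 0), (22, 0)]⟩
  | true, false, false => ⟨8, [(34, 4), (36, 3), (35, 3), (31, 3), (37, 2), (29, 2), (32, 1), (14,
    1), (30, 1), (38, 1), (33, 0), (40, 0), (39, 0), (41, 0)], 28, [(13, 4), (12, 4), (11, 3),
    (10, 2), (5, 2), (9, 2), (7, 1), (8, 1), (6, 1), (4, 0), (3, 0), (2, 0), (1, 0)], 14, [(16,
    4), (15, 3), (18, 3), (19, 2), (17, 2), (26, 2), (25, 1), (27, 1), (21, 1), (24, 0), (20, 0),
    (23, 0), (22, 0)]⟩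
  | false, true, false => ⟨8, [(34, 4), (36, 3), (28, 3), (35, 3), (31, 2), (37, 2), (29, 2), (32,
    1), (30, 1), (38, 1), (33, 0), (40, 0), (39, 0), (41, 0)], 28, [(13, 4), (12, 3), (11, 3),
    (10, 2), (5, 2), (9, 2), (7, 1), (8, 1), (6, 1), (4, 0), (3, 0), (2, 0), (1, 0)], 14, [(16,
    5), (15, 4), (18, 3), (19, 3), (17, 2), (26, 2), (25, 1), (27, 1), (21, 1), (24, 0), (20, 0),
    (23, 0), (22, 0)]⟩
  | true, true, false => ⟨14, [(16, 4), (15, 3), (8, 3), (18, 3), (19, 2), (17, 2), (26, 2), (25,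
    1), (27, 1), (21, 1), (24, 0), (20, 0), (23, 0), (22, 0)], 28, [(13, 4), (12, 3), (11, 3),
    (10, 2), (5, 2), (9, 2), (7, 1), (6, 1), (4, 0), (3, 0), (2, 0), (1, 0)], 8, [(34, 4), (36,
    3), (35, 3), (31, 2), (37, 2), (29, 2), (32, 1), (30, 1), (38, 1), (33, 0), (40, 0), (39, 0),
    (41, 0)]⟩
  | false, false, true => ⟨14, [(16, 4), (15, 3), (18, 3), (19, 3), (17, 2), (26, 2), (25, 1),
    (28, 1), (27, 1), (21, 1), (24, 0), (20, 0), (23, 0), (22, 0)], 8, [(34, 5), (36, 4), (35, 3),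
    (31, 3), (37, 2), (29, 2), (32, 1), (14, 1), (30, 1), (38, 1), (33, 0), (40, 0), (39, 0), (41,
    0)], 28, [(13, 4), (12, 3), (11, 2), (10, 2), (5, 2), (9, 2), (7, 1), (6, 1), (4, 0), (3, 0),
    (2, 0), (1, 0)]⟩
  | true, false, true => ⟨8, [(34, 4), (36, 3), (35, 3), (31, 3), (37, 2), (29, 2), (32, 1), (14,
    1), (30, 1), (38, 1), (33, 0), (40, 0), (39, 0), (41, 0)], 28, [(13, 4), (12, 3), (11, 2),
    (10, 2), (5, 2), (9, 2), (7, 1), (6, 1), (4, 0), (3, 0), (2, 0), (1, 0)], 14, [(16, 4), (15,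
    3), (18, 3), (19, 2), (17, 2), (26, 2), (25, 1), (27, 1), (21, 1), (24, 0), (20, 0), (23, 0),
    (22, 0)]⟩
  | false, true, true => ⟨14, [(16, 4), (15, 3), (18, 3), (19, 3), (17, 2), (26, 2), (25, 1), (28,
    1), (27, 1), (21, 1), (24, 0), (20, 0), (23, 0), (22, 0)], 8, [(34, 4), (36, 3), (35, 3), (31,
    2), (37, 2), (29, 2), (32, 1), (30, 1), (38, 1), (33, 0), (40, 0), (39, 0), (41, 0)], 28,
    [(13, 4), (12, 3), (11, 2), (10, 2), (5, 2), (9, 2), (7, 1), (6, 1), (4, 0), (3, 0), (2, 0),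
    (1, 0)]⟩
  | true, true, true => ⟨28, [(13, 4), (12, 3), (11, 2), (10, 2), (5, 2), (9, 2), (7, 1), (6, 1),
    (4, 0), (3, 0), (2, 0), (1, 0)], 14, [(16, 4), (15, 3), (18, 3), (19, 2), (17, 2), (26, 2),
    (25, 1), (27, 1), (21, 1), (24, 0), (20, 0), (23, 0), (22, 0)], 8, [(34, 4), (36, 3), (35, 3),
    (31, 2), (37, 2), (29, 2), (32, 1), (30, 1), (38, 1), (33, 0), (40, 0), (39, 0), (41, 0)]⟩

/-- The data of the search through the colorings whose colors at 20, 40 and 2 are at least 4. The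
arguments say which of the vertices 28, 14 and 8 have a color that is at least 4. -/
def stagesTriple : Bool → Bool → Bool → Stages
  | false, false, false => ⟨28, [(13, 4), (12, 3), (14, 3), (11, 3), (10, 2), (5, 2), (9, 1), (7,
    1), (8, 0), (6, 0), (4, 0), (3, 0), (1, 0), (0, 0)], 14, [(16, 4), (15, 3), (18, 3), (19, 2),
    (17, 2), (26, 1), (25, 1), (28, 0), (27, 0), (21, 0), (24, 0), (23, 0), (22, 0)], 8, [(34, 4),
    (36, 3), (35, 3), (31, 2), (37, 2), (29, 1), (32, 1), (30, 0), (38, 0), (33, 0), (39, 0), (41,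
    0)]⟩
  | true, false, false => ⟨8, [(34, 3), (36, 3), (35, 3), (31, 2), (37, 2), (29, 1), (32, 1), (14,
    0), (30, 0), (38, 0), (33, 0), (39, 0), (41, 0)], 28, [(13, 4), (12, 3), (11, 3), (10, 2), (5,
    2), (9, 1), (7, 1), (8, 0), (6, 0), (4, 0), (3, 0), (1, 0), (0, 0)], 14, [(16, 4), (15, 3),
    (18, 2), (19, 2), (17, 2), (26, 1), (25, 1), (27, 0), (21, 0), (24, 0), (23, 0), (22, 0)]⟩
  | false, true, false => ⟨28, [(13, 3), (12, 3), (11, 3), (10, 2), (5, 2), (9, 1), (7, 1), (8,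
    0), (6, 0), (4, 0), (3, 0), (1, 0), (0, 0)], 14, [(16, 4), (15, 3), (18, 3), (19, 2), (17, 2),
    (26, 1), (25, 1), (28, 0), (27, 0), (21, 0), (24, 0), (23, 0), (22, 0)], 8, [(34, 4), (36, 3),
    (35, 2), (31, 2), (37, 2), (29, 1), (32, 1), (30, 0), (38, 0), (33, 0), (39, 0), (41, 0)]⟩
  | true, true, false => ⟨28, [(13, 3), (12, 3), (11, 3), (10, 2), (5, 2), (9, 1), (7, 1), (8, 0),
    (6, 0), (4, 0), (3, 0), (1, 0), (0, 0)], 14, [(16, 4), (15, 3), (18, 2), (19, 2), (17, 2),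
    (26, 1), (25, 1), (27, 0), (21, 0), (24, 0), (23, 0), (22, 0)], 8, [(34, 3), (36, 3), (35, 2),
    (31, 2), (37, 2), (29, 1), (32, 1), (30, 0), (38, 0), (33, 0), (39, 0), (41, 0)]⟩
  | false, false, true => ⟨14, [(16, 3), (15, 3), (18, 3), (19, 2), (17, 2), (26, 1), (25, 1),
    (28, 0), (27, 0), (21, 0), (24, 0), (23, 0), (22, 0)], 8, [(34, 4), (36, 3), (35, 3), (31, 2),
    (37, 2), (29, 1), (32, 1), (14, 0), (30, 0), (38, 0), (33, 0), (39, 0), (41, 0)], 28, [(13,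
    4), (12, 3), (11, 2), (10, 2), (5, 2), (9, 1), (7, 1), (6, 0), (4, 0), (3, 0), (1, 0), (0,
    0)]⟩
  | true, false, true => ⟨8, [(34, 3), (36, 3), (35, 3), (31, 2), (37, 2), (29, 1), (32, 1), (14,
    0), (30, 0), (38, 0), (33, 0), (39, 0), (41, 0)], 28, [(13, 4), (12, 3), (11, 2), (10, 2), (5,
    2), (9, 1), (7, 1), (6, 0), (4, 0), (3, 0), (1, 0), (0, 0)], 14, [(16, 3), (15, 3), (18, 2),
    (19, 2), (17, 2), (26, 1), (25, 1), (27, 0), (21, 0), (24, 0), (23, 0), (22, 0)]⟩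
  | false, true, true => ⟨14, [(16, 3), (15, 3), (18, 3), (19, 2), (17, 2), (26, 1), (25, 1), (28,
    0), (27, 0), (21, 0), (24, 0), (23, 0), (22, 0)], 8, [(34, 4), (36, 3), (35, 2), (31, 2), (37,
    2), (29, 1), (32, 1), (30, 0), (38, 0), (33, 0), (39, 0), (41, 0)], 28, [(13, 3), (12, 3),
    (11, 2), (10, 2), (5, 2), (9, 1), (7, 1), (6, 0), (4, 0), (3, 0), (1, 0), (0, 0)]⟩
  | true, true, true => ⟨28, [(13, 3), (12, 3), (11, 2), (10, 2), (5, 2), (9, 1), (7, 1), (6, 0),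
    (4, 0), (3, 0), (1, 0), (0, 0)], 14, [(16, 3), (15, 3), (18, 2), (19, 2), (17, 2), (26, 1),
    (25, 1), (27, 0), (21, 0), (24, 0), (23, 0), (22, 0)], 8, [(34, 3), (36, 3), (35, 2), (31, 2),
    (37, 2), (29, 1), (32, 1), (30, 0), (38, 0), (33, 0), (39, 0), (41, 0)]⟩

/-- The data of the search through the colorings whose colors at all corners are at least 4. The
arguments say which of the vertices 28, 14 and 8 have a color that is at least 4. -/
def stagesCorners : Bool → Bool → Bool → Stages
  | false, false, false => ⟨28, [(13, 4), (12, 4), (14, 3), (11, 3), (10, 2), (5, 2), (9, 2), (7,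
    1), (8, 1), (6, 1), (4, 0), (3, 0), (2, 0), (1, 0)], 14, [(16, 4), (15, 4), (18, 3), (19, 2),
    (17, 2), (26, 2), (25, 1), (28, 1), (27, 1), (21, 0), (24, 0), (20, 0), (23, 0)], 8, [(34, 4),
    (36, 4), (35, 3), (31, 2), (37, 2), (29, 2), (32, 1), (30, 1), (38, 0), (33, 0), (40, 0), (39,
    0)]⟩
  | true, false, false => ⟨28, [(13, 4), (12, 4), (14, 3), (11, 3), (10, 2), (5, 2), (9, 2), (7,
    1), (8, 1), (6, 1), (4, 0), (3, 0), (2, 0), (1, 0)], 14, [(16, 4), (15, 3), (18, 2), (19, 2),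
    (17, 2), (26, 2), (25, 1), (27, 1), (21, 0), (24, 0), (20, 0), (23, 0)], 8, [(34, 4), (36, 3),
    (35, 3), (31, 2), (37, 2), (29, 2), (32, 1), (30, 1), (38, 0), (33, 0), (40, 0), (39, 0)]⟩
  | false, true, false => ⟨14, [(16, 4), (15, 4), (8, 3), (18, 3), (19, 2), (17, 2), (26, 2), (25,
    1), (28, 1), (27, 1), (21, 0), (24, 0), (20, 0), (23, 0)], 8, [(34, 4), (36, 3), (35, 2), (31,
    2), (37, 2), (29, 2), (32, 1), (30, 1), (38, 0), (33, 0), (40, 0), (39, 0)], 28, [(13, 4),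
    (12, 3), (11, 3), (10, 2), (5, 2), (9, 2), (7, 1), (6, 1), (4, 0), (3, 0), (2, 0), (1, 0)]⟩
  | true, true, false => ⟨14, [(16, 4), (15, 3), (8, 2), (18, 2), (19, 2), (17, 2), (26, 2), (25,
    1), (27, 1), (21, 0), (24, 0), (20, 0), (23, 0)], 28, [(13, 4), (12, 3), (11, 3), (10, 2), (5,
    2), (9, 2), (7, 1), (6, 1), (4, 0), (3, 0), (2, 0), (1, 0)], 8, [(34, 4), (36, 3), (35, 2),
    (31, 2), (37, 2), (29, 2), (32, 1), (30, 1), (38, 0), (33, 0), (40, 0), (39, 0)]⟩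
  | false, false, true => ⟨8, [(34, 4), (36, 4), (28, 3), (35, 3), (31, 2), (37, 2), (29, 2), (32,
    1), (14, 1), (30, 1), (38, 0), (33, 0), (40, 0), (39, 0)], 28, [(13, 4), (12, 3), (11, 2),
    (10, 2), (5, 2), (9, 2), (7, 1), (6, 1), (4, 0), (3, 0), (2, 0), (1, 0)], 14, [(16, 4), (15,
    3), (18, 3), (19, 2), (17, 2), (26, 2), (25, 1), (27, 1), (21, 0), (24, 0), (20, 0), (23, 0)]⟩
  | true, false, true => ⟨28, [(13, 4), (12, 3), (14, 2), (11, 2), (10, 2), (5, 2), (9, 2), (7,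
    1), (6, 1), (4, 0), (3, 0), (2, 0), (1, 0)], 14, [(16, 4), (15, 3), (18, 2), (19, 2), (17, 2),
    (26, 2), (25, 1), (27, 1), (21, 0), (24, 0), (20, 0), (23, 0)], 8, [(34, 4), (36, 3), (35, 3),
    (31, 2), (37, 2), (29, 2), (32, 1), (30, 1), (38, 0), (33, 0), (40, 0), (39, 0)]⟩
  | false, true, true => ⟨28, [(13, 4), (12, 3), (11, 2), (10, 2), (5, 2), (9, 2), (7, 1), (6, 1),
    (4, 0), (3, 0), (2, 0), (1, 0)], 8, [(34, 4), (36, 3), (28, 2), (35, 2), (31, 2), (37, 2),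
    (29, 2), (32, 1), (30, 1), (38, 0), (33, 0), (40, 0), (39, 0)], 14, [(16, 4), (15, 3), (18,
    3), (19, 2), (17, 2), (26, 2), (25, 1), (27, 1), (21, 0), (24, 0), (20, 0), (23, 0)]⟩
  | true, true, true => ⟨28, [(13, 4), (12, 3), (11, 2), (10, 2), (5, 2), (9, 2), (7, 1), (6, 1),
    (4, 0), (3, 0), (2, 0), (1, 0)], 14, [(16, 4), (15, 3), (18, 2), (19, 2), (17, 2), (26, 2),
    (25, 1), (27, 1), (21, 0), (24, 0), (20, 0), (23, 0)], 8, [(34, 4), (36, 3), (35, 2), (31, 2),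
    (37, 2), (29, 2), (32, 1), (30, 1), (38, 0), (33, 0), (40, 0), (39, 0)]⟩


/-- The vertices among 28, 14 and 8 indicated by the arguments. -/
def glueVertices (x y z : Bool) : List ℕ :=
  (bif x then [28] else []) ++ ((bif y then [14] else []) ++ (bif z then [8] else []))

/-- The budget is 14 = 2 + 12, for colorings in which the colors 6 and 7 occur at most twice. -/
lemma stages_check : ∀ x y z, (stages x y z).check (leafCheck 2) 14
    (glueVertices x y z) (glueVertices (!x) (!y) (!z)) = true := by
  decide +kernel

/-- The budget is 15 = 3 + 12: color 6 may now occur three times, and in exchange the corner 0 is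
large. -/
lemma stagesCorner_check : ∀ x y z, (stagesCorner x y z).check (leafCheck 3) 15
    (0 :: glueVertices x y z) (glueVertices (!x) (!y) (!z)) = true := by
  decide +kernel

lemma stagesTriple_check : ∀ x y z, (stagesTriple x y z).check (leafCheck 3) 15
    (20 :: 40 :: 2 :: glueVertices x y z) (glueVertices (!x) (!y) (!z)) = true := by
  decide +kernel

/-- The budget 16 = 4 · 3 + 4 assumes nothing about the colors 6 and 7 beyond three occurrences
each. No coloring at all is left, so no examination of color classes is needed. -/
lemma stagesCorners_check : ∀ x y z, (stagesCorners x y z).check (fun _ => false) 16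
    (0 :: 22 :: 41 :: glueVertices x y z) (glueVertices (!x) (!y) (!z)) = true := by
  decide +kernel

/-- `g` is a packing coloring of `ST_3^3` with at most 11 colors. -/
structure Good (g : ℕ → ℕ) : Prop where
  packs : Packs g (List.range 42)
  le : ∀ u < 42, g u ≤ 11

/-- Case analysis on which of the vertices 28, 14 and 8 have a color that is at least 4. -/
lemma exists_of_check {g : ℕ → ℕ} (hp : Packs g (List.range 42)) {d : Bool → Bool → Bool → Stages}
    {leaf : List ℕ → Bool} {c : ℕ} {must : List ℕ} (hmust : ∀ v ∈ must, 4 ≤ g v)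
    (hc : countLarge g (List.range 42) ≤ c)
    (h : ∀ x y z, (d x y z).check leaf c (must ++ glueVertices x y z)
      (glueVertices (!x) (!y) (!z)) = true) :
    ∃ R : List ℕ, R.Perm ((List.range 42).filter fun v => 4 ≤ g v) ∧ leaf R = true := by
  have hmem : ∀ x y z v, v ∈ glueVertices x y z ↔
      (x = true ∧ v = 28) ∨ (y = true ∧ v = 14) ∨ (z = true ∧ v = 8) := by
    intro x y z v
    cases x <;> cases y <;> cases z <;> simp [glueVertices]
  have hnd : ∀ x y z, (glueVertices x y z).Nodup := by decide
  refine Stages.check_sound hp (fun v hv => ?_) (fun v hv => ?_) (hnd _ _ _) hc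
    (h (decide (4 ≤ g 28)) (decide (4 ≤ g 14)) (decide (4 ≤ g 8)))
  · rcases List.mem_append.1 hv with hv | hv
    · exact hmust v hv
    · simp only [hmem, decide_eq_true_eq] at hv
      rcases hv with ⟨h, rfl⟩ | ⟨h, rfl⟩ | ⟨h, rfl⟩ <;> exact h
  · simp only [hmem, Bool.not_eq_true', decide_eq_false_iff_not, not_le] at hv
    rcases hv with ⟨h, rfl⟩ | ⟨h, rfl⟩ | ⟨h, rfl⟩ <;> omega

/-! ### Sizes of the large color classes -/

/-- The vertices of color `k`. -/
def colorClass (g : ℕ → ℕ) (k : ℕ) : Finset ℕ := (Finset.range 42).filter fun v => g v = k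

lemma classSize_range (g : ℕ → ℕ) (k : ℕ) :
    classSize g (List.range 42) k = (colorClass g k).card := by
  have h : colorClass g k = ((List.range 42).filter fun v => g v = k).toFinset := by
    ext v; simp [colorClass]
  rw [h, List.toFinset_card_of_nodup (List.nodup_range.filter _), classSize,
    List.countP_eq_length_filter]

lemma dist_le_eight : ∀ u < 42, ∀ v < 42, dist u v ≤ 8 := by decide +kernel

lemma dist_le_four : ∀ u < 42, ∀ v < 42, rep u 0 = rep v 0 → dist u v ≤ 4 := by decide +kernel

set_option synthInstance.maxSize 10000 in
set_option synthInstance.maxHeartbeats 200000 in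
-- This locates color 7 if it occurs three times: on the three corners.
lemma far_triple_eight : ∀ u < 42, ∀ v < 42, 7 < dist u v → ∀ w < 42, 7 < dist u w →
    7 < dist v w → ∀ c ∈ [0, 22, 41], c ∈ [u, v, w] := by
  decide +kernel

set_option synthInstance.maxSize 10000 in
set_option synthInstance.maxHeartbeats 200000 in
-- This locates color 6 if it occurs three times. The two exceptional triples consist of one
-- neighbor of each corner and are mirror images of each other.
lemma far_triple_seven : ∀ u < 42, ∀ v < 42, 6 < dist u v → ∀ w < 42, 6 < dist u w →
    6 < dist v w → (∃ c ∈ [0, 22, 41], c ∈ [u, v, w]) ∨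
      (∀ c ∈ [20, 40, 2], c ∈ [u, v, w]) ∨
      (∀ c ∈ [39, 23, 1], c ∈ [u, v, w]) := by
  decide +kernel

lemma Good.lt_dist {g : ℕ → ℕ} (hg : Good g) {k u v : ℕ} (hu : u ∈ colorClass g k)
    (hv : v ∈ colorClass g k) (huv : u ≠ v) : k < dist u v := by
  rw [colorClass, Finset.mem_filter, Finset.mem_range] at hu hv
  have := hg.packs.lt_dist u (List.mem_range.2 hu.1) v (List.mem_range.2 hv.1) huv
    (hu.2.trans hv.2.symm)
  rwa [hu.2] at this

lemma mem_colorClass {g : ℕ → ℕ} {k v : ℕ} : v ∈ colorClass g k ↔ v < 42 ∧ g v = k := by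
  rw [colorClass, Finset.mem_filter, Finset.mem_range]

lemma Good.card_le_one {g : ℕ → ℕ} (hg : Good g) {k : ℕ} (hk : 8 ≤ k) :
    (colorClass g k).card ≤ 1 := by
  refine Finset.card_le_one.2 fun u hu v hv => by_contra fun huv => ?_
  have h1 := hg.lt_dist hu hv huv
  have h2 := dist_le_eight u (mem_colorClass.1 hu).1 v (mem_colorClass.1 hv).1
  omega

/-- Each copy of ST_3^2 has diameter 4, so it contains at most one vertex of the color; the first
letter of the representing word names the copy. -/
lemma Good.card_le_three {g : ℕ → ℕ} (hg : Good g) {k : ℕ} (hk : 4 ≤ k) :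
    (colorClass g k).card ≤ 3 := by
  have h : (colorClass g k).card ≤ (Finset.univ : Finset (Fin 3)).card := by
    refine Finset.card_le_card_of_injOn (fun v => rep v 0) (fun _ _ => Finset.mem_coe.2
      (Finset.mem_univ _)) fun u hu v hv huv => by_contra fun hne => ?_
    have h1 := hg.lt_dist hu hv hne
    have h2 := dist_le_four u (mem_colorClass.1 hu).1 v (mem_colorClass.1 hv).1 huv
    omega
  simpa using h

lemma length_eq_sum_classSize {g : ℕ → ℕ} {R : List ℕ} (h : ∀ v ∈ R, 4 ≤ g v ∧ g v ≤ 11) :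
    R.length = classSize g R 4 + classSize g R 5 + classSize g R 6 + classSize g R 7 +
      classSize g R 8 + classSize g R 9 + classSize g R 10 + classSize g R 11 := by
  induction R with
  | nil => rfl
  | cons v R ih =>
    have ih' := ih fun u hu => h u (List.mem_cons_of_mem v hu)
    have hv := h v List.mem_cons_self
    simp only [classSize, List.countP_cons, List.length_cons, decide_eq_true_eq] at ih' ⊢
    have hcases : g v = 4 ∨ g v = 5 ∨ g v = 6 ∨ g v = 7 ∨ g v = 8 ∨ g v = 9 ∨ g v = 10 ∨
      g v = 11 := by omega
    rcases hcases with h | h | h | h | h | h | h | h <;> simp [h] <;> omega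

/-- The properties of the list of vertices of color at least 4. -/
lemma Good.large {g : ℕ → ℕ} (hg : Good g) {R : List ℕ}
    (hR : R.Perm ((List.range 42).filter fun v => 4 ≤ g v)) :
    R.Nodup ∧ Packs g R ∧ R.length = countLarge g (List.range 42) ∧
      (∀ k, 4 ≤ k → classSize g R k = (colorClass g k).card) ∧
      R.length = (colorClass g 4).card + (colorClass g 5).card + (colorClass g 6).card +
        (colorClass g 7).card + (colorClass g 8).card + (colorClass g 9).card +
        (colorClass g 10).card + (colorClass g 11).card := by
  have hsize : ∀ k, 4 ≤ k → classSize g R k = (colorClass g k).card := fun k hk => by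
    rw [← classSize_range]
    refine (hR.countP_eq _).trans ?_
    rw [List.countP_filter]
    refine List.countP_congr fun v _ => ?_
    simp only [Bool.and_eq_true, decide_eq_true_eq]
    exact ⟨fun h => h.1, fun h => ⟨h, h ▸ hk⟩⟩
  have hmem : ∀ v ∈ R, v < 42 ∧ 4 ≤ g v := fun v hv => by
    simpa using hR.subset hv
  refine ⟨hR.nodup_iff.2 (List.nodup_range.filter _),
    hg.packs.mono fun v hv => List.mem_range.2 (hmem v hv).1,
    hR.length_eq.trans List.countP_eq_length_filter.symm, hsize, ?_⟩
  rw [length_eq_sum_classSize fun v hv => ⟨(hmem v hv).2, hg.le v (hmem v hv).1⟩]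
  simp only [hsize _ (by decide : 4 ≤ 4), hsize 5 (by decide), hsize 6 (by decide),
    hsize 7 (by decide), hsize 8 (by decide), hsize 9 (by decide), hsize 10 (by decide),
    hsize 11 (by decide)]

/-- The constant 10 is three for each of the colors 4 and 5 and one for each of the colors 8 to 11.
-/
lemma Good.countLarge_le {g : ℕ → ℕ} (hg : Good g) :
    countLarge g (List.range 42) ≤ (colorClass g 6).card + (colorClass g 7).card + 10 := by
  obtain ⟨-, -, h1, -, h2⟩ := hg.large (List.Perm.refl _)
  have h4 := hg.card_le_three (k := 4) (by decide)
  have h5 := hg.card_le_three (k := 5) (by decide)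
  have h8 := hg.card_le_one (k := 8) (by decide)
  have h9 := hg.card_le_one (k := 9) (by decide)
  have h10 := hg.card_le_one (k := 10) (by decide)
  have h11 := hg.card_le_one (k := 11) (by decide)
  omega

lemma Good.card_seven_le_two {g : ℕ → ℕ} (hg : Good g) : (colorClass g 7).card ≤ 2 := by
  by_contra hcard
  obtain ⟨u, hu, v, hv, w, hw, huv, huw, hvw⟩ := Finset.two_lt_card.1 (not_le.1 hcard)
  have hcorner := far_triple_eight u (mem_colorClass.1 hu).1 v (mem_colorClass.1 hv).1
    (hg.lt_dist hu hv huv) w (mem_colorClass.1 hw).1 (hg.lt_dist hu hw huw) (hg.lt_dist hv hw hvw)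
  have hmust : ∀ c ∈ [0, 22, 41], 4 ≤ g c := fun c hc => by
    have hc' := hcorner c hc
    simp only [List.mem_cons, List.not_mem_nil, or_false] at hc'
    rcases hc' with rfl | rfl | rfl
    · rw [(mem_colorClass.1 hu).2]; decide
    · rw [(mem_colorClass.1 hv).2]; decide
    · rw [(mem_colorClass.1 hw).2]; decide
  have h6 := hg.card_le_three (k := 6) (by decide)
  have h7 := hg.card_le_three (k := 7) (by decide)
  have hc := hg.countLarge_le
  obtain ⟨_, _, hfalse⟩ := exists_of_check hg.packs hmust (by omega) stagesCorners_check
  exact Bool.false_ne_true hfalse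

/-- The length `c + 12` equals the sum of the maximal class sizes, so all of them are attained; in
particular the colors 5, 6, 7 occur exactly 3, `c` and 2 times, which `leafCheck` excludes. -/
lemma Good.not_leafCheck {g : ℕ → ℕ} (hg : Good g) {c : ℕ} (hc : (colorClass g 6).card ≤ c)
    {R : List ℕ} (hR : R.Perm ((List.range 42).filter fun v => 4 ≤ g v)) :
    leafCheck c R ≠ true := by
  intro h
  obtain ⟨hnd, hp, -, hsize, hlen⟩ := hg.large hR
  have hlen' : R.length = c + 12 := Nat.eq_of_beq_eq_true (both_eq_true.1 h).1
  have h4 := hg.card_le_three (k := 4) (by decide)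
  have h5 := hg.card_le_three (k := 5) (by decide)
  have h7 := hg.card_seven_le_two
  have h8 := hg.card_le_one (k := 8) (by decide)
  have h9 := hg.card_le_one (k := 9) (by decide)
  have h10 := hg.card_le_one (k := 10) (by decide)
  have h11 := hg.card_le_one (k := 11) (by decide)
  refine leafCheck_sound hnd hp ?_ ?_ ?_ h <;> rw [hsize _ (by decide)] <;> omega

lemma Good.corner_ne_six {g : ℕ → ℕ} (hg : Good g) : g 0 ≠ 6 := by
  intro h0
  have h6 := hg.card_le_three (k := 6) (by decide)
  have h7 := hg.card_seven_le_two
  have hc := hg.countLarge_le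
  obtain ⟨R, hR, hleaf⟩ := exists_of_check (must := [0]) hg.packs
    (fun c hc => by rw [List.mem_singleton.1 hc, h0]; decide) (by omega) stagesCorner_check
  exact hg.not_leafCheck h6 hR hleaf

lemma Good.exists_triple_ne_six {g : ℕ → ℕ} (hg : Good g) :
    ∃ c ∈ [20, 40, 2], g c ≠ 6 := by
  by_contra! hne
  have h6 := hg.card_le_three (k := 6) (by decide)
  have h7 := hg.card_seven_le_two
  have hc := hg.countLarge_le
  obtain ⟨R, hR, hleaf⟩ := exists_of_check (must := [20, 40, 2]) hg.packs
    (fun c hc => by rw [hne c hc]; decide) (by omega) stagesTriple_check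
  exact hg.not_leafCheck h6 hR hleaf

/-! ### Symmetries, and the exclusion of 11 colors -/

/-- The rotation of `ST_3^3`. -/
def rotate (v : ℕ) : ℕ :=
  [22, 23, 20, 24, 21, 17, 27, 25, 28, 26, 19, 18, 15, 16, 8, 36, 34, 37, 35, 31, 40, 38, 41, 39,
    33, 32, 29, 30, 14, 9, 6, 10, 7, 3, 13, 11, 12, 5, 4, 1, 2, 0].getD v 0

/-- The reflection of `ST_3^3` that fixes the corner 0. -/
def reflect (v : ℕ) : ℕ :=
  [0, 2, 1, 5, 4, 3, 12, 11, 14, 13, 10, 7, 6, 9, 8, 30, 29, 33, 32, 31, 39, 38, 41, 40, 37, 35,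
    34, 36, 28, 16, 15, 19, 18, 17, 26, 25, 27, 24, 21, 20, 23, 22].getD v 0

lemma rotate_lt : ∀ v < 42, rotate v < 42 := by decide +kernel

lemma reflect_lt : ∀ v < 42, reflect v < 42 := by decide +kernel

lemma dist_rotate : ∀ u < 42, ∀ v < 42, dist (rotate u) (rotate v) = dist u v := by
  decide +kernel

lemma dist_reflect : ∀ u < 42, ∀ v < 42, dist (reflect u) (reflect v) = dist u v := by
  decide +kernel

lemma rotate_inj : ∀ u < 42, ∀ v < 42, rotate u = rotate v → u = v := by decide +kernel

lemma reflect_inj : ∀ u < 42, ∀ v < 42, reflect u = reflect v → u = v := by decide +kernel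

lemma Good.comp {g σ : ℕ → ℕ} (hg : Good g) (hlt : ∀ v < 42, σ v < 42)
    (hdist : ∀ u < 42, ∀ v < 42, dist (σ u) (σ v) = dist u v)
    (hinj : ∀ u < 42, ∀ v < 42, σ u = σ v → u = v) : Good (g ∘ σ) := by
  have hmem : ∀ u ∈ List.range 42, u < 42 ∧ σ u ∈ List.range 42 := fun u hu =>
    ⟨List.mem_range.1 hu, List.mem_range.2 (hlt u (List.mem_range.1 hu))⟩
  refine ⟨⟨fun u hu => (hmem u hu).1, fun u hu => hg.packs.one_le _ (hmem u hu).2,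
    fun u hu v hv huv h => ?_⟩, fun u hu => hg.le _ (hlt u hu)⟩
  have hu' := hmem u hu
  have hv' := hmem v hv
  rw [← hdist u hu'.1 v hv'.1]
  exact hg.packs.lt_dist _ hu'.2 _ hv'.2 (fun hσ => huv (hinj u hu'.1 v hv'.1 hσ)) h

lemma Good.rotate {g : ℕ → ℕ} (hg : Good g) : Good (g ∘ rotate) :=
  hg.comp rotate_lt dist_rotate rotate_inj

lemma Good.reflect {g : ℕ → ℕ} (hg : Good g) : Good (g ∘ reflect) :=
  hg.comp reflect_lt dist_reflect reflect_inj

/-- Rotations carry the corner 0 to the other corners, and the reflection exchanges the two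
exceptional triples, so one search for a corner and one for a triple cover all cases. -/
lemma Good.card_six_le_two {g : ℕ → ℕ} (hg : Good g) : (colorClass g 6).card ≤ 2 := by
  by_contra hcard
  obtain ⟨u, hu, v, hv, w, hw, huv, huw, hvw⟩ := Finset.two_lt_card.1 (not_le.1 hcard)
  have htriple := far_triple_seven u (mem_colorClass.1 hu).1 v (mem_colorClass.1 hv).1
    (hg.lt_dist hu hv huv) w (mem_colorClass.1 hw).1 (hg.lt_dist hu hw huw) (hg.lt_dist hv hw hvw)
  have hsix : ∀ {c}, c ∈ [u, v, w] → g c = 6 := by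
    intro c hc
    simp only [List.mem_cons, List.not_mem_nil, or_false] at hc
    rcases hc with rfl | rfl | rfl
    · exact (mem_colorClass.1 hu).2
    · exact (mem_colorClass.1 hv).2
    · exact (mem_colorClass.1 hw).2
  rcases htriple with ⟨c, hc, h⟩ | h | h
  · have hc6 := hsix h
    have h22 : SierpinskiPacking.rotate 0 = 22 := by decide
    have h41 : SierpinskiPacking.rotate 22 = 41 := by decide
    simp only [List.mem_cons, List.not_mem_nil, or_false] at hc
    rcases hc with rfl | rfl | rfl
    · exact hg.corner_ne_six hc6
    · exact hg.rotate.corner_ne_six (by simpa [h22] using hc6)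
    · exact hg.rotate.rotate.corner_ne_six (by simpa [h22, h41] using hc6)
  · obtain ⟨c, hc, hne⟩ := hg.exists_triple_ne_six
    exact hne (hsix (h c hc))
  · obtain ⟨c, hc, hne⟩ := hg.reflect.exists_triple_ne_six
    have hmem : ∀ c ∈ [20, 40, 2], SierpinskiPacking.reflect c ∈ [39, 23, 1] := by decide
    exact hne (hsix (h _ (hmem c hc)))

theorem not_good (g : ℕ → ℕ) : ¬ Good g := by
  intro hg
  have h6 := hg.card_six_le_two
  have h7 := hg.card_seven_le_two
  have hc := hg.countLarge_le
  obtain ⟨R, hR, hleaf⟩ := exists_of_check (must := []) hg.packs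
    (fun c hc => absurd hc List.not_mem_nil) (by omega) stages_check
  exact hg.not_leafCheck h6 hR hleaf

/-! ### Lower bounds -/

lemma dist_ne_zero : ∀ u < 42, ∀ v < 42, u ≠ v → dist u v ≠ 0 := by decide +kernel

lemma IsPackingInto.packs {n c : ℕ} {f : _ → ℕ}
    (hf : IsPackingInto (sierpinskiTriangleGraph n) c f) {r : ℕ → Word n} {N : ℕ} (hN : N ≤ 42)
    (hr : ∀ u < N, ∀ v < N, dist u v = wordDist n (r u) (r v)) :
    Packs (fun v => f (vertex (r v))) (List.range N) := by
  refine ⟨fun u hu => (List.mem_range.1 hu).trans_le hN, fun u _ => (hf.1 _).1,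
    fun u hu v hv huv h => ?_⟩
  have hu' := List.mem_range.1 hu
  have hv' := List.mem_range.1 hv
  have hne : vertex (r u) ≠ vertex (r v) := fun he => by
    rw [vertex_eq_iff, ← hr u hu' v hv'] at he
    exact dist_ne_zero u (hu'.trans_le hN) v (hv'.trans_le hN) huv he
  have hlt := hf.2 _ _ hne h
  rw [edist_vertex, ← hr u hu' v hv'] at hlt
  exact_mod_cast hlt

/-- The embedding of `ST_3^3` into `ST_3^{k+3}` as the copy at the corner `0`. -/
def embed : (k : ℕ) → Word 3 → Word (3 + k)
  | 0, u => u
  | k + 1, u => pre 0 (embed k u)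

/-- The embedding is isometric because words with the same first letter have the distance of their
tails. -/
lemma wordDist_embed (k : ℕ) (u v : Word 3) :
    wordDist (3 + k) (embed k u) (embed k v) = wordDist 3 u v := by
  induction k with
  | zero => rfl
  | succ k ih => rw [← ih]; rfl

theorem twelve_le_packingChromaticNumber {n : ℕ} (hn : 3 ≤ n) :
    12 ≤ packingChromaticNumber (sierpinskiTriangleGraph n) := by
  obtain ⟨k, rfl⟩ := Nat.exists_eq_add_of_le hn
  refine le_packingChromaticNumber (c := 11) fun f hf => ?_
  refine not_good (fun v => f (vertex (embed k (rep v))))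
    ⟨hf.packs le_rfl ?_, fun _ _ => (hf.1 _).2⟩
  exact fun u _ v _ => (wordDist_embed k _ _).symm

/-- In ST_3^2, of diameter 4, every large color occurs at most once, but the search shows that at
least five vertices are large. The four colors 4 to 7 do not suffice. -/
theorem eight_le_packingChromaticNumber :
    8 ≤ packingChromaticNumber (sierpinskiTriangleGraph 2) := by
  refine le_packingChromaticNumber (c := 7) fun f hf => ?_
  have hp := hf.packs (r := fun v => Fin.tail (rep v)) (N := 15) (by decide) (by decide +kernel)
  have hle : ∀ v, f (vertex (Fin.tail (rep v))) ≤ 7 := fun v => (hf.1 _).2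
  generalize hg : (fun v => f (vertex (Fin.tail (rep v)))) = g at hp
  replace hle : ∀ v, g v ≤ 7 := fun v => by rw [← hg]; exact hle v
  -- These are the bounds used for the copy 0 in `stages false false false`.
  let s : List (ℕ × ℕ) := [(13, 5), (12, 4), (14, 3), (11, 3), (10, 3), (5, 2), (9, 2), (7, 1),
    (8, 1), (6, 1), (4, 1), (3, 0), (2, 0), (1, 0), (0, 0)]
  have hperm : (verts s).Perm (List.range 15) := by decide
  have hb : Bounded g s := by
    refine validate_sound (non := []) (l := []) (by decide +kernel) (by simp) (List.Subset.refl _)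
      List.nodup_nil (hperm.nodup_iff.2 List.nodup_range)
      (hp.mono (by simpa using hperm.subset)) (by decide +kernel)
  have hcount : 5 ≤ countLarge g (List.range 15) := hb.1.trans_eq (hperm.countP_eq _)
  have hdiam : ∀ u < 15, ∀ v < 15, dist u v ≤ 4 := by decide +kernel
  have hcard : countLarge g (List.range 15) ≤ (Finset.Icc 4 7).card := by
    have h : countLarge g (List.range 15) = ((Finset.range 15).filter fun v => 4 ≤ g v).card := by
      have h' : ((Finset.range 15).filter fun v => 4 ≤ g v) =
          ((List.range 15).filter fun v => 4 ≤ g v).toFinset := by ext v; simp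
      rw [h', List.toFinset_card_of_nodup (List.nodup_range.filter _), countLarge,
        List.countP_eq_length_filter]
    rw [h]
    refine Finset.card_le_card_of_injOn g (fun v hv => ?_) fun u hu v hv huv =>
      by_contra fun hne => ?_
    · simp only [Finset.coe_filter, Set.mem_ofPred_eq] at hv
      simpa using ⟨hv.2, hle v⟩
    · simp only [Finset.coe_filter, Set.mem_ofPred_eq, Finset.mem_range] at hu hv
      have h1 := hp.lt_dist u (List.mem_range.2 hu.1) v (List.mem_range.2 hv.1) hne huv
      have h2 := hdiam u hu.1 v hv.1
      omega
  simp at hcard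
  omega

/-- The verified bound 1 at the head of the list says that the six vertices cannot be colored with
1, 2, 3 alone. -/
theorem four_le_packingChromaticNumber :
    4 ≤ packingChromaticNumber (sierpinskiTriangleGraph 1) := by
  refine le_packingChromaticNumber (c := 3) fun f hf => ?_
  have hp := hf.packs (r := fun v => Fin.tail (Fin.tail (rep v))) (N := 6) (by decide)
    (by decide +kernel)
  have hb := validate_sound (s := [(0, 1), (1, 1), (2, 0), (3, 0), (4, 0), (5, 0)]) (non := [])
    (l := []) (by decide +kernel) (by simp) (List.Subset.refl _) List.nodup_nil
    (by decide) hp (by decide +kernel)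
  obtain ⟨v, -, hv⟩ := List.countP_pos_iff.1 hb.1
  rw [decide_eq_true_eq] at hv
  exact absurd (hv.trans (hf.1 _).2) (by decide)

theorem three_le_packingChromaticNumber :
    3 ≤ packingChromaticNumber (sierpinskiTriangleGraph 0) := by
  refine le_packingChromaticNumber (c := 2) fun f hf => ?_
  have hne : ∀ i j : Fin 3, i ≠ j → f (vertex (corner 0 i)) ≠ f (vertex (corner 0 j)) := by
    intro i j hij h
    have hd : wordDist 0 (corner 0 i) (corner 0 j) = 1 := if_neg hij
    have hlt := hf.2 _ _ (fun he => by rw [vertex_eq_iff, hd] at he; exact one_ne_zero he) h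
    rw [edist_vertex, hd] at hlt
    have hlt' : f (vertex (corner 0 i)) < 1 := by exact_mod_cast hlt
    have := (hf.1 (vertex (corner 0 i))).1
    omega
  have h01 := hne 0 1 (by decide)
  have h02 := hne 0 2 (by decide)
  have h12 := hne 1 2 (by decide)
  have h0 := hf.1 (vertex (corner 0 0))
  have h1 := hf.1 (vertex (corner 0 1))
  have h2 := hf.1 (vertex (corner 0 2))
  omega

end SierpinskiPacking

theorem mainTheorem1 :
    (SierpinskiPacking.packingChromaticNumber (SierpinskiPacking.sierpinskiTriangleGraph 0) = 3 ∧
      SierpinskiPacking.packingChromaticNumber (SierpinskiPacking.sierpinskiTriangleGraph 1) = 4 ∧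
      SierpinskiPacking.packingChromaticNumber (SierpinskiPacking.sierpinskiTriangleGraph 2) = 8 ∧
      SierpinskiPacking.packingChromaticNumber (SierpinskiPacking.sierpinskiTriangleGraph 3) = 12) ∧
    (12 ≤ SierpinskiPacking.packingChromaticNumber (SierpinskiPacking.sierpinskiTriangleGraph 4) ∧
      SierpinskiPacking.packingChromaticNumber (SierpinskiPacking.sierpinskiTriangleGraph 4) ≤ 15) ∧
    (12 ≤ SierpinskiPacking.packingChromaticNumber (SierpinskiPacking.sierpinskiTriangleGraph 5) ∧
      SierpinskiPacking.packingChromaticNumber (SierpinskiPacking.sierpinskiTriangleGraph 5) ≤ 19) ∧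
    (∀ n : ℕ, 6 ≤ n →
      12 ≤ SierpinskiPacking.packingChromaticNumber
          (SierpinskiPacking.sierpinskiTriangleGraph n) ∧
        SierpinskiPacking.packingChromaticNumber
          (SierpinskiPacking.sierpinskiTriangleGraph n) ≤ 20) := by
  exact ⟨⟨le_antisymm SierpinskiPacking.packingChromaticNumber_zero_le
      SierpinskiPacking.three_le_packingChromaticNumber,
    le_antisymm SierpinskiPacking.packingChromaticNumber_one_le
      SierpinskiPacking.four_le_packingChromaticNumber,
    le_antisymm SierpinskiPacking.packingChromaticNumber_two_le
      SierpinskiPacking.eight_le_packingChromaticNumber,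
    le_antisymm SierpinskiPacking.packingChromaticNumber_three_le
      (SierpinskiPacking.twelve_le_packingChromaticNumber le_rfl)⟩,
    ⟨SierpinskiPacking.twelve_le_packingChromaticNumber (by norm_num),
      SierpinskiPacking.packingChromaticNumber_four_le⟩,
    ⟨SierpinskiPacking.twelve_le_packingChromaticNumber (by norm_num),
      SierpinskiPacking.packingChromaticNumber_five_le⟩,
    fun _ hn => ⟨SierpinskiPacking.twelve_le_packingChromaticNumber (by omega),
      SierpinskiPacking.packingChromaticNumber_le_of_six_le hn⟩⟩
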